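/- **Setting.** Let $n\in\{1,2,3\}$, let $\Omega\subset\mathbb R^n$ be a bounded polytopal Lipschitz domain (an interval if $n=1$), let $\Gamma_{\mathrm D}\subset\partial\Omega$ be a union of finitely many, and at least one, closed faces of $\Omega$, and let $\Gamma_{\mathrm N}$ be the union of the remaining faces. Let $I=(0,1)$, $Q=\Omega\times I$, and let $H^1_{\Gamma_{\mathrm D}}(\Omega)$ be the space of $v\in H^1(\Omega)$ that vanish on $\Gamma_{\mathrm D}$. Let $A\in L^\infty(\Omega;\mathbb R^{n\times n}_{\mathrm{sym}})$ be uniformly positive definite, and $\mathcal L_x=-\nabla_x\cdot(A\nabla_x)$. For $k\in\mathbb N_0$ put $\lambda_k=(\frac\pi2+k\pi)^2$, $V_k(t)=\sqrt2\sin(\sqrt{\lambda_k}\,t)$, $W_k(t)=\sqrt2\cos(\sqrt{\lambda_k}\,t)$. For a Hilbert space $H$, $H^{1/2}_{0,}(I;H)$ and $H^{1/2}_{,0}(I;H)$ are the spaces of those $v\in L^2(I;H)$ for which the norms $$\|v\|^2_{H^{1/2}_{0,}(I;H)}=\sum_{k\ge0}\lambda_k^{1/2}\Big\|\int_I v\,V_k\,dt\Big\|_H^2,\qquad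 \|v\|^2_{H^{1/2}_{,0}(I;H)}=\sum_{k\ge0}\lambda_k^{1/2}\Big\|\int_I v\,W_k\,dt\Big\|_H^2$$ are finite. The modified Hilbert transform is $\mathcal H_Tv=\sum_k\big(\int_I v\,V_k\,dt\big)W_k$. Let $X_{0,}=L^2(I;H^1_{\Gamma_{\mathrm D}}(\Omega))\cap H^{1/2}_{0,}(I;L^2(\Omega))$ and $X_{,0}=L^2(I;H^1_{\Gamma_{\mathrm D}}(\Omega))\cap H^{1/2}_{,0}(I;L^2(\Omega))$ with the sum norms, and $$b(v,w)=\langle\partial_t v,w\rangle_Q+\langle A\nabla_xv,\nabla_xw\rangle_{L^2(Q)^n},$$ where $\langle\partial_tv,w\rangle_Q$ is the continuous extension of $\int_Q \partial_t v\,w$ to $v\in H^{1/2}_{0,}(I;L^2(\Omega))$, $w\in H^{1/2}_{,0}(I;L^2(\Omega))$. Let $f\in[X_{,0}]'$ and let $u\in X_{0,}$ solve $b(u,w)=\langle f,w\rangle$ for all $w\in X_{,0}$. **Discretization.** Let $d\ge2$, $0\le r\le d-2$ and $p_x\ge1$. For $N\ge1$ and $h^t=1/N$ let $S^t$ be the space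 of $v\in C^r([0,1])$ that are polynomials of degree at most $d-1$ on each interval $[\frac{\ell-1}N,\frac{\ell}N]$, $1\le\ell\le N$, and satisfy $v(0)=0$ (so $r=0$ gives all continuous splines and $r=d-2$ the B-spline space of order $d$). For a finite face-to-face decomposition of $\overline\Omega$ into $n$-simplices with maximal diameter $h^x$ let $S^x$ be the space of continuous functions on $\overline\Omega$ that are polynomials of degree at most $p_x$ on each simplex and vanish on $\Gamma_{\mathrm D}$. The Ritz projection $P^x:H^1_{\Gamma_{\mathrm D}}(\Omega)\to S^x$ is given by $\langle A\nabla P^xz,\nabla w\rangle_{L^2(\Omega)^n}=\langle A\nabla z,\nabla w\rangle_{L^2(\Omega)^n}$ for all $w\in S^x$. The Galerkin approximation $u_h\in S^x\otimes S^t$ is given by $b(u_h,\mathcal H_Tv)=\langle f,\mathcal H_Tv\rangle$ for all $v\in S^x\otimes S^t$. **Corollary 3.2.** Assume that $u\in H^{1/2}_{0,}(I;H^{p_x+1/2}(\Omega))\cap H^d(I;L^2(\Omega))$ and that $\mathcal L_xu\in H^{d-1}(I;L^2(\Omega))$; here $\mathcal L_xu=g\in L^2(Q)$ means that $\langle A\nabla_xu,\nabla_xw\rangle_{L^2(Q)^n}=\langle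 g,w\rangle_{L^2(Q)}$ for all $w\in L^2(I;H^1_{\Gamma_{\mathrm D}}(\Omega))$, i.e. $-\nabla_x\cdot(A\nabla_xu)=g$ in $Q$ with homogeneous conormal derivative on $\Gamma_{\mathrm N}\times I$ in the weak sense. Let $c>0$. Then there is a constant $C>0$ such that for every $N\ge1$ and every decomposition as above whose Ritz projection satisfies $$\|u-(\mathrm{Id}_t\otimes P^x)u\|_{H^{1/2}_{0,}(I;L^2(\Omega))}\le c\,(h^x)^{p_x+1/2}\,\|u\|_{H^{1/2}_{0,}(I;H^{p_x+1/2}(\Omega))},$$ the error estimate $$\|u-u_h\|_{H^{1/2}_{0,}(I;L^2(\Omega))}\le C\big[(h^t)^{d-1/2}+(h^x)^{p_x+1/2}\big]$$ holds. In particular $C$ is independent of $h^t$, of $h^x$ and of the decomposition. -/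

import Mathlib

open MeasureTheory Set Filter Topology
open scoped ENNReal NNReal ContDiff

noncomputable section

namespace SpaceTime

/-! ### The spatial domain, its Dirichlet boundary, and the diffusion coefficient -/

/-- The Euclidean space `ℝⁿ`. -/
abbrev Eu (n : ℕ) : Type := EuclideanSpace ℝ (Fin n)

/-- `Ω` has a Lipschitz boundary: near each boundary point, in suitable Cartesian coordinates with
vertical unit direction `e`, it is the strict epigraph of a Lipschitz function `γ` of the
horizontal part `x - ⟪e, x⟫ e` of the variable. -/
def HasLipschitzBoundary {n : ℕ} (Ω : Set (Eu n)) : Prop :=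
  ∀ x₀ ∈ frontier Ω, ∃ (ρ : ℝ) (e : Eu n) (γ : Eu n → ℝ) (K : ℝ≥0),
    0 < ρ ∧ ‖e‖ = 1 ∧ LipschitzWith K γ ∧
    ∀ x ∈ Metric.ball x₀ ρ, (x ∈ Ω ↔ γ (x - inner ℝ e x • e) < inner ℝ e x)

/-- The points of the hyperplane `H` near which `H` is contained in the boundary of `Ω`. -/
def flatPart {n : ℕ} (Ω : Set (Eu n)) (H : AffineSubspace ℝ (Eu n)) : Set (Eu n) :=
  {x | x ∈ H ∧ ∃ ε > 0, Metric.ball x ε ∩ (H : Set (Eu n)) ⊆ frontier Ω}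

/-- `F` is a (closed) face of `Ω`: the closure of a connected component of the flat part of the
boundary in some hyperplane. For `n = 1` the faces are the boundary points, for `n = 2` the closed
sides of a polygon, for `n = 3` the closed faces of a polyhedron. -/
def IsFace {n : ℕ} (Ω F : Set (Eu n)) : Prop :=
  ∃ H : AffineSubspace ℝ (Eu n), Module.finrank ℝ H.direction + 1 = n ∧
    ∃ x ∈ flatPart Ω H, F = closure (connectedComponentIn (flatPart Ω H) x)

/-- Bounded polytopal Lipschitz domains of `ℝⁿ`: intervals for `n = 1`, polygons for `n = 2`,
polyhedra for `n = 3`. -/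
structure IsPolytopalLipschitzDomain {n : ℕ} (Ω : Set (Eu n)) : Prop where
  isOpen : IsOpen Ω
  isConnected : IsConnected Ω
  isBounded : Bornology.IsBounded Ω
  lipschitz : HasLipschitzBoundary Ω
  polytopal : ∃ 𝓕 : Set (Set (Eu n)), 𝓕.Finite ∧ (∀ F ∈ 𝓕, IsFace Ω F) ∧ frontier Ω = ⋃₀ 𝓕

/-- The Dirichlet part `Γ` of the boundary is a union of finitely many, and at least one, faces;
the Neumann part consists of the remaining faces (if there are any). -/
def IsDirichletPart {n : ℕ} (Ω Γ : Set (Eu n)) : Prop :=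
  ∃ 𝓕 : Set (Set (Eu n)), 𝓕.Finite ∧ 𝓕.Nonempty ∧ (∀ F ∈ 𝓕, IsFace Ω F) ∧ Γ = ⋃₀ 𝓕

/-- `A ∈ L^∞(Ω; ℝ^{n×n}_sym)` is uniformly positive definite. -/
structure IsDiffusionCoefficient {n : ℕ} (Ω : Set (Eu n))
    (A : Eu n → Matrix (Fin n) (Fin n) ℝ) : Prop where
  measurable : ∀ i j, AEStronglyMeasurable (fun x => A x i j) (volume.restrict Ω)
  bounded : ∃ M : ℝ, ∀ᵐ x ∂(volume.restrict Ω), ∀ i j, |A x i j| ≤ M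
  symm : ∀ᵐ x ∂(volume.restrict Ω), (A x).IsSymm
  coercive : ∃ α : ℝ, 0 < α ∧ ∀ᵐ x ∂(volume.restrict Ω), ∀ ξ : Fin n → ℝ,
    α * (ξ ⬝ᵥ ξ) ≤ ξ ⬝ᵥ Matrix.mulVec (A x) ξ

/-! ### Spatial function spaces -/

/-- `L²(Ω)`. -/
abbrev L2 {n : ℕ} (Ω : Set (Eu n)) : Type := Lp ℝ 2 (volume.restrict Ω)

/-- `L²(Ω)ⁿ`. -/
abbrev L2Vec {n : ℕ} (Ω : Set (Eu n)) : Type := Lp (Eu n) 2 (volume.restrict Ω)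

/-- `H¹_Γ(Ω)`: the functions in `H¹(Ω)` which vanish on `Γ`, i.e. the closure in `H¹(Ω)` of the
restrictions to `Ω` of smooth functions with compact support in `ℝⁿ ∖ Γ`. A function `v` is stored
as the pair `(v, ∇v)`, so that the norm is the `H¹(Ω)`-norm (equivalent on this space to the
seminorm `‖∇v‖` whenever `Γ` contains a face). -/
abbrev H1D {n : ℕ} (Ω Γ : Set (Eu n)) : Submodule ℝ (WithLp 2 (L2 Ω × L2Vec Ω)) :=
  (Submodule.span ℝ {z : WithLp 2 (L2 Ω × L2Vec Ω) |
    ∃ φ : Eu n → ℝ, ContDiff ℝ ∞ φ ∧ HasCompactSupport φ ∧ Disjoint (tsupport φ) Γ ∧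
      (⇑z.fst =ᵐ[volume.restrict Ω] φ) ∧
      (⇑z.snd =ᵐ[volume.restrict Ω] gradient φ)}).topologicalClosure

/-- The embedding `H¹_Γ(Ω) → L²(Ω)`. -/
def toL2 {n : ℕ} (Ω Γ : Set (Eu n)) : H1D Ω Γ →L[ℝ] L2 Ω :=
  (WithLp.fstL 2 ℝ (L2 Ω) (L2Vec Ω)).comp (H1D Ω Γ).subtypeL

/-- The gradient `∇ : H¹_Γ(Ω) → L²(Ω)ⁿ`. -/
def grad {n : ℕ} (Ω Γ : Set (Eu n)) : H1D Ω Γ →L[ℝ] L2Vec Ω :=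
  (WithLp.sndL 2 ℝ (L2 Ω) (L2Vec Ω)).comp (H1D Ω Γ).subtypeL

/-- The form `⟨A ∇z, ∇w⟩_{L²(Ω)ⁿ}`. -/
def aForm {n : ℕ} {Ω Γ : Set (Eu n)} (A : Eu n → Matrix (Fin n) (Fin n) ℝ) (z w : H1D Ω Γ) : ℝ :=
  ∫ x in Ω, Matrix.mulVec (A x) (grad Ω Γ z x).ofLp ⬝ᵥ (grad Ω Γ w x).ofLp

/-- `g` is the weak partial derivative `∂_{i 0} ⋯ ∂_{i (k-1)} v` in `Ω`. -/
def HasWeakDeriv {n k : ℕ} (Ω : Set (Eu n)) (i : Fin k → Fin n) (v g : L2 Ω) : Prop :=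
  ∀ φ : Eu n → ℝ, ContDiff ℝ ∞ φ → HasCompactSupport φ → tsupport φ ⊆ Ω →
    ∫ x in Ω, v x * iteratedFDeriv ℝ k φ x (fun j => EuclideanSpace.single (i j) (1 : ℝ)) =
      (-1) ^ k * ∫ x in Ω, g x * φ x

/-- The square of the `H^{1/2}(Ω)`-seminorm (Sobolev–Slobodeckij). -/
def slobodeckijSq {n : ℕ} (Ω : Set (Eu n)) (w : L2 Ω) : ℝ≥0∞ :=
  ∫⁻ x in Ω, ∫⁻ y in Ω, ENNReal.ofReal (|w x - w y| ^ 2 / ‖x - y‖ ^ (n + 1))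

/-- The square of the norm of `H^{m+1/2}(Ω)`: all weak partial derivatives up to the order `m` in
`L²(Ω)`, those of order `m` also in the `H^{1/2}(Ω)`-seminorm. The value is `∞` exactly when `v`
does not belong to `H^{m+1/2}(Ω)`; otherwise the infimum is over the single family `D` of the weak
derivatives of `v`. -/
def sobolevHalfSq {n : ℕ} (Ω : Set (Eu n)) (m : ℕ) (v : L2 Ω) : ℝ≥0∞ :=
  ⨅ (D : (k : ℕ) → (Fin k → Fin n) → L2 Ω) (_ : ∀ k ≤ m, ∀ i, HasWeakDeriv Ω i v (D k i)),
    (∑ k ∈ Finset.range (m + 1), ∑ i : Fin k → Fin n, ‖D k i‖ₑ ^ 2) +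
      ∑ i : Fin m → Fin n, slobodeckijSq Ω (D m i)

/-! ### Bochner spaces over the time interval `I = (0,1)` -/

/-- Lebesgue measure on `I = (0,1)`. -/
abbrev timeMeasure : Measure ℝ := volume.restrict (Ioo (0 : ℝ) 1)

/-- `L²(I; H)`. -/
abbrev L2I (H : Type*) [NormedAddCommGroup H] : Type _ := Lp H 2 timeMeasure

/-- `√λ_k = π/2 + kπ`. -/
def freq (k : ℕ) : ℝ := Real.pi / 2 + k * Real.pi

/-- `V_k(t) = √2 sin((π/2 + kπ) t)`, an eigenfunction for the eigenvalue `λ_k`. -/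
def sinFun (k : ℕ) (t : ℝ) : ℝ := √2 * Real.sin (freq k * t)

/-- `W_k(t) = √2 cos((π/2 + kπ) t)`. -/
def cosFun (k : ℕ) (t : ℝ) : ℝ := √2 * Real.cos (freq k * t)

section Bochner

variable {H : Type*} [NormedAddCommGroup H] [InnerProductSpace ℝ H]

/-- The coefficient `u_k = ∫_I V_k(t) u(t) dt ∈ H`. -/
def sinCoeff (u : L2I H) (k : ℕ) : H := ∫ t, sinFun k t • u t ∂timeMeasure

/-- The coefficient `w_k = ∫_I W_k(t) w(t) dt ∈ H`. -/
def cosCoeff (w : L2I H) (k : ℕ) : H := ∫ t, cosFun k t • w t ∂timeMeasure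

/-- The norm of `H^{1/2}_{0,}(I; H)`, with the value `∞` for `u` not in this space:
`‖u‖² = ∑ λ_k^{1/2} ‖u_k‖²`. -/
def normZeroLeft (u : L2I H) : ℝ≥0∞ :=
  (∑' k, ENNReal.ofReal (freq k) * ‖sinCoeff u k‖ₑ ^ 2) ^ (1 / 2 : ℝ)

/-- The norm of `H^{1/2}_{,0}(I; H)`, with the value `∞` for `w` not in this space:
`‖w‖² = ∑ λ_k^{1/2} ‖w_k‖²`. -/
def normZeroRight (w : L2I H) : ℝ≥0∞ :=
  (∑' k, ENNReal.ofReal (freq k) * ‖cosCoeff w k‖ₑ ^ 2) ^ (1 / 2 : ℝ)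

/-- The duality pairing `⟨∂_t u, w⟩` for `u ∈ H^{1/2}_{0,}(I; H)`, `w ∈ H^{1/2}_{,0}(I; H)`: since
`∂_t V_k = √λ_k W_k`, the continuous extension of `∫_I ⟨∂_t u, w⟩` is `∑ √λ_k ⟨u_k, w_k⟩`. -/
def timePairing (u w : L2I H) : ℝ :=
  ∑' k, freq k * inner ℝ (sinCoeff u k) (cosCoeff w k)

lemma hasDerivAt_sinFun (k : ℕ) (t : ℝ) : HasDerivAt (sinFun k) (freq k * cosFun k t) t := by
  unfold sinFun cosFun
  have h := (((hasDerivAt_id t).const_mul (freq k)).sin).const_mul √2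
  have e : freq k * (√2 * Real.cos (freq k * t)) =
      √2 * (Real.cos (freq k * id t) * (freq k * 1)) := by
    rw [id]; ring
  rw [e]
  exact h

lemma continuous_cosFun (k : ℕ) : Continuous (cosFun k) := by
  unfold cosFun; fun_prop

lemma abs_cosFun_le (k : ℕ) (t : ℝ) : |cosFun k t| ≤ √2 := by
  unfold cosFun
  rw [abs_mul, abs_of_nonneg (Real.sqrt_nonneg 2)]
  exact mul_le_of_le_one_right (Real.sqrt_nonneg 2) (Real.abs_cos_le_one _)

lemma memLp_cosFun_smul (k : ℕ) (h : H) :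
    MemLp (fun t => cosFun k t • h) 2 timeMeasure := by
  refine MemLp.of_bound (C := √2 * ‖h‖) ?_ ?_
  · exact ((continuous_cosFun k).smul continuous_const).aestronglyMeasurable
  · refine Eventually.of_forall fun t => ?_
    rw [norm_smul]
    exact mul_le_mul_of_nonneg_right (abs_cosFun_le k t) (norm_nonneg h)

/-- The modified Hilbert transform `ℋ_T u = ∑ u_k W_k` (the series converges in `L²(I; H)`). -/
def hilbertT (u : L2I H) : L2I H :=
  ∑' k, (memLp_cosFun_smul k (sinCoeff u k)).toLp (fun t => cosFun k t • sinCoeff u k)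

/-- `u ∈ H^m(I; H)`: the weak time derivatives of order at most `m` belong to `L²(I; H)`. -/
def MemSobolevTime (m : ℕ) (u : L2I H) : Prop :=
  ∀ k ≤ m, ∃ g : L2I H, ∀ φ : ℝ → ℝ, ContDiff ℝ ∞ φ → HasCompactSupport φ →
    tsupport φ ⊆ Ioo (0 : ℝ) 1 →
    ∫ t, iteratedDeriv k φ t • u t ∂timeMeasure = (-1 : ℝ) ^ k • ∫ t, φ t • g t ∂timeMeasure

lemma integrable_cosFun_smul (k : ℕ) (w : L2I H) :
    Integrable (fun t => cosFun k t • w t) timeMeasure := by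
  refine Integrable.bdd_smul ((Lp.memLp w).integrable (by norm_num)) √2
    (continuous_cosFun k).aestronglyMeasurable ?_
  exact Eventually.of_forall fun t => abs_cosFun_le k t

lemma cosCoeff_add (v w : L2I H) (k : ℕ) : cosCoeff (v + w) k = cosCoeff v k + cosCoeff w k := by
  unfold cosCoeff
  rw [← integral_add (integrable_cosFun_smul k v) (integrable_cosFun_smul k w)]
  refine integral_congr_ae ?_
  filter_upwards [Lp.coeFn_add v w] with t ht
  rw [ht, Pi.add_apply, smul_add]

lemma cosCoeff_smul (c : ℝ) (w : L2I H) (k : ℕ) : cosCoeff (c • w) k = c • cosCoeff w k := by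
  unfold cosCoeff
  rw [← integral_smul]
  refine integral_congr_ae ?_
  filter_upwards [Lp.coeFn_smul c w] with t ht
  rw [ht, Pi.smul_apply, smul_comm]

lemma normZeroRight_lt_top_iff (w : L2I H) :
    normZeroRight w < ⊤ ↔ ∑' k, ENNReal.ofReal (freq k) * ‖cosCoeff w k‖ₑ ^ 2 < ⊤ := by
  unfold normZeroRight
  exact ENNReal.rpow_lt_top_iff_of_pos (by norm_num)

lemma normZeroRight_zero : normZeroRight (0 : L2I H) < ⊤ := by
  rw [normZeroRight_lt_top_iff]
  have h : ∀ k, cosCoeff (0 : L2I H) k = 0 := fun k => by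
    simpa using cosCoeff_smul (0 : ℝ) (0 : L2I H) k
  simp [h]

lemma normZeroRight_add {v w : L2I H} (hv : normZeroRight v < ⊤) (hw : normZeroRight w < ⊤) :
    normZeroRight (v + w) < ⊤ := by
  rw [normZeroRight_lt_top_iff] at *
  have key : ∀ k, ENNReal.ofReal (freq k) * ‖cosCoeff (v + w) k‖ₑ ^ 2 ≤
      2 * (ENNReal.ofReal (freq k) * ‖cosCoeff v k‖ₑ ^ 2) +
      2 * (ENNReal.ofReal (freq k) * ‖cosCoeff w k‖ₑ ^ 2) := fun k => by
    have h1 : ‖cosCoeff (v + w) k‖ₑ ^ 2 ≤ 2 * (‖cosCoeff v k‖ₑ ^ 2 + ‖cosCoeff w k‖ₑ ^ 2) := by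
      rw [cosCoeff_add]
      have h2 := ENNReal.rpow_add_le_mul_rpow_add_rpow ‖cosCoeff v k‖ₑ ‖cosCoeff w k‖ₑ
        (p := 2) (by norm_num)
      norm_num at h2
      exact (pow_le_pow_left' (enorm_add_le _ _) 2).trans h2
    calc _ ≤ ENNReal.ofReal (freq k) *
        (2 * (‖cosCoeff v k‖ₑ ^ 2 + ‖cosCoeff w k‖ₑ ^ 2)) := by gcongr
      _ = _ := by ring
  refine (ENNReal.tsum_le_tsum key).trans_lt ?_
  rw [ENNReal.tsum_add, ENNReal.tsum_mul_left, ENNReal.tsum_mul_left]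
  exact ENNReal.add_lt_top.2
    ⟨ENNReal.mul_lt_top (by norm_num) hv, ENNReal.mul_lt_top (by norm_num) hw⟩

lemma normZeroRight_smul (c : ℝ) {w : L2I H} (hw : normZeroRight w < ⊤) :
    normZeroRight (c • w) < ⊤ := by
  rw [normZeroRight_lt_top_iff] at *
  have key : ∀ k, ENNReal.ofReal (freq k) * ‖cosCoeff (c • w) k‖ₑ ^ 2 =
      ‖c‖ₑ ^ 2 * (ENNReal.ofReal (freq k) * ‖cosCoeff w k‖ₑ ^ 2) := fun k => by
    rw [cosCoeff_smul, enorm_smul, mul_pow]; ring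
  simp_rw [key]
  rw [ENNReal.tsum_mul_left]
  exact ENNReal.mul_lt_top (by simp) hw

end Bochner

/-! ### The space-time variational formulation -/

section Variational

variable {n : ℕ} {Ω Γ : Set (Eu n)}

/-- The embedding `L²(I; H¹_Γ(Ω)) → L²(I; L²(Ω)) = L²(Q)`. -/
def toL2Q (u : L2I (H1D Ω Γ)) : L2I (L2 Ω) := (toL2 Ω Γ).compLp u

/-- The norm of `H^{1/2}_{0,}(I; H^{m+1/2}(Ω)) ≃ H^{m+1/2}(Ω) ⊗ H^{1/2}_{0,}(I)`, with the value
`∞` for `u` not in this space. -/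
def normZeroLeftSobolev (m : ℕ) (u : L2I (L2 Ω)) : ℝ≥0∞ :=
  (∑' k, ENNReal.ofReal (freq k) * sobolevHalfSq Ω m (sinCoeff u k)) ^ (1 / 2 : ℝ)

variable (Ω Γ) in
/-- The test space `H^{1,1/2}_{Γ;,0}(Q) = L²(I; H¹_Γ(Ω)) ∩ H^{1/2}_{,0}(I; L²(Ω))`. -/
def TestSpace : Submodule ℝ (L2I (H1D Ω Γ)) where
  carrier := {w | normZeroRight (toL2Q w) < ⊤}
  zero_mem' := by
    have h : toL2Q (0 : L2I (H1D Ω Γ)) = 0 := ((toL2 Ω Γ).compLpL 2 timeMeasure).map_zero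
    change normZeroRight (toL2Q 0) < ⊤
    rw [h]
    exact normZeroRight_zero
  add_mem' {v w} hv hw := by
    have h : toL2Q (v + w) = toL2Q v + toL2Q w :=
      ((toL2 Ω Γ).compLpL 2 timeMeasure).map_add v w
    change normZeroRight (toL2Q (v + w)) < ⊤
    rw [h]
    exact normZeroRight_add hv hw
  smul_mem' c w hw := by
    have h : toL2Q (c • w) = c • toL2Q w :=
      ((toL2 Ω Γ).compLpL 2 timeMeasure).map_smul c w
    change normZeroRight (toL2Q (c • w)) < ⊤
    rw [h]
    exact normZeroRight_smul c hw

/-- The linear functional `f` belongs to the dual of `H^{1,1/2}_{Γ;,0}(Q)`: it is bounded with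
respect to the sum norm. -/
def IsBoundedFunctional (f : TestSpace Ω Γ →ₗ[ℝ] ℝ) : Prop :=
  ∃ M : ℝ, ∀ w : TestSpace Ω Γ,
    |f w| ≤ M * (‖w.1‖ + (normZeroRight (toL2Q w.1)).toReal)

/-- `⟨A ∇_x u, ∇_x w⟩_{L²(Q)ⁿ}`. -/
def aFormQ (A : Eu n → Matrix (Fin n) (Fin n) ℝ) (u w : L2I (H1D Ω Γ)) : ℝ :=
  ∫ t, aForm A (u t) (w t) ∂timeMeasure

/-- `b(u, w) = ⟨∂_t u, w⟩_Q + ⟨A ∇_x u, ∇_x w⟩_{L²(Q)ⁿ}`. -/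
def bForm (A : Eu n → Matrix (Fin n) (Fin n) ℝ) (u w : L2I (H1D Ω Γ)) : ℝ :=
  timePairing (toL2Q u) (toL2Q w) + aFormQ A u w

/-- `u ∈ H^{1,1/2}_{Γ;0,}(Q)` and `b(u, w) = ⟨f, w⟩_Q` for all `w ∈ H^{1,1/2}_{Γ;,0}(Q)`. -/
def IsWeakSolution (A : Eu n → Matrix (Fin n) (Fin n) ℝ) (f : TestSpace Ω Γ →ₗ[ℝ] ℝ)
    (u : L2I (H1D Ω Γ)) : Prop :=
  normZeroLeft (toL2Q u) < ⊤ ∧ ∀ w : TestSpace Ω Γ, bForm A u w.1 = f w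

/-- `ℒ_x u = g ∈ L²(Q)` for the operator `ℒ_x = -∇_x · (A ∇_x)` with homogeneous conormal
derivative on the Neumann part of the boundary, in weak form. -/
def IsEllipticImage (A : Eu n → Matrix (Fin n) (Fin n) ℝ) (u : L2I (H1D Ω Γ))
    (g : L2I (L2 Ω)) : Prop :=
  ∀ w : L2I (H1D Ω Γ), aFormQ A u w = ∫ t, inner ℝ (g t) (toL2Q w t) ∂timeMeasure

/-! ### The discrete spaces and the Galerkin method -/

/-- The temporal spline space `S^t` of order `d` on the uniform mesh with `N` elements: functions in
`C^r([0,1])` which are polynomials of degree at most `d - 1` on each element and vanish at `0`. -/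
def temporalSpace (d r N : ℕ) : Set (ℝ → ℝ) :=
  {φ | ContDiffOn ℝ r φ (Icc 0 1) ∧ φ 0 = 0 ∧
    ∀ l < N, ∃ q : Polynomial ℝ, q.degree < d ∧
      ∀ t ∈ Icc ((l : ℝ) / N) (((l : ℝ) + 1) / N), φ t = q.eval t}

/-- `K` is an admissible (face-to-face) decomposition of `Ω` into finitely many `n`-simplices. -/
structure IsTriangulation (K : Geometry.SimplicialComplex ℝ (Eu n)) (Ω : Set (Eu n)) : Prop where
  finite : K.faces.Finite
  space_eq : K.space = closure Ω
  pure : ∀ s ∈ K.faces, ∃ t ∈ K.faces, s ⊆ t ∧ t.card = n + 1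

/-- The vertex sets of the elements of a triangulation. -/
def cells (K : Geometry.SimplicialComplex ℝ (Eu n)) : Set (Finset (Eu n)) :=
  {s | s ∈ K.faces ∧ s.card = n + 1}

/-- The maximal mesh size: the largest diameter of an element. -/
def meshSize (K : Geometry.SimplicialComplex ℝ (Eu n)) : ℝ :=
  sSup ((fun s : Finset (Eu n) => Metric.diam (convexHull ℝ (s : Set (Eu n)))) '' cells K)

variable (Ω Γ) in
/-- The Lagrangian finite element space `S^x ⊂ H¹_Γ(Ω)`: the functions which are continuous on the
closure of `Ω`, polynomials of degree at most `p` on each closed element, and zero on `Γ`. -/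
def spatialSpace (K : Geometry.SimplicialComplex ℝ (Eu n)) (p : ℕ) : Set (H1D Ω Γ) :=
  {s | ∃ w : Eu n → ℝ, ContinuousOn w (closure Ω) ∧
    (∀ T ∈ cells K, ∃ q : MvPolynomial (Fin n) ℝ, q.totalDegree ≤ p ∧
      ∀ x ∈ convexHull ℝ (T : Set (Eu n)), w x = MvPolynomial.eval x.ofLp q) ∧
    (∀ x ∈ Γ, w x = 0) ∧
    ⇑(toL2 Ω Γ s) =ᵐ[volume.restrict Ω] w}

variable (Ω Γ) in
/-- The space-time trial space `S^{x,t} = S^x ⊗ S^t`, the span of the products `φ(t) s(x)`. -/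
def trialSpace (d r N : ℕ) (K : Geometry.SimplicialComplex ℝ (Eu n)) (p : ℕ) :
    Submodule ℝ (L2I (H1D Ω Γ)) :=
  Submodule.span ℝ {v | ∃ φ ∈ temporalSpace d r N, ∃ s ∈ spatialSpace Ω Γ K p,
    ⇑v =ᵐ[timeMeasure] fun t => φ t • s}

/-- `P` is the Ritz projection `H¹_Γ(Ω) → S^x`:
`⟨A ∇Pz, ∇w⟩ = ⟨A ∇z, ∇w⟩` for all `w ∈ S^x`. -/
def IsRitzProjection (A : Eu n → Matrix (Fin n) (Fin n) ℝ)
    (K : Geometry.SimplicialComplex ℝ (Eu n)) (p : ℕ) (P : H1D Ω Γ →L[ℝ] H1D Ω Γ) : Prop :=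
  ∀ z, P z ∈ spatialSpace Ω Γ K p ∧
    ∀ w ∈ spatialSpace Ω Γ K p, aForm A (P z) w = aForm A z w

/-- `v` is the space-time Galerkin approximation: `v ∈ S^{x,t}` and
`b(v, ℋ_T z) = ⟨f, ℋ_T z⟩_Q` for all `z ∈ S^{x,t}`. -/
def IsGalerkinSolution (A : Eu n → Matrix (Fin n) (Fin n) ℝ) (f : TestSpace Ω Γ →ₗ[ℝ] ℝ)
    (d r N : ℕ) (K : Geometry.SimplicialComplex ℝ (Eu n)) (p : ℕ) (v : L2I (H1D Ω Γ)) : Prop :=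
  v ∈ trialSpace Ω Γ d r N K p ∧
    ∀ z ∈ trialSpace Ω Γ d r N K p, ∀ w : TestSpace Ω Γ,
      w.1 = hilbertT z → bForm A v w.1 = f w

end Variational

end SpaceTime

end

open MeasureTheory Set Filter Topology
open scoped ENNReal NNReal ContDiff

set_option linter.unusedSectionVars false

noncomputable section

namespace SpaceTime

/-! ### Elementary tensors, coefficients and finite-rank operators in time. -/

section Tensor

variable {H : Type*} [NormedAddCommGroup H] [InnerProductSpace ℝ H]
variable {V : Type*} [NormedAddCommGroup V] [InnerProductSpace ℝ V]

/-! Stability. Let e_k be the sine coefficients of e. Since ℋ_T turns sine coefficients into cosine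
coefficients (`cosCoeff_hilbertT`), ⟨∂_t v, ℋ_T e⟩ is the inner product of H^{1/2}_{0,}, and taking
v = e gives the squared norm in which the error is measured. The elliptic part has the right sign.
Write ⟨A∇z, ∇w⟩ = ⟨Lz, w⟩; the symmetric part of the matrix ⟨V_j, W_k⟩ has the entries (1/π)∫
x^{j+k} dx over (-1,1), so for finite sums ⟨Le, ℋ_T e⟩ is an integral of ⟨L z(x), z(x)⟩ with z(x) =
∑ x^j e_j, and it stays nonnegative in the limit (`inner_compLp_hilbertT_nonneg`). Hence b(e, ℋ_T e)
≥ ‖e‖² with no condition on the meshes.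

Consistency. Compare u_h with w = ΠPu, where P is the Ritz projection and Π = ∑ φ_i ⊗ ∫ χ_i · is a
finite-rank operator in time with spline φ_i. Π commutes with all operators in space, so Galerkin
orthogonality and Ritz orthogonality give, for e = u_h - w and g = ℒ_x u, ‖e‖² ≤ ⟨∂_t(u - w), ℋ_T e⟩
+ ⟨g - Πg, ℋ_T e⟩ (`energy_discrete_error_le`). The first term is handled by Cauchy–Schwarz and u -
w = (u - Πu) + Π(u - Pu), provided that Π is bounded in H^{1/2}_{0,}. In the second one g has only d
- 1 derivatives; the missing half power of 1/N must come from the half derivative of ℋ_T e, that is,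
from a negative-norm estimate.

The operator Π. The L²-projection onto splines is quasi-optimal and bounded in H^{1/2}_{0,}, but
splines vanish at t = 0 whereas ℋ_T e need not. `exists_timeOp_aux` adds β ⊗ (mean of the projection
error), with a spline bump β of mass one supported within O(1/N) of 0, so that all residuals have
mean zero. The low frequencies of ℋ_T e are a constant plus a primitive: the constant is annihilated
and the primitive gains a factor 1/N (`inner_hilbertT_sq_le`).

Spline approximation (`exists_spline_approx`). An m-fold primitive is an integral operator with a
truncated power as kernel. That kernel is replaced by truncated powers with knots on the mesh,
combined with polynomial weights so that both kernels agree outside a band of width O(1/N); a Schur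
test then gives the rates. Bounds in H^{1/2}_{0,} follow from L²–H¹ interpolation
(`IsPrim.sinEnergy_le`) and an inverse inequality.

Initial values. Full order for splines vanishing at 0 needs u(0) = 0 and g(0) = 0. The first holds
because nonzero constants have infinite norm in H^{1/2}_{0,}; the second follows from the first by
averaging the elliptic equation over (0, ε) (`IsEllipticImage.isZeroSobolev`). -/

instance isProbabilityMeasure_timeMeasure : IsProbabilityMeasure timeMeasure :=
  ⟨by simp [timeMeasure]⟩

/-- The elementary tensor `φ ⊗ a`, i.e. the function `t ↦ φ(t) a`. -/
def tens (φ : L2I ℝ) (a : H) : L2I H := (ContinuousLinearMap.toSpanSingleton ℝ a).compLp φ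

lemma coeFn_tens (φ : L2I ℝ) (a : H) : ⇑(tens φ a) =ᵐ[timeMeasure] fun t => φ t • a := by
  filter_upwards [(ContinuousLinearMap.toSpanSingleton ℝ a).coeFn_compLp φ] with t ht
  exact ht.trans (ContinuousLinearMap.toSpanSingleton_apply _ _ _)

lemma tens_add (φ : L2I ℝ) (a b : H) : tens φ (a + b) = tens φ a + tens φ b := by
  apply Lp.ext
  filter_upwards [coeFn_tens φ (a + b), coeFn_tens φ a, coeFn_tens φ b,
    Lp.coeFn_add (tens φ a) (tens φ b)] with t h1 h2 h3 h4
  rw [h1, h4, Pi.add_apply, h2, h3, smul_add]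

lemma add_tens (φ ψ : L2I ℝ) (a : H) : tens (φ + ψ) a = tens φ a + tens ψ a :=
  ((ContinuousLinearMap.toSpanSingleton ℝ a).compLpL 2 timeMeasure).map_add φ ψ

lemma smul_tens (c : ℝ) (φ : L2I ℝ) (a : H) : tens (c • φ) a = c • tens φ a :=
  ((ContinuousLinearMap.toSpanSingleton ℝ a).compLpL 2 timeMeasure).map_smul c φ

lemma tens_smul (c : ℝ) (φ : L2I ℝ) (a : H) : tens φ (c • a) = c • tens φ a := by
  apply Lp.ext
  filter_upwards [coeFn_tens φ (c • a), coeFn_tens φ a, Lp.coeFn_smul c (tens φ a)] with t h1 h2 h3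
  rw [h1, h3, Pi.smul_apply, h2, smul_comm]

/-- `tens` as a bilinear map. -/
def tensL : L2I ℝ →ₗ[ℝ] H →ₗ[ℝ] L2I H :=
  LinearMap.mk₂ ℝ tens add_tens smul_tens tens_add tens_smul

lemma tensL_apply (φ : L2I ℝ) (a : H) : tensL φ a = tens φ a := rfl

lemma sum_tens {ι : Type*} (s : Finset ι) (φ : ι → L2I ℝ) (a : H) :
    tens (∑ i ∈ s, φ i) a = ∑ i ∈ s, tens (φ i) a := by
  simp only [← tensL_apply, map_sum, LinearMap.sum_apply]

lemma tens_sum {ι : Type*} (s : Finset ι) (φ : L2I ℝ) (a : ι → H) :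
    tens φ (∑ i ∈ s, a i) = ∑ i ∈ s, tens φ (a i) := by
  simp only [← tensL_apply, map_sum]

lemma sub_tens (φ ψ : L2I ℝ) (a : H) : tens (φ - ψ) a = tens φ a - tens ψ a := by
  simp only [← tensL_apply, map_sub, LinearMap.sub_apply]

/-- The coefficient `∫_I χ v dt ∈ H`. -/
def coef (χ : L2I ℝ) (v : L2I H) : H := ∫ t, χ t • v t ∂timeMeasure

lemma integrable_smul_L2I (χ : L2I ℝ) (v : L2I H) :
    Integrable (fun t => χ t • v t) timeMeasure := by
  have h : MemLp (⇑χ • ⇑v) 1 timeMeasure := (Lp.memLp v).smul (Lp.memLp χ)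
  exact memLp_one_iff_integrable.1 h

lemma coef_add (χ : L2I ℝ) (v w : L2I H) : coef χ (v + w) = coef χ v + coef χ w := by
  unfold coef
  rw [← integral_add (integrable_smul_L2I χ v) (integrable_smul_L2I χ w)]
  refine integral_congr_ae ?_
  filter_upwards [Lp.coeFn_add v w] with t ht
  rw [ht, Pi.add_apply, smul_add]

lemma add_coef (χ η : L2I ℝ) (v : L2I H) : coef (χ + η) v = coef χ v + coef η v := by
  unfold coef
  rw [← integral_add (integrable_smul_L2I χ v) (integrable_smul_L2I η v)]
  refine integral_congr_ae ?_
  filter_upwards [Lp.coeFn_add χ η] with t ht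
  rw [ht, Pi.add_apply, add_smul]

lemma coef_smul (c : ℝ) (χ : L2I ℝ) (v : L2I H) : coef χ (c • v) = c • coef χ v := by
  unfold coef
  rw [← integral_smul]
  refine integral_congr_ae ?_
  filter_upwards [Lp.coeFn_smul c v] with t ht
  rw [ht, Pi.smul_apply, smul_comm]

lemma smul_coef (c : ℝ) (χ : L2I ℝ) (v : L2I H) : coef (c • χ) v = c • coef χ v := by
  unfold coef
  rw [← integral_smul]
  refine integral_congr_ae ?_
  filter_upwards [Lp.coeFn_smul c χ] with t ht
  rw [ht, Pi.smul_apply, smul_assoc]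

/-- `coef` as a bilinear map. -/
def coefL : L2I ℝ →ₗ[ℝ] L2I H →ₗ[ℝ] H :=
  LinearMap.mk₂ ℝ coef add_coef smul_coef coef_add (fun c χ v => coef_smul c χ v)

lemma coefL_apply (χ : L2I ℝ) (v : L2I H) : coefL χ v = coef χ v := rfl

lemma coef_sum {ι : Type*} (s : Finset ι) (χ : L2I ℝ) (v : ι → L2I H) :
    coef χ (∑ i ∈ s, v i) = ∑ i ∈ s, coef χ (v i) := by
  simp only [← coefL_apply, map_sum]

lemma sum_coef {ι : Type*} (s : Finset ι) (χ : ι → L2I ℝ) (v : L2I H) :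
    coef (∑ i ∈ s, χ i) v = ∑ i ∈ s, coef (χ i) v := by
  simp only [← coefL_apply, map_sum, LinearMap.sum_apply]

lemma coef_sub (χ : L2I ℝ) (v w : L2I H) : coef χ (v - w) = coef χ v - coef χ w := by
  simp only [← coefL_apply, map_sub]

lemma sub_coef (χ η : L2I ℝ) (v : L2I H) : coef (χ - η) v = coef χ v - coef η v := by
  simp only [← coefL_apply, map_sub, LinearMap.sub_apply]

lemma coef_zero (χ : L2I ℝ) : coef χ (0 : L2I H) = 0 := by
  rw [← coefL_apply, map_zero]

section Complete

variable [CompleteSpace H] [CompleteSpace V]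

/-- `coef χ` is the adjoint of `tens χ`. Through this duality, pairings with tensors are reduced to
inner products in `H`. -/
lemma inner_tens_left (χ : L2I ℝ) (a : H) (v : L2I H) :
    inner ℝ (tens χ a) v = inner ℝ a (coef χ v) := by
  rw [L2.inner_def, coef, ← integral_inner (integrable_smul_L2I χ v)]
  refine integral_congr_ae ?_
  filter_upwards [coeFn_tens χ a] with t ht
  rw [ht, real_inner_smul_left, real_inner_smul_right]

lemma inner_tens_right (χ : L2I ℝ) (a : H) (v : L2I H) :
    inner ℝ v (tens χ a) = inner ℝ (coef χ v) a := by
  rw [real_inner_comm, inner_tens_left, real_inner_comm]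

lemma coef_tens (φ χ : L2I ℝ) (a : H) : coef χ (tens φ a) = inner ℝ χ φ • a := by
  unfold coef
  rw [L2.inner_def, ← integral_smul_const]
  refine integral_congr_ae ?_
  filter_upwards [coeFn_tens φ a] with t ht
  rw [ht, smul_smul]
  simp [mul_comm]

lemma inner_tens_tens (φ ψ : L2I ℝ) (a b : H) :
    inner ℝ (tens φ a) (tens ψ b) = inner ℝ φ ψ * inner ℝ a b := by
  rw [inner_tens_left, coef_tens, real_inner_smul_right]

lemma norm_tens (φ : L2I ℝ) (a : H) : ‖tens φ a‖ = ‖φ‖ * ‖a‖ := by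
  have h : ‖tens φ a‖ ^ 2 = (‖φ‖ * ‖a‖) ^ 2 := by
    rw [← real_inner_self_eq_norm_sq, inner_tens_tens, real_inner_self_eq_norm_sq,
      real_inner_self_eq_norm_sq, mul_pow]
  exact (pow_left_inj₀ (norm_nonneg _) (by positivity) two_ne_zero).1 h

/-- By duality: pair `v` with the tensor `χ ⊗ coef χ v` and cancel one factor. -/
lemma norm_coef_le (χ : L2I ℝ) (v : L2I H) : ‖coef χ v‖ ≤ ‖χ‖ * ‖v‖ := by
  by_cases h0 : ‖coef χ v‖ = 0
  · rw [h0]; positivity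
  have h : ‖coef χ v‖ * ‖coef χ v‖ ≤ (‖χ‖ * ‖v‖) * ‖coef χ v‖ := by
    calc ‖coef χ v‖ * ‖coef χ v‖ = inner ℝ v (tens χ (coef χ v)) := by
          rw [inner_tens_right, real_inner_self_eq_norm_mul_norm]
      _ ≤ ‖v‖ * ‖tens χ (coef χ v)‖ := real_inner_le_norm _ _
      _ = _ := by rw [norm_tens]; ring
  exact le_of_mul_le_mul_right h (lt_of_le_of_ne (norm_nonneg _) (Ne.symm h0))

lemma coef_compLp (χ : L2I ℝ) (L : H →L[ℝ] V) (v : L2I H) :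
    coef χ (L.compLp v) = L (coef χ v) := by
  unfold coef
  rw [← L.integral_comp_comm (integrable_smul_L2I χ v)]
  refine integral_congr_ae ?_
  filter_upwards [L.coeFn_compLp v] with t ht
  rw [ht, map_smul]

end Complete

lemma compLp_tens (φ : L2I ℝ) (L : H →L[ℝ] V) (a : H) :
    L.compLp (tens φ a) = tens φ (L a) := by
  apply Lp.ext
  filter_upwards [L.coeFn_compLp (tens φ a), coeFn_tens φ a, coeFn_tens φ (L a)] with t h1 h2 h3
  rw [h1, h2, h3, map_smul]

lemma compLp_sum {ι : Type*} (s : Finset ι) (L : H →L[ℝ] V) (v : ι → L2I H) :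
    L.compLp (∑ i ∈ s, v i) = ∑ i ∈ s, L.compLp (v i) :=
  map_sum (L.compLpL 2 timeMeasure) v s

lemma compLp_sub (L : H →L[ℝ] V) (v w : L2I H) : L.compLp (v - w) = L.compLp v - L.compLp w :=
  map_sub (L.compLpL 2 timeMeasure) v w

lemma compLp_add (L : H →L[ℝ] V) (v w : L2I H) : L.compLp (v + w) = L.compLp v + L.compLp w :=
  map_add (L.compLpL 2 timeMeasure) v w

/-- The finite rank operator `∑ φ_i ⊗ ∫ χ_i v` acting in time. -/
def finOp {ι : Type*} [Fintype ι] (φ χ : ι → L2I ℝ) (v : L2I H) : L2I H :=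
  ∑ i, tens (φ i) (coef (χ i) v)

section

variable [CompleteSpace H] [CompleteSpace V] {ι : Type*} [Fintype ι]

lemma finOp_sub (φ χ : ι → L2I ℝ) (v w : L2I H) :
    finOp φ χ (v - w) = finOp φ χ v - finOp φ χ w := by
  unfold finOp
  rw [← Finset.sum_sub_distrib]
  refine Finset.sum_congr rfl fun i _ => ?_
  rw [coef_sub, ← tensL_apply, map_sub]; rfl

/-- Operators in time commute with operators in space. This is why the operator in time is described
by scalar families `φ`, `χ`: the same families act on functions with values in `H1D Ω Γ` and in `L2
Ω`. -/
lemma compLp_finOp (φ χ : ι → L2I ℝ) (L : H →L[ℝ] V) (v : L2I H) :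
    L.compLp (finOp φ χ v) = finOp φ χ (L.compLp v) := by
  unfold finOp
  rw [compLp_sum]
  refine Finset.sum_congr rfl fun i _ => ?_
  rw [compLp_tens, coef_compLp]

lemma inner_finOp_left (φ χ : ι → L2I ℝ) (v w : L2I H) :
    inner ℝ (finOp φ χ v) w = inner ℝ v (finOp χ φ w) := by
  unfold finOp
  rw [sum_inner, inner_sum]
  refine Finset.sum_congr rfl fun i _ => ?_
  rw [inner_tens_left, inner_tens_right]

end

section Bessel

variable [CompleteSpace H] {ι : Type*}

lemma norm_sq_sum_tens {φ : ι → L2I ℝ} (hφ : Orthonormal ℝ φ) (s : Finset ι) (a : ι → H) :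
    ‖∑ i ∈ s, tens (φ i) (a i)‖ ^ 2 = ∑ i ∈ s, ‖a i‖ ^ 2 := by
  classical
  rw [← real_inner_self_eq_norm_sq, sum_inner]
  refine Finset.sum_congr rfl fun i hi => ?_
  rw [inner_sum, Finset.sum_eq_single i]
  · rw [inner_tens_tens, real_inner_self_eq_norm_sq, hφ.1 i, real_inner_self_eq_norm_sq]; ring
  · intro j _ hj
    rw [inner_tens_tens, hφ.2 (Ne.symm hj), zero_mul]
  · intro h; exact absurd hi h

lemma coef_sum_tens [DecidableEq ι] {φ : ι → L2I ℝ} (hφ : Orthonormal ℝ φ) (s : Finset ι)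
    (a : ι → H) (i : ι) :
    coef (φ i) (∑ j ∈ s, tens (φ j) (a j)) = if i ∈ s then a i else 0 := by
  rw [coef_sum]
  simp_rw [coef_tens, orthonormal_iff_ite.1 hφ]
  simp

lemma norm_sub_proj_sq {φ : ι → L2I ℝ} (hφ : Orthonormal ℝ φ) (s : Finset ι) (v : L2I H) :
    ‖v - ∑ i ∈ s, tens (φ i) (coef (φ i) v)‖ ^ 2 = ‖v‖ ^ 2 - ∑ i ∈ s, ‖coef (φ i) v‖ ^ 2 := by
  have h : inner ℝ v (∑ i ∈ s, tens (φ i) (coef (φ i) v)) = ∑ i ∈ s, ‖coef (φ i) v‖ ^ 2 := by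
    rw [inner_sum]
    refine Finset.sum_congr rfl fun i _ => ?_
    rw [inner_tens_right, real_inner_self_eq_norm_sq]
  rw [norm_sub_sq_real, h, norm_sq_sum_tens hφ]
  ring

lemma bessel {φ : ι → L2I ℝ} (hφ : Orthonormal ℝ φ) (s : Finset ι) (v : L2I H) :
    ∑ i ∈ s, ‖coef (φ i) v‖ ^ 2 ≤ ‖v‖ ^ 2 := by
  have := norm_sub_proj_sq hφ s v
  nlinarith [sq_nonneg ‖v - ∑ i ∈ s, tens (φ i) (coef (φ i) v)‖]

lemma summable_bessel {φ : ι → L2I ℝ} (hφ : Orthonormal ℝ φ) (v : L2I H) :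
    Summable fun i => ‖coef (φ i) v‖ ^ 2 :=
  summable_of_sum_le (fun _ => by positivity) (fun s => bessel hφ s v)

/-- Finite sums obey the Pythagorean identity, so the Cauchy criterion for the squares is the one
for the series itself. -/
lemma summable_tens {φ : ι → L2I ℝ} (hφ : Orthonormal ℝ φ) {a : ι → H}
    (ha : Summable fun i => ‖a i‖ ^ 2) : Summable fun i => tens (φ i) (a i) := by
  rw [summable_iff_cauchySeq_finset, cauchySeq_finset_iff_vanishing_norm] at *
  intro ε hε
  obtain ⟨s, hs⟩ := ha (ε ^ 2) (by positivity)
  refine ⟨s, fun t ht => ?_⟩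
  have h1 := hs t ht
  rw [← norm_sq_sum_tens hφ, Real.norm_of_nonneg (by positivity)] at h1
  exact lt_of_pow_lt_pow_left₀ 2 hε.le h1

lemma coef_tsum_tens {φ : ι → L2I ℝ} (hφ : Orthonormal ℝ φ) {a : ι → H}
    (ha : Summable fun i => ‖a i‖ ^ 2) (i : ι) :
    coef (φ i) (∑' j, tens (φ j) (a j)) = a i := by
  classical
  have h := (summable_tens hφ ha).hasSum.map
    ((coefL (φ i) : L2I H →ₗ[ℝ] H).mkContinuous ‖φ i‖ (norm_coef_le (φ i)))
    ((coefL (φ i) : L2I H →ₗ[ℝ] H).mkContinuous ‖φ i‖ (norm_coef_le (φ i))).continuous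
  have h2 : HasSum (fun j => coef (φ i) (tens (φ j) (a j))) (a i) := by
    simp_rw [coef_tens, orthonormal_iff_ite.1 hφ]
    have := hasSum_ite_eq i (a i)
    convert this using 2 with j
    by_cases hj : i = j <;> simp [hj, eq_comm]
  exact h.unique h2

end Bessel

end Tensor

/-! ### The systems V_k and W_k and the matrix of ℋ_T. -/

section Fourier

lemma freq_pos (k : ℕ) : 0 < freq k := by unfold freq; positivity

lemma continuous_sinFun (k : ℕ) : Continuous (sinFun k) := by unfold sinFun; fun_prop

lemma abs_sinFun_le (k : ℕ) (t : ℝ) : |sinFun k t| ≤ √2 := by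
  unfold sinFun
  rw [abs_mul, abs_of_nonneg (Real.sqrt_nonneg 2)]
  exact mul_le_of_le_one_right (Real.sqrt_nonneg 2) (Real.abs_sin_le_one _)

lemma ae_mem_Ioo : ∀ᵐ t ∂timeMeasure, t ∈ Ioo (0 : ℝ) 1 :=
  ae_restrict_mem measurableSet_Ioo

lemma memLp_of_bound_on {E : Type*} [NormedAddCommGroup E] {f : ℝ → E}
    (hf : AEStronglyMeasurable f timeMeasure) (M : ℝ) (h : ∀ t ∈ Ioo (0 : ℝ) 1, ‖f t‖ ≤ M) :
    MemLp f 2 timeMeasure :=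
  MemLp.of_bound hf M (ae_mem_Ioo.mono h)

lemma memLp_of_continuous {E : Type*} [NormedAddCommGroup E] {f : ℝ → E} (hf : Continuous f) :
    MemLp f 2 timeMeasure := by
  obtain ⟨M, hM⟩ := (isCompact_Icc (a := (0 : ℝ)) (b := 1)).exists_bound_of_continuousOn
    hf.continuousOn
  exact memLp_of_bound_on hf.aestronglyMeasurable M fun t ht => hM t (Ioo_subset_Icc_self ht)

lemma integral_timeMeasure {E : Type*} [NormedAddCommGroup E] [NormedSpace ℝ E] (f : ℝ → E) :
    ∫ t, f t ∂timeMeasure = ∫ t in (0 : ℝ)..1, f t := by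
  rw [intervalIntegral.integral_of_le zero_le_one, integral_Ioc_eq_integral_Ioo]

/-- `V_k` as an element of `L²(I)`. -/
def sinL (k : ℕ) : L2I ℝ := (memLp_of_continuous (continuous_sinFun k)).toLp

/-- `W_k` as an element of `L²(I)`. -/
def cosL (k : ℕ) : L2I ℝ := (memLp_of_continuous (continuous_cosFun k)).toLp

lemma coeFn_sinL (k : ℕ) : ⇑(sinL k) =ᵐ[timeMeasure] sinFun k := MemLp.coeFn_toLp _

lemma coeFn_cosL (k : ℕ) : ⇑(cosL k) =ᵐ[timeMeasure] cosFun k := MemLp.coeFn_toLp _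

lemma integral_cos_int (m : ℤ) :
    ∫ t in (0 : ℝ)..1, Real.cos (m * Real.pi * t) = if m = 0 then 1 else 0 := by
  split_ifs with h
  · simp [h]
  · have hm : (m : ℝ) * Real.pi ≠ 0 := by
      have : (m : ℝ) ≠ 0 := by exact_mod_cast h
      positivity
    rw [intervalIntegral.integral_comp_mul_left (fun x => Real.cos x) hm, integral_cos]
    simp [Real.sin_int_mul_pi]

lemma integral_sin_nat (n : ℕ) :
    ∫ t in (0 : ℝ)..1, Real.sin ((n + 1 : ℕ) * Real.pi * t) =
      (1 + (-1) ^ n) / ((n + 1) * Real.pi) := by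
  have hm : ((n + 1 : ℕ) : ℝ) * Real.pi ≠ 0 := by positivity
  rw [intervalIntegral.integral_comp_mul_left (fun x => Real.sin x) hm, integral_sin]
  rw [mul_zero, mul_one, Real.cos_zero, Real.cos_nat_mul_pi, pow_succ, smul_eq_mul]
  push_cast
  field_simp
  ring

lemma inner_L2I_of_ae {φ ψ : L2I ℝ} {f g : ℝ → ℝ} (hf : ⇑φ =ᵐ[timeMeasure] f)
    (hg : ⇑ψ =ᵐ[timeMeasure] g) : inner ℝ φ ψ = ∫ t in (0 : ℝ)..1, f t * g t := by
  rw [L2.inner_def, ← integral_timeMeasure]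
  refine integral_congr_ae ?_
  filter_upwards [hf, hg] with t h1 h2
  rw [h1, h2]
  simp [mul_comm]

lemma sqrt_two_mul_sqrt_two : √(2 : ℝ) * √2 = 2 := Real.mul_self_sqrt (by norm_num)

/-- The frequencies are half-odd multiples of π, so their differences and sums are integer
multiples. The factor j + k + 1 never vanishes, which leaves only the difference term in the
orthonormality relations. -/
lemma sinFun_mul_sinFun (j k : ℕ) (t : ℝ) : sinFun j t * sinFun k t =
    Real.cos (((j - k : ℤ) : ℝ) * Real.pi * t) -
      Real.cos (((j + k + 1 : ℤ) : ℝ) * Real.pi * t) := by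
  have h1 : ((j - k : ℤ) : ℝ) * Real.pi * t = freq j * t - freq k * t := by
    unfold freq; push_cast; ring
  have h2 : ((j + k + 1 : ℤ) : ℝ) * Real.pi * t = freq j * t + freq k * t := by
    unfold freq; push_cast; ring
  rw [h1, h2, Real.cos_sub, Real.cos_add]
  unfold sinFun
  linear_combination (Real.sin (freq j * t) * Real.sin (freq k * t)) * sqrt_two_mul_sqrt_two

lemma cosFun_mul_cosFun (j k : ℕ) (t : ℝ) : cosFun j t * cosFun k t =
    Real.cos (((j - k : ℤ) : ℝ) * Real.pi * t) +
      Real.cos (((j + k + 1 : ℤ) : ℝ) * Real.pi * t) := by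
  have h1 : ((j - k : ℤ) : ℝ) * Real.pi * t = freq j * t - freq k * t := by
    unfold freq; push_cast; ring
  have h2 : ((j + k + 1 : ℤ) : ℝ) * Real.pi * t = freq j * t + freq k * t := by
    unfold freq; push_cast; ring
  rw [h1, h2, Real.cos_sub, Real.cos_add]
  unfold cosFun
  linear_combination (Real.cos (freq j * t) * Real.cos (freq k * t)) * sqrt_two_mul_sqrt_two

lemma orthonormal_sinL : Orthonormal ℝ sinL := by
  rw [orthonormal_iff_ite]
  intro j k
  rw [inner_L2I_of_ae (coeFn_sinL j) (coeFn_sinL k)]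
  simp_rw [sinFun_mul_sinFun]
  rw [intervalIntegral.integral_sub (Continuous.intervalIntegrable (by fun_prop) _ _)
    (Continuous.intervalIntegrable (by fun_prop) _ _), integral_cos_int, integral_cos_int,
    if_neg (by omega : ¬ ((j : ℤ) + k + 1 = 0)), sub_zero]
  congr 1
  simp [sub_eq_zero]

lemma orthonormal_cosL : Orthonormal ℝ cosL := by
  rw [orthonormal_iff_ite]
  intro j k
  rw [inner_L2I_of_ae (coeFn_cosL j) (coeFn_cosL k)]
  simp_rw [cosFun_mul_cosFun]
  rw [intervalIntegral.integral_add (Continuous.intervalIntegrable (by fun_prop) _ _)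
    (Continuous.intervalIntegrable (by fun_prop) _ _), integral_cos_int, integral_cos_int,
    if_neg (by omega : ¬ ((j : ℤ) + k + 1 = 0)), add_zero]
  congr 1
  simp [sub_eq_zero]

/-- The symmetric part of the matrix of `ℋ_T` is a Hilbert-type moment matrix. -/
lemma inner_sinL_cosL_add (j k : ℕ) :
    inner ℝ (sinL j) (cosL k) + inner ℝ (sinL k) (cosL j) =
      2 / Real.pi * ∫ x in (-1 : ℝ)..1, x ^ j * x ^ k := by
  have hc : ∀ j k, Continuous fun t => sinFun j t * cosFun k t := fun j k =>
    (continuous_sinFun j).mul (continuous_cosFun k)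
  rw [inner_L2I_of_ae (coeFn_sinL j) (coeFn_cosL k), inner_L2I_of_ae (coeFn_sinL k) (coeFn_cosL j),
    ← intervalIntegral.integral_add ((hc j k).intervalIntegrable _ _)
      ((hc k j).intervalIntegrable _ _)]
  -- The sum is 2 sin((j+k+1)πt), and both sides integrate to 2(1 + (-1)^{j+k}) / ((j+k+1)π).
  have h : ∀ t : ℝ, sinFun j t * cosFun k t + sinFun k t * cosFun j t =
      2 * Real.sin (((j + k) + 1 : ℕ) * Real.pi * t) := fun t => by
    have h2 : (((j + k) + 1 : ℕ) : ℝ) * Real.pi * t = freq j * t + freq k * t := by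
      unfold freq; push_cast; ring
    rw [h2, Real.sin_add]
    unfold sinFun cosFun
    linear_combination (Real.sin (freq j * t) * Real.cos (freq k * t) +
      Real.sin (freq k * t) * Real.cos (freq j * t)) * sqrt_two_mul_sqrt_two
  simp_rw [h, ← pow_add]
  rw [intervalIntegral.integral_const_mul, integral_sin_nat, integral_pow]
  have hp := Real.pi_ne_zero
  push_cast
  field_simp
  rw [pow_succ]
  ring

end Fourier

/-! ### Completeness of the sine system and the action of ℋ_T on coefficients. -/

section Vector

variable {H : Type*} [NormedAddCommGroup H] [InnerProductSpace ℝ H]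
variable {V : Type*} [NormedAddCommGroup V] [InnerProductSpace ℝ V]

lemma coef_eq_of_ae {χ : L2I ℝ} {f : ℝ → ℝ} (h : ⇑χ =ᵐ[timeMeasure] f) (v : L2I H) :
    coef χ v = ∫ t, f t • v t ∂timeMeasure := by
  refine integral_congr_ae ?_
  filter_upwards [h] with t ht
  rw [ht]

lemma sinCoeff_eq (v : L2I H) (k : ℕ) : sinCoeff v k = coef (sinL k) v :=
  (coef_eq_of_ae (coeFn_sinL k) v).symm

lemma cosCoeff_eq (v : L2I H) (k : ℕ) : cosCoeff v k = coef (cosL k) v :=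
  (coef_eq_of_ae (coeFn_cosL k) v).symm

lemma integrable_L2I (v : L2I H) : Integrable (⇑v) timeMeasure :=
  (Lp.memLp v).integrable (by norm_num)

lemma integrable_continuous_smul {f : ℝ → ℝ} (hf : Continuous f) (v : L2I H) :
    Integrable (fun t => f t • v t) timeMeasure := by
  obtain ⟨M, hM⟩ := (isCompact_Icc (a := (0 : ℝ)) (b := 1)).exists_bound_of_continuousOn
    hf.continuousOn
  refine Integrable.bdd_smul (integrable_L2I v) M hf.aestronglyMeasurable ?_
  exact ae_mem_Ioo.mono fun t ht => hM t (Ioo_subset_Icc_self ht)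

lemma two_cos_mul_sinFun_succ (k : ℕ) (t : ℝ) :
    Real.cos (Real.pi * t) * sinFun (k + 1) t = (1 / 2) * (sinFun (k + 2) t + sinFun k t) := by
  unfold sinFun
  have h1 : freq (k + 2) * t = freq (k + 1) * t + Real.pi * t := by unfold freq; push_cast; ring
  have h2 : freq k * t = freq (k + 1) * t - Real.pi * t := by unfold freq; push_cast; ring
  rw [h1, h2, Real.sin_add, Real.sin_sub]
  ring

/-- The boundary case of the three-term recurrence, in which V_{-1} = -V_0 takes the place of the
missing function. -/
lemma two_cos_mul_sinFun_zero (t : ℝ) :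
    Real.cos (Real.pi * t) * sinFun 0 t = (1 / 2) * (sinFun 1 t - sinFun 0 t) := by
  unfold sinFun
  have h1 : freq 1 * t = freq 0 * t + Real.pi * t := by unfold freq; push_cast; ring
  have h2 : Real.sin (freq 0 * t) = - Real.sin (freq 0 * t - Real.pi * t) := by
    rw [← Real.sin_neg]; congr 1; unfold freq; push_cast; ring
  have h3 : Real.sin (freq 0 * t) = - (Real.sin (freq 0 * t) * Real.cos (Real.pi * t) -
      Real.cos (freq 0 * t) * Real.sin (Real.pi * t)) := by
    rw [← Real.sin_sub]; exact h2
  rw [h1, Real.sin_add]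
  linear_combination √2 * (1 / 2) * h3

/-- Multiplication by cos(πt) maps the span of the V_k into itself, by the recurrence; hence the
annihilator of all V_k also annihilates p(cos πt) V_k. -/
lemma integral_poly_cos_smul_eq_zero {v : L2I H} (hv : ∀ k, sinCoeff v k = 0)
    (p : Polynomial ℝ) (k : ℕ) :
    ∫ t, (p.eval (Real.cos (Real.pi * t)) * sinFun k t) • v t ∂timeMeasure = 0 := by
  have hc : ∀ (q : Polynomial ℝ) (k : ℕ),
      Continuous fun t => q.eval (Real.cos (Real.pi * t)) * sinFun k t := fun q k =>
    (q.continuous.comp (by fun_prop)).mul (continuous_sinFun k)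
  have hpow : ∀ (n k : ℕ),
      ∫ t, (Real.cos (Real.pi * t) ^ n * sinFun k t) • v t ∂timeMeasure = 0 := by
    intro n
    induction n with
    | zero => intro k; simpa [sinCoeff] using hv k
    | succ n ih =>
      have hi : ∀ k, Integrable (fun t => (Real.cos (Real.pi * t) ^ n * sinFun k t) • v t)
          timeMeasure := fun k =>
        integrable_continuous_smul (by have := continuous_sinFun k; fun_prop) v
      intro k
      cases k with
      | zero =>
        have : ∀ t, (Real.cos (Real.pi * t) ^ (n + 1) * sinFun 0 t) • v t =
            (1 / 2 : ℝ) • ((Real.cos (Real.pi * t) ^ n * sinFun 1 t) • v t -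
              (Real.cos (Real.pi * t) ^ n * sinFun 0 t) • v t) := fun t => by
          rw [← sub_smul, smul_smul, pow_succ]
          congr 1
          linear_combination Real.cos (Real.pi * t) ^ n * two_cos_mul_sinFun_zero t
        simp_rw [this]
        rw [integral_smul, integral_sub (hi 1) (hi 0), ih, ih]; simp
      | succ k =>
        have : ∀ t, (Real.cos (Real.pi * t) ^ (n + 1) * sinFun (k + 1) t) • v t =
            (1 / 2 : ℝ) • ((Real.cos (Real.pi * t) ^ n * sinFun (k + 2) t) • v t +
              (Real.cos (Real.pi * t) ^ n * sinFun k t) • v t) := fun t => by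
          rw [← add_smul, smul_smul, pow_succ]
          congr 1
          linear_combination Real.cos (Real.pi * t) ^ n * two_cos_mul_sinFun_succ k t
        simp_rw [this]
        rw [integral_smul, integral_add (hi (k + 2)) (hi k), ih, ih]; simp
  induction p using Polynomial.induction_on' with
  | add p q hp hq =>
    have : ∀ t, ((p + q).eval (Real.cos (Real.pi * t)) * sinFun k t) • v t =
        (p.eval (Real.cos (Real.pi * t)) * sinFun k t) • v t +
        (q.eval (Real.cos (Real.pi * t)) * sinFun k t) • v t := fun t => by
      rw [Polynomial.eval_add, add_mul, add_smul]
    simp_rw [this]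
    rw [integral_add (integrable_continuous_smul (hc p k) v)
      (integrable_continuous_smul (hc q k) v), hp, hq, add_zero]
  | monomial n a =>
    have : ∀ t, ((Polynomial.monomial n a).eval (Real.cos (Real.pi * t)) * sinFun k t) • v t =
        a • ((Real.cos (Real.pi * t) ^ n * sinFun k t) • v t) := fun t => by
      rw [Polynomial.eval_monomial, smul_smul, mul_assoc]
    simp_rw [this]
    rw [integral_smul, hpow, smul_zero]

lemma sinFun_zero_pos {t : ℝ} (ht : t ∈ Ioo (0 : ℝ) 1) : 0 < sinFun 0 t := by
  unfold sinFun freq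
  have hp := Real.pi_pos
  refine mul_pos (by positivity) (Real.sin_pos_of_pos_of_lt_pi ?_ ?_)
  · have := ht.1; simp; positivity
  · have := ht.2; simp; nlinarith

/-- The system `V_k` is complete in `L²(I; H)`. -/
theorem eq_zero_of_sinCoeff [CompleteSpace H] {v : L2I H} (hv : ∀ k, sinCoeff v k = 0) : v = 0 := by
  have hloc : LocallyIntegrableOn (⇑v) (Ioo (0 : ℝ) 1) volume :=
    IntegrableOn.locallyIntegrableOn (integrable_L2I v)
  have key := isOpen_Ioo.ae_eq_zero_of_integral_contDiff_smul_eq_zero hloc ?_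
  · rw [Lp.eq_zero_iff_ae_eq_zero]
    exact (ae_restrict_iff' measurableSet_Ioo).2 key
  intro g hg _ hgs
  have hset : ∫ t, g t • v t = ∫ t, g t • v t ∂timeMeasure := by
    rw [setIntegral_eq_integral_of_forall_compl_eq_zero]
    intro t ht
    rw [image_eq_zero_of_notMem_tsupport (fun h => ht (hgs h)), zero_smul]
  rw [hset]
  -- V_0 is positive on the open interval, which contains the support of `g`, so the quotient
  -- extends continuously by zero.
  have hGc : Continuous fun t => g t / sinFun 0 t := by
    refine continuous_of_tsupport fun t ht => ?_
    have ht' : t ∈ tsupport g := by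
      simp_rw [div_eq_mul_inv] at ht
      exact tsupport_mul_subset_left ht
    exact hg.continuous.continuousAt.div (continuous_sinFun 0).continuousAt
      (sinFun_zero_pos (hgs ht')).ne'
  set B := ∫ t, ‖v t‖ ∂timeMeasure with hB
  have hB0 : 0 ≤ B := integral_nonneg fun _ => norm_nonneg _
  have hsmall : ∀ ε > 0, ‖∫ t, g t • v t ∂timeMeasure‖ ≤ ε * (√2 * B) := by
    intro ε hε
    -- Weierstrass in the variable x = cos(πt): g / V_0 is uniformly close to p(cos πt), and p(cos
    -- πt) V_0 is annihilated by `v`.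
    obtain ⟨p, hp⟩ := exists_polynomial_near_of_continuousOn (-1) 1
      (fun x => g (Real.arccos x / Real.pi) / sinFun 0 (Real.arccos x / Real.pi))
      ((hGc.comp (Real.continuous_arccos.div_const _)).continuousOn) ε hε
    have hpc : Continuous fun t => p.eval (Real.cos (Real.pi * t)) * sinFun 0 t :=
      (p.continuous.comp (by fun_prop)).mul (continuous_sinFun 0)
    have h1 : ∫ t, g t • v t ∂timeMeasure =
        ∫ t, (g t - p.eval (Real.cos (Real.pi * t)) * sinFun 0 t) • v t ∂timeMeasure := by
      simp_rw [sub_smul]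
      rw [integral_sub (integrable_continuous_smul hg.continuous v)
        (integrable_continuous_smul hpc v), integral_poly_cos_smul_eq_zero hv, sub_zero]
    rw [h1, ← mul_assoc, hB, ← integral_const_mul]
    refine norm_integral_le_of_norm_le ((integrable_L2I v).norm.const_mul _) ?_
    filter_upwards [ae_mem_Ioo] with t ht
    rw [norm_smul]
    refine mul_le_mul_of_nonneg_right ?_ (norm_nonneg _)
    have hs := sinFun_zero_pos ht
    have hpt := hp (Real.cos (Real.pi * t)) ⟨Real.neg_one_le_cos _, Real.cos_le_one _⟩
    have hp0 := Real.pi_pos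
    rw [Real.arccos_cos (by have := ht.1; positivity) (by have := ht.2; nlinarith),
      mul_div_cancel_left₀ _ hp0.ne'] at hpt
    have : g t - p.eval (Real.cos (Real.pi * t)) * sinFun 0 t =
        -((p.eval (Real.cos (Real.pi * t)) - g t / sinFun 0 t) * sinFun 0 t) := by
      field_simp; ring
    rw [this, norm_neg, norm_mul]
    exact mul_le_mul hpt.le (abs_sinFun_le 0 t) (norm_nonneg _) hε.le
  have hz : ‖∫ t, g t • v t ∂timeMeasure‖ ≤ 0 := by
    refine le_of_forall_pos_le_add fun ε hε => ?_
    refine (hsmall (ε / (√2 * B + 1)) (by positivity)).trans ?_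
    rw [zero_add, div_mul_eq_mul_div, div_le_iff₀ (by positivity)]
    nlinarith
  exact norm_le_zero_iff.1 hz

variable [CompleteSpace H] [CompleteSpace V]

lemma summable_sinCoeff (v : L2I H) : Summable fun k => ‖sinCoeff v k‖ ^ 2 := by
  simp_rw [sinCoeff_eq]
  exact summable_bessel orthonormal_sinL v

/-- The Fourier expansion `v = ∑ V_k ⊗ v_k` in `L²(I; H)`. -/
theorem hasSum_sinCoeff (v : L2I H) : HasSum (fun k => tens (sinL k) (sinCoeff v k)) v := by
  have h := summable_tens orthonormal_sinL (summable_sinCoeff v)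
  have he : v - ∑' k, tens (sinL k) (sinCoeff v k) = 0 := by
    refine eq_zero_of_sinCoeff fun k => ?_
    rw [sinCoeff_eq, coef_sub, coef_tsum_tens orthonormal_sinL (summable_sinCoeff v),
      sinCoeff_eq, sub_self]
  rw [sub_eq_zero] at he
  have h2 := h.hasSum
  rwa [← he] at h2

lemma hilbertT_eq (v : L2I H) : hilbertT v = ∑' k, tens (cosL k) (sinCoeff v k) := by
  unfold hilbertT
  congr 1

lemma hasSum_hilbertT (v : L2I H) :
    HasSum (fun k => tens (cosL k) (sinCoeff v k)) (hilbertT v) := by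
  rw [hilbertT_eq]
  exact (summable_tens orthonormal_cosL (summable_sinCoeff v)).hasSum

/-- The reason for testing with ℋ_T: pairing ∂_t v with `hilbertT e` becomes the weighted ℓ² product
of the sine coefficients of both functions. -/
lemma cosCoeff_hilbertT (v : L2I H) (k : ℕ) : cosCoeff (hilbertT v) k = sinCoeff v k := by
  rw [cosCoeff_eq, hilbertT_eq, coef_tsum_tens orthonormal_cosL (summable_sinCoeff v)]

end Vector

/-! ### The energy of H^{1/2}_{0,}, positivity of ℋ_T, and frequency splitting. -/

section Energy

variable {H : Type*} [NormedAddCommGroup H] [InnerProductSpace ℝ H]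
variable {V : Type*} [NormedAddCommGroup V] [InnerProductSpace ℝ V]

/-- The square of the norm of `H^{1/2}_{0,}(I; H)`. -/
def sinEnergy (v : L2I H) : ℝ≥0∞ := ∑' k, ENNReal.ofReal (freq k) * ‖sinCoeff v k‖ₑ ^ 2

lemma normZeroLeft_eq (v : L2I H) : normZeroLeft v = sinEnergy v ^ (1 / 2 : ℝ) := rfl

lemma normZeroLeft_lt_top_iff (v : L2I H) : normZeroLeft v < ⊤ ↔ sinEnergy v < ⊤ := by
  rw [normZeroLeft_eq]
  exact ENNReal.rpow_lt_top_iff_of_pos (by norm_num)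

lemma normZeroLeft_le_ofReal_iff (v : L2I H) {x : ℝ} (hx : 0 ≤ x) :
    normZeroLeft v ≤ ENNReal.ofReal x ↔ sinEnergy v ≤ ENNReal.ofReal (x ^ 2) := by
  rw [normZeroLeft_eq, one_div, ENNReal.rpow_inv_le_iff (by norm_num),
    ENNReal.ofReal_rpow_of_nonneg hx (by norm_num)]
  norm_num

lemma ofReal_mul_enorm_sq {a : ℝ} (ha : 0 ≤ a) (x : H) :
    ENNReal.ofReal a * ‖x‖ₑ ^ 2 = ENNReal.ofReal (a * ‖x‖ ^ 2) := by
  rw [ENNReal.ofReal_mul ha, ENNReal.ofReal_pow (norm_nonneg _), ofReal_norm]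

lemma sinEnergy_lt_top_iff (v : L2I H) :
    sinEnergy v < ⊤ ↔ Summable fun k => freq k * ‖sinCoeff v k‖ ^ 2 := by
  unfold sinEnergy
  simp_rw [fun k => ofReal_mul_enorm_sq (freq_pos k).le (sinCoeff v k)]
  constructor
  · intro h
    have h2 := ENNReal.summable_toReal h.ne
    refine h2.congr fun k => ?_
    rw [ENNReal.toReal_ofReal (mul_nonneg (freq_pos k).le (by positivity))]
  · intro h
    exact h.tsum_ofReal_lt_top

/-- The real-valued energy, meaningful if `sinEnergy v < ⊤`. -/
def energy (v : L2I H) : ℝ := ∑' k, freq k * ‖sinCoeff v k‖ ^ 2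

lemma energy_nonneg (v : L2I H) : 0 ≤ energy v :=
  tsum_nonneg fun k => mul_nonneg (freq_pos k).le (by positivity)

lemma sinEnergy_eq {v : L2I H} (hv : sinEnergy v < ⊤) : sinEnergy v = ENNReal.ofReal (energy v) := by
  have h := (sinEnergy_lt_top_iff v).1 hv
  unfold sinEnergy energy
  simp_rw [fun k => ofReal_mul_enorm_sq (freq_pos k).le (sinCoeff v k)]
  exact (ENNReal.ofReal_tsum_of_nonneg
    (fun k => mul_nonneg (freq_pos k).le (by positivity)) h).symm

lemma sinEnergy_le_ofReal_of_sum_le {v : L2I H} {x : ℝ}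
    (h : ∀ s : Finset ℕ, ∑ k ∈ s, freq k * ‖sinCoeff v k‖ ^ 2 ≤ x) :
    sinEnergy v ≤ ENNReal.ofReal x := by
  have hs : Summable fun k => freq k * ‖sinCoeff v k‖ ^ 2 :=
    summable_of_sum_le (fun k => mul_nonneg (freq_pos k).le (by positivity)) h
  rw [sinEnergy_eq ((sinEnergy_lt_top_iff v).2 hs)]
  exact ENNReal.ofReal_le_ofReal (hs.tsum_le_of_sum_le h)

variable [CompleteSpace H] [CompleteSpace V]

lemma sinCoeff_add (v w : L2I H) (k : ℕ) : sinCoeff (v + w) k = sinCoeff v k + sinCoeff w k := by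
  simp_rw [sinCoeff_eq, coef_add]

lemma sinCoeff_compLp (L : H →L[ℝ] V) (v : L2I H) (k : ℕ) :
    sinCoeff (L.compLp v) k = L (sinCoeff v k) := by
  simp_rw [sinCoeff_eq, coef_compLp]

lemma enorm_add_sq_le (x y : H) : ‖x + y‖ₑ ^ 2 ≤ 2 * (‖x‖ₑ ^ 2 + ‖y‖ₑ ^ 2) := by
  have h2 := ENNReal.rpow_add_le_mul_rpow_add_rpow ‖x‖ₑ ‖y‖ₑ (p := 2) (by norm_num)
  norm_num at h2
  exact (pow_le_pow_left' (enorm_add_le _ _) 2).trans h2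

lemma sinEnergy_add_le (v w : L2I H) : sinEnergy (v + w) ≤ 2 * (sinEnergy v + sinEnergy w) := by
  unfold sinEnergy
  rw [← ENNReal.tsum_add, ← ENNReal.tsum_mul_left]
  refine ENNReal.tsum_le_tsum fun k => ?_
  rw [sinCoeff_add]
  calc _ ≤ ENNReal.ofReal (freq k) * (2 * (‖sinCoeff v k‖ₑ ^ 2 + ‖sinCoeff w k‖ₑ ^ 2)) := by
        gcongr; exact enorm_add_sq_le _ _
    _ = _ := by ring

lemma sinEnergy_neg (v : L2I H) : sinEnergy (-v) = sinEnergy v := by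
  unfold sinEnergy
  refine tsum_congr fun k => ?_
  have : sinCoeff (-v) k = - sinCoeff v k := by
    rw [sinCoeff_eq, sinCoeff_eq, ← coefL_apply, map_neg]; rfl
  rw [this, enorm_neg]

lemma sinEnergy_sub_le (v w : L2I H) : sinEnergy (v - w) ≤ 2 * (sinEnergy v + sinEnergy w) := by
  rw [sub_eq_add_neg]
  exact (sinEnergy_add_le v (-w)).trans_eq (by rw [sinEnergy_neg])

lemma compLp_hilbertT (L : H →L[ℝ] V) (v : L2I H) :
    L.compLp (hilbertT v) = hilbertT (L.compLp v) := by
  have h := (hasSum_hilbertT v).map (L.compLpL 2 timeMeasure) (L.compLpL 2 timeMeasure).continuous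
  have h2 : HasSum (fun k => tens (cosL k) (sinCoeff (L.compLp v) k)) (L.compLp (hilbertT v)) := by
    refine h.congr_fun fun k => ?_
    rw [sinCoeff_compLp, ← compLp_tens]; rfl
  exact h2.unique (hasSum_hilbertT _)

/-- `⟨𝒜 e, ℋ_T e⟩ ≥ 0` for positive semidefinite symmetric operators acting in space. -/
theorem inner_compLp_hilbertT_nonneg (L : H →L[ℝ] H)
    (hs : ∀ x y, inner ℝ (L x) y = inner ℝ (L y) x) (hp : ∀ x, 0 ≤ inner ℝ (L x) x) (e : L2I H) :
    0 ≤ inner ℝ (L.compLp e) (hilbertT e) := by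
  have h1 := ((L.compLpL 2 timeMeasure).continuous.tendsto _).comp (hasSum_sinCoeff e)
  have h3 := h1.inner (hasSum_hilbertT e) (𝕜 := ℝ)
  refine ge_of_tendsto' h3 fun s => ?_
  change 0 ≤ inner ℝ (L.compLp (∑ k ∈ s, tens (sinL k) (sinCoeff e k))) _
  set a := fun k => sinCoeff e k with ha
  have hexp : inner ℝ (L.compLp (∑ k ∈ s, tens (sinL k) (a k))) (∑ k ∈ s, tens (cosL k) (a k)) =
      ∑ j ∈ s, ∑ k ∈ s, inner ℝ (sinL j) (cosL k) * inner ℝ (L (a j)) (a k) := by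
    rw [compLp_sum, sum_inner]
    refine Finset.sum_congr rfl fun j _ => ?_
    rw [inner_sum]
    refine Finset.sum_congr rfl fun k _ => ?_
    rw [compLp_tens, inner_tens_tens]
  -- Since `L` is symmetric, only the symmetric part of the matrix of ℋ_T contributes.
  have hsym : 2 * ∑ j ∈ s, ∑ k ∈ s, inner ℝ (sinL j) (cosL k) * inner ℝ (L (a j)) (a k) =
      ∑ j ∈ s, ∑ k ∈ s, (inner ℝ (sinL j) (cosL k) + inner ℝ (sinL k) (cosL j)) *
        inner ℝ (L (a j)) (a k) := by
    simp_rw [add_mul, Finset.sum_add_distrib]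
    rw [two_mul]
    congr 1
    rw [Finset.sum_comm]
    refine Finset.sum_congr rfl fun j _ => Finset.sum_congr rfl fun k _ => ?_
    rw [hs (a k) (a j)]
  -- The symmetrized matrix consists of moments of Lebesgue measure on (-1,1), so the double sum is
  -- the integral of a quadratic form evaluated at ∑ x^j a_j.
  have hint : ∑ j ∈ s, ∑ k ∈ s, (inner ℝ (sinL j) (cosL k) + inner ℝ (sinL k) (cosL j)) *
        inner ℝ (L (a j)) (a k) =
      2 / Real.pi * ∫ x in (-1 : ℝ)..1,
        inner ℝ (L (∑ j ∈ s, x ^ j • a j)) (∑ k ∈ s, x ^ k • a k) := by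
    have : ∀ x : ℝ, inner ℝ (L (∑ j ∈ s, x ^ j • a j)) (∑ k ∈ s, x ^ k • a k) =
        ∑ j ∈ s, ∑ k ∈ s, x ^ j * x ^ k * inner ℝ (L (a j)) (a k) := fun x => by
      rw [map_sum, sum_inner]
      refine Finset.sum_congr rfl fun j _ => ?_
      rw [inner_sum]
      refine Finset.sum_congr rfl fun k _ => ?_
      rw [map_smul, real_inner_smul_left, real_inner_smul_right]; ring
    simp_rw [this]
    rw [intervalIntegral.integral_finsetSum
      (fun j _ => Continuous.intervalIntegrable (by fun_prop) _ _), Finset.mul_sum]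
    refine Finset.sum_congr rfl fun j _ => ?_
    rw [intervalIntegral.integral_finsetSum
      (fun j _ => Continuous.intervalIntegrable (by fun_prop) _ _), Finset.mul_sum]
    refine Finset.sum_congr rfl fun k _ => ?_
    rw [intervalIntegral.integral_mul_const, inner_sinL_cosL_add, mul_assoc]
  have hnn : 0 ≤ ∫ x in (-1 : ℝ)..1,
        inner ℝ (L (∑ j ∈ s, x ^ j • a j)) (∑ k ∈ s, x ^ k • a k) :=
    intervalIntegral.integral_nonneg (by norm_num) fun x _ => hp _
  have : 0 ≤ 2 * ∑ j ∈ s, ∑ k ∈ s, inner ℝ (sinL j) (cosL k) * inner ℝ (L (a j)) (a k) := by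
    rw [hsym, hint]; positivity
  change 0 ≤ inner ℝ (L.compLp (∑ k ∈ s, tens (sinL k) (a k))) (∑ k ∈ s, tens (cosL k) (a k))
  rw [hexp]
  linarith

lemma freq_mono {j k : ℕ} (h : j ≤ k) : freq j ≤ freq k := by
  unfold freq
  have : (j : ℝ) ≤ k := by exact_mod_cast h
  have := Real.pi_pos
  gcongr

/-- The high frequency part of a function with finite energy is small in `L²`. -/
lemma norm_sub_low_sq_le {φ : ℕ → L2I ℝ} (hφ : Orthonormal ℝ φ) {a : ℕ → H} {v : L2I H}
    (hv : HasSum (fun k => tens (φ k) (a k)) v) (ha : Summable fun k => freq k * ‖a k‖ ^ 2)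
    (N : ℕ) :
    freq N * ‖v - ∑ k ∈ Finset.range N, tens (φ k) (a k)‖ ^ 2 ≤ ∑' k, freq k * ‖a k‖ ^ 2 := by
  have ht := ((hv.tendsto_sum_nat.sub_const
    (∑ k ∈ Finset.range N, tens (φ k) (a k))).norm.pow 2).const_mul (freq N)
  refine le_of_tendsto ht ?_
  filter_upwards [eventually_ge_atTop N] with M hM
  rw [← Finset.sum_Ico_eq_sub _ hM, norm_sq_sum_tens hφ, Finset.mul_sum]
  have h1 : ∑ k ∈ Finset.Ico N M, freq N * ‖a k‖ ^ 2 ≤ ∑ k ∈ Finset.Ico N M, freq k * ‖a k‖ ^ 2 := by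
    refine Finset.sum_le_sum fun k hk => ?_
    have := freq_mono (Finset.mem_Ico.1 hk).1
    gcongr
  exact h1.trans (ha.sum_le_tsum _ fun k _ => mul_nonneg (freq_pos k).le (by positivity))

/-- The derivative of the low frequency part. -/
lemma norm_low_deriv_sq_le {φ : ℕ → L2I ℝ} (hφ : Orthonormal ℝ φ) {a : ℕ → H}
    (ha : Summable fun k => freq k * ‖a k‖ ^ 2) (N : ℕ) :
    ‖∑ k ∈ Finset.range N, tens (φ k) (freq k • a k)‖ ^ 2 ≤ freq N * ∑' k, freq k * ‖a k‖ ^ 2 := by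
  rw [norm_sq_sum_tens hφ]
  have h1 : ∑ k ∈ Finset.range N, ‖freq k • a k‖ ^ 2 ≤
      ∑ k ∈ Finset.range N, freq N * (freq k * ‖a k‖ ^ 2) := by
    refine Finset.sum_le_sum fun k hk => ?_
    have h2 := freq_mono (Finset.mem_range.1 hk).le
    have h3 := freq_pos k
    rw [norm_smul, Real.norm_of_nonneg h3.le, mul_pow, sq (freq k), mul_assoc]
    gcongr
  refine h1.trans ?_
  rw [← Finset.mul_sum]
  exact mul_le_mul_of_nonneg_left
    (ha.sum_le_tsum _ fun k _ => mul_nonneg (freq_pos k).le (by positivity)) (freq_pos N).le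

end Energy

/-! ### Truncated powers, the kernels of repeated integration. -/

/-- The truncated power `τ₊^k / k!`, with value `0` for `τ ≤ 0`. -/
def truncPow (k : ℕ) (τ : ℝ) : ℝ := if 0 < τ then τ ^ k / k.factorial else 0

lemma truncPow_of_nonpos (k : ℕ) {τ : ℝ} (h : τ ≤ 0) : truncPow k τ = 0 := if_neg h.not_gt

lemma truncPow_of_pos (k : ℕ) {τ : ℝ} (h : 0 < τ) : truncPow k τ = τ ^ k / k.factorial := if_pos h

lemma truncPow_succ_of_nonneg (k : ℕ) {τ : ℝ} (h : 0 ≤ τ) :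
    truncPow (k + 1) τ = τ ^ (k + 1) / (k + 1).factorial := by
  rcases h.eq_or_lt with rfl | h
  · rw [truncPow_of_nonpos _ le_rfl]; simp
  · exact truncPow_of_pos _ h

lemma measurable_truncPow (k : ℕ) : Measurable (truncPow k) :=
  Measurable.ite measurableSet_Ioi (by fun_prop) measurable_const

lemma truncPow_nonneg (k : ℕ) (τ : ℝ) : 0 ≤ truncPow k τ := by
  unfold truncPow; split_ifs <;> positivity

lemma truncPow_le_one (k : ℕ) {τ : ℝ} (h : τ ≤ 1) : truncPow k τ ≤ 1 := by
  unfold truncPow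
  split_ifs with h0
  · have h1 : (1 : ℝ) ≤ k.factorial := by exact_mod_cast Nat.factorial_pos k
    rw [div_le_one (by positivity)]
    exact (pow_le_one₀ h0.le h).trans h1
  · exact zero_le_one

lemma abs_truncPow_le_one (k : ℕ) {τ : ℝ} (h : τ ≤ 1) : |truncPow k τ| ≤ 1 := by
  rw [abs_of_nonneg (truncPow_nonneg k τ)]; exact truncPow_le_one k h

lemma truncPow_mul {c : ℝ} (hc : 0 < c) (k : ℕ) (τ : ℝ) :
    truncPow k (c * τ) = c ^ k * truncPow k τ := by
  unfold truncPow
  by_cases h : 0 < τ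
  · rw [if_pos h, if_pos (by positivity), mul_pow, mul_div_assoc]
  · rw [if_neg h, if_neg (fun h' => h (pos_of_mul_pos_right h' hc.le)), mul_zero]

/-! ### Primitives vanishing at t = 0. -/

section Prim

variable {H : Type*} [NormedAddCommGroup H] [InnerProductSpace ℝ H]

lemma integrable_bdd_smul {K : ℝ → ℝ} (hK : Measurable K) (M : ℝ)
    (hM : ∀ t ∈ Ioo (0 : ℝ) 1, |K t| ≤ M) {q : ℝ → H} (hq : Integrable q timeMeasure) :
    Integrable (fun t => K t • q t) timeMeasure :=
  Integrable.bdd_smul hq M hK.aestronglyMeasurable (ae_mem_Ioo.mono fun t ht => hM t ht)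

/-- Fubini for bounded kernels. -/
lemma integral_kernel_swap [CompleteSpace H] {K : ℝ → ℝ → ℝ} (hK : Measurable (Function.uncurry K))
    (M : ℝ) (hM : ∀ t ∈ Ioo (0 : ℝ) 1, ∀ s ∈ Ioo (0 : ℝ) 1, |K t s| ≤ M) {q : ℝ → H}
    (hq : Integrable q timeMeasure) :
    ∫ t, ∫ s, K t s • q s ∂timeMeasure ∂timeMeasure =
      ∫ s, (∫ t, K t s ∂timeMeasure) • q s ∂timeMeasure := by
  rw [integral_integral_swap]
  · refine integral_congr_ae (Eventually.of_forall fun s => ?_)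
    exact integral_smul_const _ _
  · have h1 : Integrable (fun z : ℝ × ℝ => q z.2) (timeMeasure.prod timeMeasure) := hq.comp_snd _
    refine Integrable.bdd_smul h1 M hK.aestronglyMeasurable ?_
    have h2 : ∀ᵐ z ∂(timeMeasure.prod timeMeasure), z ∈ Ioo (0 : ℝ) 1 ×ˢ Ioo (0 : ℝ) 1 := by
      rw [Measure.prod_restrict]
      exact ae_restrict_mem (measurableSet_Ioo.prod measurableSet_Ioo)
    exact h2.mono fun z hz => hM z.1 hz.1 z.2 hz.2

/-- `v(t) = ∫_0^t q(s) ds`. -/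
def IsPrim (v q : L2I H) : Prop :=
  ⇑v =ᵐ[timeMeasure] fun t => ∫ s, truncPow 0 (t - s) • q s ∂timeMeasure

lemma integral_truncPow_zero {t : ℝ} (ht : t ∈ Icc (0 : ℝ) 1) (q : ℝ → H) :
    ∫ s, truncPow 0 (t - s) • q s ∂timeMeasure = ∫ s in (0 : ℝ)..t, q s := by
  have h : (fun s => truncPow 0 (t - s) • q s) = (Iio t).indicator q := by
    ext s
    by_cases hs : s < t
    · rw [indicator_of_mem (show s ∈ Iio t from hs), truncPow_of_pos _ (sub_pos.2 hs)]; simp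
    · rw [indicator_of_notMem (show s ∉ Iio t from hs),
        truncPow_of_nonpos _ (by linarith [not_lt.1 hs]), zero_smul]
  rw [h, integral_indicator measurableSet_Iio, Measure.restrict_restrict measurableSet_Iio,
    intervalIntegral.integral_of_le ht.1, integral_Ioc_eq_integral_Ioo]
  congr 2
  ext s
  simp only [mem_inter_iff, mem_Iio, mem_Ioo]
  constructor
  · rintro ⟨h1, h2, _⟩; exact ⟨h2, h1⟩
  · rintro ⟨h1, h2⟩; exact ⟨h2, h1, h2.trans_le ht.2⟩

lemma isPrim_iff (v q : L2I H) :
    IsPrim v q ↔ ⇑v =ᵐ[timeMeasure] fun t => ∫ s in (0 : ℝ)..t, q s := by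
  have h : (fun t => ∫ s, truncPow 0 (t - s) • q s ∂timeMeasure) =ᵐ[timeMeasure]
      fun t => ∫ s in (0 : ℝ)..t, q s :=
    ae_mem_Ioo.mono fun t ht => integral_truncPow_zero (Ioo_subset_Icc_self ht) _
  exact ⟨fun h1 => h1.trans h, fun h1 => h1.trans h.symm⟩

lemma sub_lt_one_of_mem {t s : ℝ} (ht : t ∈ Ioo (0 : ℝ) 1) (hs : s ∈ Ioo (0 : ℝ) 1) :
    t - s ≤ 1 := by linarith [ht.2, hs.1]

lemma integrable_truncPow_smul (k : ℕ) {t : ℝ} (ht : t ∈ Ioo (0 : ℝ) 1) {q : ℝ → H}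
    (hq : Integrable q timeMeasure) :
    Integrable (fun s => truncPow k (t - s) • q s) timeMeasure :=
  integrable_bdd_smul ((measurable_truncPow k).comp (measurable_const.sub measurable_id)) 1
    (fun _ hs => abs_truncPow_le_one k (sub_lt_one_of_mem ht hs)) hq

lemma IsPrim.add {v w q r : L2I H} (h1 : IsPrim v q) (h2 : IsPrim w r) :
    IsPrim (v + w) (q + r) := by
  unfold IsPrim at *
  filter_upwards [h1, h2, Lp.coeFn_add v w, ae_mem_Ioo] with t a1 a2 a3 ht
  rw [a3, Pi.add_apply, a1, a2, ← integral_add (integrable_truncPow_smul 0 ht (integrable_L2I q))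
    (integrable_truncPow_smul 0 ht (integrable_L2I r))]
  refine integral_congr_ae ?_
  filter_upwards [Lp.coeFn_add q r] with s hs
  rw [hs, Pi.add_apply, smul_add]

lemma IsPrim.smul {v q : L2I H} (c : ℝ) (h1 : IsPrim v q) : IsPrim (c • v) (c • q) := by
  unfold IsPrim at *
  filter_upwards [h1, Lp.coeFn_smul c v, ae_mem_Ioo] with t a1 a3 ht
  rw [a3, Pi.smul_apply, a1, ← integral_smul]
  refine integral_congr_ae ?_
  filter_upwards [Lp.coeFn_smul c q] with s hs
  rw [hs, Pi.smul_apply, smul_comm]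

lemma IsPrim.sub {v w q r : L2I H} (h1 : IsPrim v q) (h2 : IsPrim w r) :
    IsPrim (v - w) (q - r) := by
  have := h1.add (h2.smul (-1))
  simpa [sub_eq_add_neg] using this

lemma isPrim_zero : IsPrim (0 : L2I H) 0 := by
  unfold IsPrim
  filter_upwards [Lp.coeFn_zero H 2 timeMeasure] with t ht
  rw [ht, Pi.zero_apply]
  symm
  rw [← integral_zero ℝ H (μ := timeMeasure)]
  refine integral_congr_ae ?_
  filter_upwards [Lp.coeFn_zero H 2 timeMeasure] with s hs
  rw [hs, Pi.zero_apply, smul_zero]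

lemma IsPrim.sum {ι : Type*} (s : Finset ι) {v q : ι → L2I H} (h : ∀ i ∈ s, IsPrim (v i) (q i)) :
    IsPrim (∑ i ∈ s, v i) (∑ i ∈ s, q i) := by
  classical
  induction s using Finset.induction_on with
  | empty => simpa using isPrim_zero
  | insert i s hi ih =>
    rw [Finset.sum_insert hi, Finset.sum_insert hi]
    exact (h i (Finset.mem_insert_self _ _)).add
      (ih fun j hj => h j (Finset.mem_insert_of_mem hj))

variable [CompleteSpace H]

lemma IsPrim.tens {φ ψ : L2I ℝ} (h : IsPrim φ ψ) (a : H) : IsPrim (tens φ a) (tens ψ a) := by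
  unfold IsPrim at *
  filter_upwards [h, coeFn_tens φ a] with t h1 h2
  rw [h2, h1, ← integral_smul_const]
  refine integral_congr_ae ?_
  filter_upwards [coeFn_tens ψ a] with s hs
  rw [hs, smul_assoc]

lemma hasDerivAt_neg_cosFun_div (k : ℕ) (t : ℝ) :
    HasDerivAt (fun t => -(cosFun k t / freq k)) (sinFun k t) t := by
  unfold cosFun sinFun
  have h := (((((hasDerivAt_id t).const_mul (freq k)).cos).const_mul √2).div_const (freq k)).neg
  refine h.congr_deriv ?_
  have := (freq_pos k).ne'
  simp only [id]
  field_simp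

lemma cosFun_one (k : ℕ) : cosFun k 1 = 0 := by
  unfold cosFun freq
  rw [mul_one, Real.cos_add_nat_mul_pi, Real.cos_pi_div_two]; simp

/-- W_k vanishes at t = 1, so integrating V_k over (s,1) leaves only the value at s. This is
integration by parts at the level of kernels; no boundary term at 0 arises because primitives vanish
there. -/
lemma freq_mul_integral_sinFun {s : ℝ} (hs : s ∈ Ioo (0 : ℝ) 1) (k : ℕ) :
    freq k * ∫ t, sinFun k t * truncPow 0 (t - s) ∂timeMeasure = cosFun k s := by
  have h : ∫ t, sinFun k t * truncPow 0 (t - s) ∂timeMeasure = ∫ t in s..1, sinFun k t := by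
    have h : (fun t => sinFun k t * truncPow 0 (t - s)) = (Ioi s).indicator (sinFun k) := by
      ext t
      by_cases ht : s < t
      · rw [indicator_of_mem (show t ∈ Ioi s from ht), truncPow_of_pos _ (sub_pos.2 ht)]; simp
      · rw [indicator_of_notMem (show t ∉ Ioi s from ht),
          truncPow_of_nonpos _ (by linarith [not_lt.1 ht]), mul_zero]
    rw [h, integral_indicator measurableSet_Ioi, Measure.restrict_restrict measurableSet_Ioi,
      intervalIntegral.integral_of_le hs.2.le, integral_Ioc_eq_integral_Ioo]
    congr 2
    ext t
    simp only [mem_inter_iff, mem_Ioi, mem_Ioo]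
    constructor
    · rintro ⟨h1, h2, h3⟩; exact ⟨h1, h3⟩
    · rintro ⟨h1, h2⟩; exact ⟨h1, hs.1.trans h1, h2⟩
  rw [h, intervalIntegral.integral_eq_sub_of_hasDerivAt
    (fun t _ => hasDerivAt_neg_cosFun_div k t) ((continuous_sinFun k).intervalIntegrable _ _)]
  have := (freq_pos k).ne'
  rw [cosFun_one]
  field_simp
  ring

lemma measurable_sinFun (k : ℕ) : Measurable (sinFun k) := (continuous_sinFun k).measurable

/-- `√λ_k v_k = (∂_t v)_k` where the right hand side is a cosine coefficient. -/
lemma IsPrim.freq_smul_sinCoeff {v q : L2I H} (h : IsPrim v q) (k : ℕ) :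
    freq k • sinCoeff v k = cosCoeff q k := by
  have h1 : sinCoeff v k =
      ∫ t, ∫ s, (sinFun k t * truncPow 0 (t - s)) • q s ∂timeMeasure ∂timeMeasure := by
    refine integral_congr_ae ?_
    filter_upwards [h] with t ht
    rw [ht, ← integral_smul]
    simp_rw [smul_smul]
  rw [h1, integral_kernel_swap (K := fun t s => sinFun k t * truncPow 0 (t - s)) ?_ √2 ?_
    (integrable_L2I q), ← integral_smul]
  · refine integral_congr_ae ?_
    filter_upwards [ae_mem_Ioo] with s hs
    rw [smul_smul, freq_mul_integral_sinFun hs]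
  · exact ((measurable_sinFun k).comp measurable_fst).mul
      ((measurable_truncPow 0).comp (measurable_fst.sub measurable_snd))
  · intro t ht s hs
    rw [abs_mul]
    have h1 := abs_sinFun_le k t
    have h2 := abs_truncPow_le_one 0 (sub_lt_one_of_mem ht hs)
    calc _ ≤ √2 * 1 := by gcongr
      _ = _ := mul_one _

/-- Interpolation between `L²` and `H¹`. -/
lemma IsPrim.sinEnergy_le {v q : L2I H} (h : IsPrim v q) :
    sinEnergy v ≤ ENNReal.ofReal (‖v‖ * ‖q‖) := by
  refine sinEnergy_le_ofReal_of_sum_le fun s => ?_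
  -- One factor √λ_k is absorbed by the derivative; what remains is Cauchy–Schwarz, with Bessel for
  -- the sines of `v` and for the cosines of `q`.
  have h1 : ∑ k ∈ s, freq k * ‖sinCoeff v k‖ ^ 2 = ∑ k ∈ s, ‖sinCoeff v k‖ * ‖cosCoeff q k‖ := by
    refine Finset.sum_congr rfl fun k _ => ?_
    rw [← h.freq_smul_sinCoeff, norm_smul, Real.norm_of_nonneg (freq_pos k).le]; ring
  rw [h1]
  refine (Real.sum_mul_le_sqrt_mul_sqrt s _ _).trans ?_
  have h2 := bessel orthonormal_sinL s v
  have h3 := bessel orthonormal_cosL s q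
  simp_rw [← sinCoeff_eq] at h2
  simp_rw [← cosCoeff_eq] at h3
  gcongr
  · exact (Real.sqrt_le_left (norm_nonneg _)).2 h2
  · exact (Real.sqrt_le_left (norm_nonneg _)).2 h3

/-- Functions with a bounded right derivative are primitives. -/
lemma isPrim_of_hasDerivWithinAt {φ ψ : L2I ℝ} {f g : ℝ → ℝ} (hf : ContinuousOn f (Icc 0 1))
    (h0 : f 0 = 0) (hd : ∀ t ∈ Ioo (0 : ℝ) 1, HasDerivWithinAt f (g t) (Ioi t) t)
    (hφ : ⇑φ =ᵐ[timeMeasure] f) (hψ : ⇑ψ =ᵐ[timeMeasure] g) : IsPrim φ ψ := by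
  rw [isPrim_iff]
  have hgi : IntegrableOn g (Icc 0 1) := by
    rw [integrableOn_Icc_iff_integrableOn_Ioo]
    exact (integrable_L2I ψ).congr hψ
  filter_upwards [hφ, ae_mem_Ioo] with t h1 ht
  have h2 : ∫ s in (0 : ℝ)..t, ψ s = ∫ s in (0 : ℝ)..t, g s := by
    rw [← integral_truncPow_zero (Ioo_subset_Icc_self ht),
      ← integral_truncPow_zero (Ioo_subset_Icc_self ht)]
    refine integral_congr_ae ?_
    filter_upwards [hψ] with s hs
    rw [hs]
  rw [h1, h2, intervalIntegral.integral_eq_sub_of_hasDeriv_right_of_le ht.1.le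
    (hf.mono (Icc_subset_Icc_right ht.2.le))
    (fun s hs => hd s ⟨hs.1, hs.2.trans ht.2⟩) ?_, h0, sub_zero]
  rw [intervalIntegrable_iff_integrableOn_Icc_of_le ht.1.le]
  exact hgi.mono_set (Icc_subset_Icc_right ht.2.le)

lemma isPrim_sinL (k : ℕ) : IsPrim (sinL k) (freq k • cosL k) := by
  refine isPrim_of_hasDerivWithinAt (f := sinFun k) (g := fun t => freq k * cosFun k t)
    (continuous_sinFun k).continuousOn (by simp [sinFun])
    (fun t _ => (hasDerivAt_sinFun k t).hasDerivWithinAt) (coeFn_sinL k) ?_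
  filter_upwards [Lp.coeFn_smul (freq k) (cosL k), coeFn_cosL k] with t h1 h2
  rw [h1, Pi.smul_apply, h2, smul_eq_mul]

/-- The constant function `1`. -/
def oneL : L2I ℝ := (memLp_of_continuous (f := fun _ : ℝ => (1 : ℝ)) continuous_const).toLp

lemma coeFn_oneL : ⇑oneL =ᵐ[timeMeasure] fun _ => (1 : ℝ) := MemLp.coeFn_toLp _

/-- W_k(0) = √2, so W_k is a primitive only after this constant is removed. These constants are the
reason why the residual of the operator in time must have mean zero. -/
lemma isPrim_cosL (k : ℕ) : IsPrim (cosL k - √2 • oneL) (-(freq k • sinL k)) := by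
  refine isPrim_of_hasDerivWithinAt (f := fun t => cosFun k t - √2)
    (g := fun t => -(freq k * sinFun k t))
    ((continuous_cosFun k).sub continuous_const).continuousOn (by simp [cosFun])
    (fun t _ => HasDerivAt.hasDerivWithinAt ?_) ?_ ?_
  · refine HasDerivAt.sub_const _ ?_
    unfold cosFun sinFun
    have h := (((hasDerivAt_id t).const_mul (freq k)).cos).const_mul √2
    refine h.congr_deriv ?_
    simp only [id]
    ring
  · filter_upwards [Lp.coeFn_sub (cosL k) (√2 • oneL), Lp.coeFn_smul √2 oneL, coeFn_cosL k,
      coeFn_oneL] with t h1 h2 h3 h4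
    rw [h1, Pi.sub_apply, h2, Pi.smul_apply, h3, h4, smul_eq_mul, mul_one]
  · filter_upwards [Lp.coeFn_neg (freq k • sinL k), Lp.coeFn_smul (freq k) (sinL k),
      coeFn_sinL k] with t h1 h2 h3
    rw [h1, Pi.neg_apply, h2, Pi.smul_apply, h3, smul_eq_mul]

/-- The pointwise bound for primitives. -/
lemma IsPrim.norm_le_sqrt {v q : L2I H} (h : IsPrim v q) :
    ∀ᵐ t ∂timeMeasure, ‖v t‖ ≤ √t * ‖q‖ := by
  filter_upwards [h, ae_mem_Ioo] with t h1 ht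
  have hm : MemLp (fun s => truncPow 0 (t - s)) 2 timeMeasure :=
    memLp_of_bound_on
      ((measurable_truncPow 0).comp (measurable_const.sub measurable_id)).aestronglyMeasurable 1
      fun s hs => abs_truncPow_le_one 0 (sub_lt_one_of_mem ht hs)
  have h2 : v t = coef hm.toLp q := by
    rw [h1, coef_eq_of_ae hm.coeFn_toLp]
  rw [h2]
  refine (norm_coef_le _ _).trans (mul_le_mul_of_nonneg_right ?_ (norm_nonneg _))
  refine Real.le_sqrt_of_sq_le (le_of_eq ?_)
  rw [← real_inner_self_eq_norm_sq, L2.inner_def]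
  have h3 : ∫ s, inner ℝ (hm.toLp _ s) (hm.toLp _ s) ∂timeMeasure =
      ∫ s, truncPow 0 (t - s) • (1 : ℝ) ∂timeMeasure := by
    refine integral_congr_ae ?_
    filter_upwards [hm.coeFn_toLp] with s hs
    rw [hs]
    unfold truncPow
    split_ifs <;> simp
  rw [h3, integral_truncPow_zero (Ioo_subset_Icc_self ht)]
  simp

end Prim

/-! ### Repeated integration, weak time derivatives and Taylor representation. -/

section PrimOp

variable {H : Type*} [NormedAddCommGroup H] [InnerProductSpace ℝ H]

lemma IsPrim.unique {v w q : L2I H} (h1 : IsPrim v q) (h2 : IsPrim w q) : v = w :=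
  Lp.ext (h1.trans h2.symm)

variable [CompleteSpace H]

lemma memLp_truncPow_integral (k : ℕ) (q : L2I H) :
    MemLp (fun t => ∫ s, truncPow k (t - s) • q s ∂timeMeasure) 2 timeMeasure := by
  refine memLp_of_bound_on ?_ (∫ s, ‖q s‖ ∂timeMeasure) ?_
  · have h : AEStronglyMeasurable (fun z : ℝ × ℝ => truncPow k (z.1 - z.2) • q z.2)
        (timeMeasure.prod timeMeasure) :=
      ((measurable_truncPow k).comp
        (measurable_fst.sub measurable_snd)).aestronglyMeasurable.smul
        (Lp.aestronglyMeasurable q).comp_snd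
    exact h.integral_prod_right'
  · intro t ht
    refine norm_integral_le_of_norm_le (integrable_L2I q).norm ?_
    filter_upwards [ae_mem_Ioo] with s hs
    rw [norm_smul]
    exact mul_le_of_le_one_left (norm_nonneg _) (abs_truncPow_le_one k (sub_lt_one_of_mem ht hs))

/-- `t ↦ ∫ (t - s)₊^k / k! q(s) ds`. -/
def powInt (k : ℕ) (q : L2I H) : L2I H := (memLp_truncPow_integral k q).toLp

lemma coeFn_powInt (k : ℕ) (q : L2I H) :
    ⇑(powInt k q) =ᵐ[timeMeasure] fun t => ∫ s, truncPow k (t - s) • q s ∂timeMeasure :=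
  MemLp.coeFn_toLp _

lemma isPrim_powInt_zero (q : L2I H) : IsPrim (powInt 0 q) q := coeFn_powInt 0 q

/-- Integrating the kernel once raises its order by one. With `0 ≤ a`, integration starts at or
before the knot, so nothing is lost at the lower limit. -/
lemma integral_truncPow_mul {t a : ℝ} (ht : t ∈ Ioo (0 : ℝ) 1) (ha : 0 ≤ a) (k : ℕ) :
    ∫ τ, truncPow 0 (t - τ) * truncPow k (τ - a) ∂timeMeasure = truncPow (k + 1) (t - a) := by
  have h0 := integral_truncPow_zero (Ioo_subset_Icc_self ht) (fun τ => truncPow k (τ - a))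
  simp only [smul_eq_mul] at h0
  rw [h0]
  rcases le_or_gt t a with h | h
  · rw [truncPow_of_nonpos _ (by linarith)]
    rw [intervalIntegral.integral_congr (g := fun _ => (0 : ℝ)), intervalIntegral.integral_zero]
    intro τ hτ
    rw [uIcc_of_le ht.1.le] at hτ
    exact truncPow_of_nonpos _ (by linarith [hτ.2])
  · have hint : ∀ x y : ℝ, IntervalIntegrable (fun τ => truncPow k (τ - a)) volume x y := by
      intro x y
      have hm : Monotone fun τ => truncPow k (τ - a) := by
        intro u v huv
        simp only [truncPow]
        split_ifs with h1 h2 h2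
        · gcongr
        · exact absurd (h1.trans_le (by linarith)) h2
        · positivity
        · exact le_rfl
      exact hm.intervalIntegrable
    rw [← intervalIntegral.integral_add_adjacent_intervals (hint 0 a) (hint a t)]
    have h1 : ∫ τ in (0 : ℝ)..a, truncPow k (τ - a) = 0 := by
      rw [intervalIntegral.integral_congr (g := fun _ => (0 : ℝ)), intervalIntegral.integral_zero]
      intro τ hτ
      rw [uIcc_of_le ha] at hτ
      exact truncPow_of_nonpos _ (by linarith [hτ.2])
    have h2 : ∫ τ in a..t, truncPow k (τ - a) = ∫ τ in a..t, (τ - a) ^ k / k.factorial := by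
      refine intervalIntegral.integral_congr_ae (Eventually.of_forall fun τ hτ => ?_)
      rw [uIoc_of_le h.le] at hτ
      exact truncPow_of_pos _ (by linarith [hτ.1])
    rw [h1, h2, zero_add, intervalIntegral.integral_div,
      intervalIntegral.integral_comp_sub_right (fun x => x ^ k), integral_pow,
      truncPow_of_pos _ (by linarith), Nat.factorial_succ]
    push_cast
    rw [sub_self, zero_pow (Nat.succ_ne_zero k), sub_zero, div_div]

lemma isPrim_powInt_succ (k : ℕ) (q : L2I H) : IsPrim (powInt (k + 1) q) (powInt k q) := by
  unfold IsPrim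
  filter_upwards [coeFn_powInt (k + 1) q, ae_mem_Ioo] with t h1 ht
  have h2 : ∫ τ, truncPow 0 (t - τ) • powInt k q τ ∂timeMeasure =
      ∫ τ, ∫ s, (truncPow 0 (t - τ) * truncPow k (τ - s)) • q s ∂timeMeasure ∂timeMeasure := by
    refine integral_congr_ae ?_
    filter_upwards [coeFn_powInt k q] with τ hτ
    rw [hτ, ← integral_smul]
    simp_rw [smul_smul]
  rw [h1, h2, integral_kernel_swap (K := fun τ s => truncPow 0 (t - τ) * truncPow k (τ - s)) ?_ 1 ?_
    (integrable_L2I q)]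
  · refine integral_congr_ae ?_
    filter_upwards [ae_mem_Ioo] with s hs
    rw [integral_truncPow_mul ht hs.1.le]
  · exact ((measurable_truncPow 0).comp (measurable_const.sub measurable_fst)).mul
      ((measurable_truncPow k).comp (measurable_fst.sub measurable_snd))
  · intro τ hτ s hs
    rw [abs_mul]
    exact mul_le_one₀ (abs_truncPow_le_one 0 (sub_lt_one_of_mem ht hτ)) (abs_nonneg _)
      (abs_truncPow_le_one k (sub_lt_one_of_mem hτ hs))

/-- The primitive vanishing at `0` as a linear operator. -/
def primL : L2I H →ₗ[ℝ] L2I H where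
  toFun := powInt 0
  map_add' v w := (isPrim_powInt_zero (v + w)).unique
    ((isPrim_powInt_zero v).add (isPrim_powInt_zero w))
  map_smul' c v := (isPrim_powInt_zero (c • v)).unique ((isPrim_powInt_zero v).smul c)

lemma isPrim_primL (q : L2I H) : IsPrim (primL q) q := isPrim_powInt_zero q

/-- Cauchy's formula for repeated integration: iterated primitives become a single integral
operator, whose kernel can then be approximated by splines. -/
lemma primL_pow_succ (k : ℕ) (q : L2I H) : (primL ^ (k + 1)) q = powInt k q := by
  induction k with
  | zero => rw [zero_add, pow_one]; rfl
  | succ k ih =>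
    rw [pow_succ', Module.End.mul_apply, ih]
    exact (isPrim_primL _).unique (isPrim_powInt_succ k q)

/-- The monomial `t^k / k!`. -/
def monoL (k : ℕ) : L2I ℝ :=
  (memLp_of_continuous (f := fun t : ℝ => t ^ k / k.factorial) (by fun_prop)).toLp

lemma coeFn_monoL (k : ℕ) : ⇑(monoL k) =ᵐ[timeMeasure] fun t => t ^ k / k.factorial :=
  MemLp.coeFn_toLp _

lemma monoL_zero : monoL 0 = oneL := by
  apply Lp.ext
  filter_upwards [coeFn_monoL 0, coeFn_oneL] with t h1 h2
  rw [h1, h2]; simp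

lemma isPrim_monoL_succ (k : ℕ) : IsPrim (monoL (k + 1)) (monoL k) := by
  refine isPrim_of_hasDerivWithinAt (Continuous.continuousOn (by fun_prop)) (by simp)
    (fun t _ => HasDerivAt.hasDerivWithinAt ?_) (coeFn_monoL (k + 1)) (coeFn_monoL k)
  have h := (hasDerivAt_pow (k + 1) t).div_const ((k + 1).factorial : ℝ)
  refine h.congr_deriv ?_
  rw [Nat.factorial_succ]
  push_cast
  have : ((k.factorial : ℕ) : ℝ) ≠ 0 := by positivity
  field_simp

lemma primL_pow_tens_oneL (k : ℕ) (a : H) : (primL ^ k) (tens oneL a) = tens (monoL k) a := by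
  induction k with
  | zero => rw [pow_zero, monoL_zero]; rfl
  | succ k ih =>
    rw [pow_succ', Module.End.mul_apply, ih]
    exact (isPrim_primL _).unique ((isPrim_monoL_succ k).tens a)

/-- `g` is the weak time derivative of `v`. -/
def HasWeakTimeDeriv (v g : L2I H) : Prop :=
  ∀ φ : ℝ → ℝ, ContDiff ℝ ∞ φ → HasCompactSupport φ → tsupport φ ⊆ Ioo (0 : ℝ) 1 →
    ∫ t, deriv φ t • v t ∂timeMeasure = -∫ t, φ t • g t ∂timeMeasure

lemma hasWeakTimeDeriv_primL (q : L2I H) : HasWeakTimeDeriv (primL q) q := by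
  intro φ hφ _ hs
  have hd : Continuous (deriv φ) := hφ.continuous_deriv (by simp)
  obtain ⟨M, hM⟩ := (isCompact_Icc (a := (0 : ℝ)) (b := 1)).exists_bound_of_continuousOn
    hd.continuousOn
  have h2 : ∫ t, deriv φ t • primL q t ∂timeMeasure =
      ∫ t, ∫ s, (deriv φ t * truncPow 0 (t - s)) • q s ∂timeMeasure ∂timeMeasure := by
    refine integral_congr_ae ?_
    filter_upwards [isPrim_primL q] with τ hτ
    rw [hτ, ← integral_smul]
    simp_rw [smul_smul]
  rw [h2, integral_kernel_swap (K := fun t s => deriv φ t * truncPow 0 (t - s)) ?_ M ?_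
    (integrable_L2I q), ← integral_neg]
  · refine integral_congr_ae ?_
    filter_upwards [ae_mem_Ioo] with s hs'
    rw [← neg_smul]
    congr 1
    have h : (fun t => deriv φ t * truncPow 0 (t - s)) = (Ioi s).indicator (deriv φ) := by
      ext t
      by_cases ht : s < t
      · rw [indicator_of_mem (show t ∈ Ioi s from ht), truncPow_of_pos _ (sub_pos.2 ht)]; simp
      · rw [indicator_of_notMem (show t ∉ Ioi s from ht),
          truncPow_of_nonpos _ (by linarith [not_lt.1 ht]), mul_zero]
    have hset : Ioi s ∩ Ioo 0 1 = Ioo s 1 := by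
      ext t
      simp only [mem_inter_iff, mem_Ioi, mem_Ioo]
      constructor
      · rintro ⟨h1, h2, h3⟩; exact ⟨h1, h3⟩
      · rintro ⟨h1, h2⟩; exact ⟨h1, hs'.1.trans h1, h2⟩
    rw [h, integral_indicator measurableSet_Ioi, Measure.restrict_restrict measurableSet_Ioi,
      hset, ← integral_Ioc_eq_integral_Ioo, ← intervalIntegral.integral_of_le hs'.2.le,
      intervalIntegral.integral_deriv_eq_sub
        (fun t _ => (hφ.differentiable (by simp)).differentiableAt)
        (hd.intervalIntegrable _ _),
      image_eq_zero_of_notMem_tsupport (fun h => lt_irrefl _ (hs h).2), zero_sub]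
  · exact (hd.measurable.comp measurable_fst).mul
      ((measurable_truncPow 0).comp (measurable_fst.sub measurable_snd))
  · intro t ht s hs
    rw [abs_mul, ← mul_one M]
    exact mul_le_mul (hM t (Ioo_subset_Icc_self ht))
      (abs_truncPow_le_one 0 (sub_lt_one_of_mem ht hs)) (abs_nonneg _)
      ((norm_nonneg _).trans (hM t (Ioo_subset_Icc_self ht)))

/-- A test function with mean value zero has a primitive which is a test function. -/
lemma exists_test_primitive {ψ : ℝ → ℝ} (hψ : ContDiff ℝ ∞ ψ) (hc : HasCompactSupport ψ)
    (hs : tsupport ψ ⊆ Ioo (0 : ℝ) 1) (hi : ∫ t in (0 : ℝ)..1, ψ t = 0) :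
    ∃ φ : ℝ → ℝ, ContDiff ℝ ∞ φ ∧ HasCompactSupport φ ∧ tsupport φ ⊆ Ioo (0 : ℝ) 1 ∧
      deriv φ = ψ := by
  by_cases hne : (tsupport ψ).Nonempty
  swap
  · refine ⟨0, contDiff_const, HasCompactSupport.zero, ?_, ?_⟩
    · intro x hx; simp [tsupport] at hx
    · rw [not_nonempty_iff_eq_empty, tsupport_eq_empty_iff] at hne
      rw [hne]; ext; simp
  have hcomp : IsCompact (tsupport ψ) := hc
  set α := sInf (tsupport ψ)
  set β := sSup (tsupport ψ)
  have hα : α ∈ Ioo (0 : ℝ) 1 := hs (hcomp.sInf_mem hne)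
  have hβ : β ∈ Ioo (0 : ℝ) 1 := hs (hcomp.sSup_mem hne)
  have hz1 : ∀ t < α, ψ t = 0 := fun t ht =>
    image_eq_zero_of_notMem_tsupport fun h => (csInf_le hcomp.bddBelow h).not_gt ht
  have hz2 : ∀ t > β, ψ t = 0 := fun t ht =>
    image_eq_zero_of_notMem_tsupport fun h => (le_csSup hcomp.bddAbove h).not_gt ht
  have hd : ∀ t, HasDerivAt (fun t => ∫ s in (0 : ℝ)..t, ψ s) (ψ t) t := fun t =>
    intervalIntegral.integral_hasDerivAt_right (hψ.continuous.intervalIntegrable _ _)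
      (hψ.continuous.stronglyMeasurableAtFilter _ _) hψ.continuous.continuousAt
  have hde : deriv (fun t => ∫ s in (0 : ℝ)..t, ψ s) = ψ := by
    ext t; exact (hd t).deriv
  -- To the right of the support the primitive equals the full integral of `ψ`, which is zero.
  have hsupp : ∀ t ∉ Icc α β, ∫ s in (0 : ℝ)..t, ψ s = 0 := by
    intro t ht
    rw [mem_Icc, not_and_or, not_le, not_le] at ht
    rcases ht with ht | ht
    · rw [intervalIntegral.integral_congr (g := fun _ => (0 : ℝ)), intervalIntegral.integral_zero]
      intro s hs'
      refine hz1 s (hs'.2.trans_lt ?_)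
      exact max_lt hα.1 ht
    · rw [← intervalIntegral.integral_add_adjacent_intervals
        (hψ.continuous.intervalIntegrable 0 1) (hψ.continuous.intervalIntegrable 1 t), hi, zero_add,
        intervalIntegral.integral_congr (g := fun _ => (0 : ℝ)), intervalIntegral.integral_zero]
      intro s hs'
      refine hz2 s (lt_of_lt_of_le ?_ hs'.1)
      exact lt_min hβ.2 ht
  have hts : tsupport (fun t => ∫ s in (0 : ℝ)..t, ψ s) ⊆ Icc α β := by
    refine closure_minimal (fun t ht => ?_) isClosed_Icc
    by_contra h
    exact ht (hsupp t h)
  refine ⟨_, ?_, HasCompactSupport.of_support_subset_isCompact isCompact_Icc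
    ((subset_tsupport _).trans hts), hts.trans fun t ht => ⟨hα.1.trans_le ht.1, ht.2.trans_lt hβ.2⟩,
    hde⟩
  rw [contDiff_infty_iff_deriv, hde]
  exact ⟨fun t => (hd t).differentiableAt, hψ⟩

/-- Functions with vanishing weak derivative are constant. -/
lemma exists_eq_const_of_weakDeriv_zero {w : L2I H}
    (h : ∀ φ : ℝ → ℝ, ContDiff ℝ ∞ φ → HasCompactSupport φ → tsupport φ ⊆ Ioo (0 : ℝ) 1 →
      ∫ t, deriv φ t • w t ∂timeMeasure = 0) : ∃ a : H, w = tens oneL a := by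
  -- A bump of integral one supported in [1/4, 3/4]. The constant sought is the mean of `w` with
  -- this weight.
  let B : ContDiffBump (1 / 2 : ℝ) := ⟨1 / 8, 1 / 4, by norm_num, by norm_num⟩
  set θ : ℝ → ℝ := B.normed volume with hθ
  have hθs : tsupport θ ⊆ Ioo (0 : ℝ) 1 := by
    rw [hθ, B.tsupport_normed_eq, Real.closedBall_eq_Icc]
    intro t ht
    constructor
    · have := ht.1; norm_num [B] at this; linarith
    · have := ht.2; norm_num [B] at this; linarith
  have hθc : ContDiff ℝ ∞ θ := B.contDiff_normed
  have hθk : HasCompactSupport θ := B.hasCompactSupport_normed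
  have hθi : ∫ t in (0 : ℝ)..1, θ t = 1 := by
    refine Eq.trans ?_ (B.integral_normed (μ := volume))
    rw [intervalIntegral.integral_of_le zero_le_one]
    refine setIntegral_eq_integral_of_forall_compl_eq_zero fun t ht => ?_
    exact image_eq_zero_of_notMem_tsupport fun h => ht (Ioo_subset_Ioc_self (hθs h))
  refine ⟨∫ t, θ t • w t ∂timeMeasure, ?_⟩
  set a := ∫ t, θ t • w t ∂timeMeasure with ha
  have hloc : LocallyIntegrableOn (fun t => w t - a) (Ioo (0 : ℝ) 1) volume :=
    IntegrableOn.locallyIntegrableOn ((integrable_L2I w).sub (integrable_const a))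
  have key := isOpen_Ioo.ae_eq_zero_of_integral_contDiff_smul_eq_zero hloc ?_
  · apply Lp.ext
    filter_upwards [(ae_restrict_iff' measurableSet_Ioo).2 key, coeFn_tens oneL a, coeFn_oneL]
      with t h1 h2 h3
    rw [h2, h3, one_smul]
    exact sub_eq_zero.1 h1
  intro ψ hψ hψc hψs
  have hset : ∫ t, ψ t • (w t - a) = ∫ t, ψ t • (w t - a) ∂timeMeasure := by
    rw [setIntegral_eq_integral_of_forall_compl_eq_zero]
    intro t ht
    rw [image_eq_zero_of_notMem_tsupport (fun h => ht (hψs h)), zero_smul]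
  rw [hset]
  set c := ∫ t in (0 : ℝ)..1, ψ t with hcdef
  have hcθ : Continuous fun t => c * θ t := continuous_const.mul hθc.continuous
  -- Subtracting c·θ removes the mean of `ψ`, and a mean-zero test function is the derivative of a
  -- test function, on which the hypothesis applies.
  obtain ⟨φ, hφ1, hφ2, hφ3, hφ4⟩ := exists_test_primitive (ψ := fun t => ψ t - c * θ t)
    (hψ.sub (contDiff_const.mul hθc)) (hψc.sub (hθk.mul_left (f := fun _ => c)))
    ((tsupport_sub _ _).trans (union_subset hψs
      ((tsupport_mul_subset_right (f := fun _ => c)).trans hθs))) (by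
      rw [intervalIntegral.integral_sub (hψ.continuous.intervalIntegrable _ _)
        (hcθ.intervalIntegrable _ _),
        intervalIntegral.integral_const_mul, hθi, mul_one, sub_self])
  have h0 := h φ hφ1 hφ2 hφ3
  rw [hφ4] at h0
  have hI1 := integrable_continuous_smul hψ.continuous w
  have hI2 := integrable_continuous_smul hθc.continuous w
  have h1 : ∫ t, (ψ t - c * θ t) • w t ∂timeMeasure = ∫ t, ψ t • w t ∂timeMeasure - c • a := by
    simp_rw [sub_smul, mul_smul]
    have hI3 : Integrable (fun t => c • θ t • w t) timeMeasure := hI2.smul c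
    rw [integral_sub hI1 hI3, integral_smul]
  rw [h1] at h0
  simp_rw [smul_sub]
  rw [integral_sub hI1 ?_, integral_smul_const, integral_timeMeasure ψ, ← hcdef, h0]
  have : MemLp ψ 2 timeMeasure := memLp_of_continuous hψ.continuous
  exact (this.integrable (by norm_num)).smul_const a

lemma HasWeakTimeDeriv.exists_eq {v g : L2I H} (h : HasWeakTimeDeriv v g) :
    ∃ a : H, v = tens oneL a + primL g := by
  obtain ⟨a, ha⟩ := exists_eq_const_of_weakDeriv_zero (w := v - primL g) (by
    intro φ h1 h2 h3
    have hd : Continuous (deriv φ) := h1.continuous_deriv (by simp)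
    have he : ∫ t, deriv φ t • (v - primL g) t ∂timeMeasure =
        ∫ t, (deriv φ t • v t - deriv φ t • primL g t) ∂timeMeasure := by
      refine integral_congr_ae ?_
      filter_upwards [Lp.coeFn_sub v (primL g)] with t ht
      rw [ht, Pi.sub_apply, smul_sub]
    rw [he, integral_sub (integrable_continuous_smul hd v) (integrable_continuous_smul hd _),
      h φ h1 h2 h3, hasWeakTimeDeriv_primL g φ h1 h2 h3, sub_self])
  exact ⟨a, by rw [← ha]; abel⟩

/-- Taylor representation of functions in `H^m(I; H)`. -/
theorem MemSobolevTime.exists_eq {m : ℕ} {v : L2I H} (h : MemSobolevTime m v) :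
    ∃ (a : ℕ → H) (q : L2I H),
      v = ∑ k ∈ Finset.range m, tens (monoL k) (a k) + (primL ^ m) q := by
  choose! g hg using h
  -- Testing the k-th derivative with φ' and the next one with φ shows that the chosen functions are
  -- successive weak derivatives of each other.
  have hw : ∀ k < m, HasWeakTimeDeriv (g k) (g (k + 1)) := by
    intro k hk φ h1 h2 h3
    have e1 := hg k hk.le (deriv φ) (by
      have := h1.iterate_deriv 1; simpa using this) h2.deriv
      ((tsupport_deriv_subset (𝕜 := ℝ) (f := φ)).trans h3)
    have e2 := hg (k + 1) hk φ h1 h2 h3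
    rw [← iteratedDeriv_succ', e2, pow_succ, mul_neg, mul_one, neg_smul] at e1
    have h4 : ((-1 : ℝ) ^ k) ≠ 0 := by positivity
    have h5 := (smul_right_injective H h4) (by
      rw [smul_neg, e1] :
        (-1 : ℝ) ^ k • -∫ t, φ t • g (k + 1) t ∂timeMeasure =
        (-1 : ℝ) ^ k • ∫ t, deriv φ t • g k t ∂timeMeasure)
    exact h5.symm
  have hg0 : v = g 0 := by
    have hloc : LocallyIntegrableOn (fun t => v t - g 0 t) (Ioo (0 : ℝ) 1) volume :=
      IntegrableOn.locallyIntegrableOn ((integrable_L2I v).sub (integrable_L2I (g 0)))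
    have key := isOpen_Ioo.ae_eq_zero_of_integral_contDiff_smul_eq_zero hloc ?_
    · apply Lp.ext
      filter_upwards [(ae_restrict_iff' measurableSet_Ioo).2 key] with t h1
      exact sub_eq_zero.1 h1
    intro ψ hψ hψc hψs
    have hset : ∫ t, ψ t • (v t - g 0 t) = ∫ t, ψ t • (v t - g 0 t) ∂timeMeasure := by
      rw [setIntegral_eq_integral_of_forall_compl_eq_zero]
      intro t ht
      rw [image_eq_zero_of_notMem_tsupport (fun h => ht (hψs h)), zero_smul]
    rw [hset]
    simp_rw [smul_sub]
    rw [integral_sub (integrable_continuous_smul hψ.continuous v)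
      (integrable_continuous_smul hψ.continuous _)]
    have := hg 0 (Nat.zero_le _) ψ hψ hψc hψs
    simp only [iteratedDeriv_zero, pow_zero, one_smul] at this
    rw [this, sub_self]
  have ha : ∀ k < m, ∃ a : H, g k = tens oneL a + primL (g (k + 1)) := fun k hk =>
    (hw k hk).exists_eq
  choose! a ha using ha
  refine ⟨a, g m, ?_⟩
  -- Taylor expansion by iteration: each derivative is a constant plus the primitive of the next,
  -- and j-fold integration turns that constant into the monomial of degree j.
  have : ∀ j ≤ m, v = ∑ k ∈ Finset.range j, tens (monoL k) (a k) + (primL ^ j) (g j) := by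
    intro j
    induction j with
    | zero => intro _; simpa using hg0
    | succ j ih =>
      intro hj
      rw [Finset.sum_range_succ, pow_succ, Module.End.mul_apply, add_assoc,
        ← primL_pow_tens_oneL, ← map_add, ← ha j hj]
      exact ih (Nat.le_of_succ_le hj)
  exact this m le_rfl

end PrimOp

/-! ### The temporal spline space and its inverse inequality. -/

section Splines

lemma temporalSpace_add {d r N : ℕ} {f g : ℝ → ℝ} (hf : f ∈ temporalSpace d r N)
    (hg : g ∈ temporalSpace d r N) : f + g ∈ temporalSpace d r N := by
  refine ⟨hf.1.add hg.1, by rw [Pi.add_apply, hf.2.1, hg.2.1, add_zero], fun l hl => ?_⟩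
  obtain ⟨p, hp, hp2⟩ := hf.2.2 l hl
  obtain ⟨q, hq, hq2⟩ := hg.2.2 l hl
  refine ⟨p + q, (Polynomial.degree_add_le p q).trans_lt (max_lt hp hq), fun t ht => ?_⟩
  rw [Pi.add_apply, hp2 t ht, hq2 t ht, Polynomial.eval_add]

lemma temporalSpace_smul {d r N : ℕ} {f : ℝ → ℝ} (c : ℝ) (hf : f ∈ temporalSpace d r N) :
    c • f ∈ temporalSpace d r N := by
  refine ⟨hf.1.const_smul c, by rw [Pi.smul_apply, hf.2.1, smul_zero], fun l hl => ?_⟩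
  obtain ⟨p, hp, hp2⟩ := hf.2.2 l hl
  refine ⟨c • p, (Polynomial.degree_smul_le c p).trans_lt hp, fun t ht => ?_⟩
  rw [Pi.smul_apply, hp2 t ht, Polynomial.eval_smul]

lemma temporalSpace_zero (d r N : ℕ) : (0 : ℝ → ℝ) ∈ temporalSpace d r N := by
  refine ⟨contDiffOn_const, rfl, fun l _ => ⟨0, ?_, fun t _ => by simp⟩⟩
  rw [Polynomial.degree_zero]
  exact WithBot.bot_lt_coe d

/-- The temporal spline space as a subspace of `L²(I)`. -/
def splineSub (d r N : ℕ) : Submodule ℝ (L2I ℝ) where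
  carrier := {φ | ∃ f ∈ temporalSpace d r N, ⇑φ =ᵐ[timeMeasure] f}
  zero_mem' := ⟨0, temporalSpace_zero d r N, Lp.coeFn_zero ℝ 2 timeMeasure⟩
  add_mem' := by
    rintro φ ψ ⟨f, hf, hf2⟩ ⟨g, hg, hg2⟩
    exact ⟨f + g, temporalSpace_add hf hg, (Lp.coeFn_add φ ψ).trans (hf2.add hg2)⟩
  smul_mem' := by
    rintro c φ ⟨f, hf, hf2⟩
    exact ⟨c • f, temporalSpace_smul c hf, (Lp.coeFn_smul c φ).trans (hf2.const_smul c)⟩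

lemma mem_splineSub {d r N : ℕ} {φ : L2I ℝ} :
    φ ∈ splineSub d r N ↔ ∃ f ∈ temporalSpace d r N, ⇑φ =ᵐ[timeMeasure] f := Iff.rfl

/-! #### The inverse inequality -/

/-- Polynomials as elements of `L²(I)`. -/
def polyL : Polynomial ℝ →ₗ[ℝ] L2I ℝ where
  toFun p := (memLp_of_continuous p.continuous).toLp
  map_add' p q := by
    apply Lp.ext
    filter_upwards [MemLp.coeFn_toLp (memLp_of_continuous (p + q).continuous),
      MemLp.coeFn_toLp (memLp_of_continuous p.continuous),
      MemLp.coeFn_toLp (memLp_of_continuous q.continuous), Lp.coeFn_add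
      (memLp_of_continuous p.continuous).toLp (memLp_of_continuous q.continuous).toLp]
      with t h1 h2 h3 h4
    rw [h1, h4, Pi.add_apply, h2, h3, Polynomial.eval_add]
  map_smul' c p := by
    apply Lp.ext
    filter_upwards [MemLp.coeFn_toLp (memLp_of_continuous (c • p).continuous),
      MemLp.coeFn_toLp (memLp_of_continuous p.continuous), Lp.coeFn_smul c
      (memLp_of_continuous p.continuous).toLp] with t h1 h2 h3
    rw [h1, RingHom.id_apply, h3, Pi.smul_apply, h2, Polynomial.eval_smul]

lemma coeFn_polyL (p : Polynomial ℝ) : ⇑(polyL p) =ᵐ[timeMeasure] fun t => p.eval t :=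
  MemLp.coeFn_toLp (memLp_of_continuous p.continuous)

lemma norm_sq_L2I_of_ae {φ : L2I ℝ} {f : ℝ → ℝ} (hf : ⇑φ =ᵐ[timeMeasure] f) :
    ‖φ‖ ^ 2 = ∫ t in (0 : ℝ)..1, f t ^ 2 := by
  rw [← real_inner_self_eq_norm_sq, inner_L2I_of_ae hf hf]
  simp_rw [sq]

lemma polyL_injective : Function.Injective polyL := by
  rw [injective_iff_map_eq_zero]
  intro p hp
  have h1 : (fun t => p.eval t) =ᵐ[volume.restrict (Ioo (0 : ℝ) 1)] fun _ => (0 : ℝ) := by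
    have h2 := coeFn_polyL p
    rw [hp] at h2
    exact h2.symm.trans (Lp.coeFn_zero ℝ 2 timeMeasure)
  have h2 := Measure.eqOn_open_of_ae_eq h1 isOpen_Ioo p.continuous.continuousOn continuousOn_const
  refine Polynomial.eq_zero_of_infinite_isRoot p ?_
  exact (Ioo_infinite (zero_lt_one (α := ℝ))).mono fun t ht => h2 ht

/-- Polynomials of bounded degree form a finite-dimensional space embedded in L²(I), so
differentiation on it is automatically continuous. -/
lemma exists_norm_polyL_derivative_le (d : ℕ) :
    ∃ C : ℝ, 0 < C ∧ ∀ p : Polynomial ℝ, p.degree < d →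
      ‖polyL (Polynomial.derivative p)‖ ≤ C * ‖polyL p‖ := by
  let ι : Polynomial.degreeLT ℝ d →ₗ[ℝ] L2I ℝ := polyL.comp (Polynomial.degreeLT ℝ d).subtype
  have hι : Function.Injective ι := polyL_injective.comp Subtype.val_injective
  let e := LinearEquiv.ofInjective ι hι
  let D : Polynomial.degreeLT ℝ d →ₗ[ℝ] L2I ℝ :=
    (polyL.comp Polynomial.derivative).comp (Polynomial.degreeLT ℝ d).subtype
  have : FiniteDimensional ℝ (Polynomial.degreeLT ℝ d) :=
    Module.Finite.equiv (Polynomial.degreeLTEquiv ℝ d).symm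
  have : FiniteDimensional ℝ (LinearMap.range ι) := Module.Finite.equiv e
  let T := LinearMap.toContinuousLinearMap (D.comp e.symm.toLinearMap)
  refine ⟨‖T‖ + 1, by positivity, fun p hp => ?_⟩
  have h := T.le_opNorm (e ⟨p, Polynomial.mem_degreeLT.2 hp⟩)
  have h1 : T (e ⟨p, Polynomial.mem_degreeLT.2 hp⟩) = polyL (Polynomial.derivative p) := by
    change D (e.symm (e _)) = _
    rw [LinearEquiv.symm_apply_apply]
    rfl
  have h2 : ‖e ⟨p, Polynomial.mem_degreeLT.2 hp⟩‖ = ‖polyL p‖ := rfl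
  rw [h1, h2] at h
  refine h.trans ?_
  gcongr
  linarith

/-- The scaled inverse inequality for polynomials. -/
lemma exists_integral_derivative_sq_le (d : ℕ) :
    ∃ C : ℝ, 0 < C ∧ ∀ p : Polynomial ℝ, p.degree < d → ∀ a b : ℝ, a < b →
      ∫ t in a..b, (Polynomial.derivative p).eval t ^ 2 ≤
        (C / (b - a)) ^ 2 * ∫ t in a..b, p.eval t ^ 2 := by
  obtain ⟨C, hC, h⟩ := exists_norm_polyL_derivative_le d
  refine ⟨C, hC, fun p hp a b hab => ?_⟩
  have hh : 0 < b - a := sub_pos.2 hab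
  -- Pull back to the unit interval; the chain rule produces the factor b - a that ends up in the
  -- denominator of the constant.
  set q := p.comp (Polynomial.C (b - a) * Polynomial.X + Polynomial.C a) with hq
  have hqd : q.degree < d := by
    rcases eq_or_ne p 0 with rfl | hp0
    · rw [hq, Polynomial.zero_comp]; exact hp
    refine (Polynomial.degree_le_natDegree).trans_lt ?_
    rw [Polynomial.degree_eq_natDegree hp0] at hp
    refine lt_of_le_of_lt ?_ hp
    have := Polynomial.natDegree_comp_le (p := p)
      (q := Polynomial.C (b - a) * Polynomial.X + Polynomial.C a)
    rw [Polynomial.natDegree_linear hh.ne', mul_one] at this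
    exact_mod_cast this
  have h1 := pow_le_pow_left₀ (norm_nonneg _) (h q hqd) 2
  rw [mul_pow, norm_sq_L2I_of_ae (coeFn_polyL _), norm_sq_L2I_of_ae (coeFn_polyL _)] at h1
  have e1 : ∀ t, q.eval t = p.eval ((b - a) * t + a) := fun t => by simp [hq]
  have e2 : ∀ t, (Polynomial.derivative q).eval t =
      (b - a) * (Polynomial.derivative p).eval ((b - a) * t + a) := fun t => by
    simp [hq, Polynomial.derivative_comp]
  simp_rw [e1, e2, mul_pow] at h1
  rw [intervalIntegral.integral_const_mul,
    intervalIntegral.integral_comp_mul_add (fun x => p.eval x ^ 2) hh.ne',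
    intervalIntegral.integral_comp_mul_add
      (fun x => (Polynomial.derivative p).eval x ^ 2) hh.ne'] at h1
  simp only [mul_zero, zero_add, mul_one, sub_add_cancel, smul_eq_mul] at h1
  rw [div_pow, div_mul_eq_mul_div, le_div_iff₀ (by positivity)]
  have h2 := mul_le_mul_of_nonneg_left h1 hh.le
  have e3 : ∀ x y : ℝ, (b - a) * (x * ((b - a)⁻¹ * y)) = x * y := fun x y => by
    field_simp
  rw [e3, e3] at h2
  linarith

lemma natFloor_mem {N : ℕ} (hN : 1 ≤ N) {t : ℝ} (ht : t ∈ Ico (0 : ℝ) 1) :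
    ⌊N * t⌋₊ < N ∧ (⌊N * t⌋₊ : ℝ) / N ≤ t ∧ t < ((⌊N * t⌋₊ : ℝ) + 1) / N := by
  have hN' : (0 : ℝ) < N := by exact_mod_cast hN
  have h0 : 0 ≤ N * t := mul_nonneg hN'.le ht.1
  refine ⟨?_, ?_, ?_⟩
  · rw [Nat.floor_lt h0]; nlinarith [ht.2]
  · rw [div_le_iff₀ hN']; linarith [Nat.floor_le h0]
  · rw [lt_div_iff₀ hN']; linarith [Nat.lt_floor_add_one (N * t)]

lemma natFloor_eq_of_mem {N l : ℕ} (hN : 1 ≤ N) {t : ℝ} (h1 : (l : ℝ) / N ≤ t)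
    (h2 : t < ((l : ℝ) + 1) / N) : ⌊N * t⌋₊ = l := by
  have hN' : (0 : ℝ) < N := by exact_mod_cast hN
  rw [div_le_iff₀ hN'] at h1
  rw [lt_div_iff₀ hN'] at h2
  rw [Nat.floor_eq_iff (le_trans (by positivity) (h1.trans_eq (mul_comm _ _)))]
  exact ⟨by linarith, by linarith⟩

/-- Splines are primitives of piecewise polynomials, with an inverse inequality. -/
lemma exists_isPrim_of_mem_splineSub (d : ℕ) :
    ∃ C : ℝ, 0 < C ∧ ∀ (r N : ℕ), 1 ≤ N → ∀ φ ∈ splineSub d r N,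
      ∃ ψ : L2I ℝ, IsPrim φ ψ ∧ ‖ψ‖ ≤ C * N * ‖φ‖ := by
  obtain ⟨C, hC, hpoly⟩ := exists_integral_derivative_sq_le d
  refine ⟨C, hC, fun r N hN φ hφ => ?_⟩
  obtain ⟨f, hf, hφf⟩ := hφ
  have hN' : (0 : ℝ) < N := by exact_mod_cast hN
  choose! q hq hqf using hf.2.2
  -- At a breakpoint the floor selects the element to its right, so this is the right derivative of
  -- the spline at every point, which suffices for a continuous function to be its primitive.
  set g : ℝ → ℝ := fun t => (Polynomial.derivative (q ⌊N * t⌋₊)).eval t with hg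
  have hgm : Measurable g := by
    have h1 : Measurable (Function.uncurry fun (l : ℕ) (t : ℝ) =>
        (Polynomial.derivative (q l)).eval t) :=
      measurable_from_prod_countable_right fun l => (Polynomial.derivative (q l)).continuous.measurable
    exact h1.comp ((Nat.measurable_floor.comp (measurable_const.mul measurable_id)).prodMk
      measurable_id)
  have hbd : ∃ M : ℝ, ∀ t ∈ Ioo (0 : ℝ) 1, ‖g t‖ ≤ M := by
    have hb : ∀ l, ∃ M, ∀ t ∈ Icc (0 : ℝ) 1, ‖(Polynomial.derivative (q l)).eval t‖ ≤ M := fun l =>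
      isCompact_Icc.exists_bound_of_continuousOn (Polynomial.derivative (q l)).continuous.continuousOn
    choose M hM using hb
    refine ⟨∑ l ∈ Finset.range N, |M l|, fun t ht => ?_⟩
    have hl := (natFloor_mem hN (Ioo_subset_Ico_self ht)).1
    refine ((hM _ t (Ioo_subset_Icc_self ht)).trans (le_abs_self _)).trans ?_
    exact Finset.single_le_sum (f := fun l => |M l|) (fun l _ => abs_nonneg _)
      (Finset.mem_range.2 hl)
  obtain ⟨M, hM⟩ := hbd
  have hgL : MemLp g 2 timeMeasure := memLp_of_bound_on hgm.aestronglyMeasurable M hM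
  refine ⟨hgL.toLp, isPrim_of_hasDerivWithinAt hf.1.continuousOn hf.2.1 ?_ hφf hgL.coeFn_toLp, ?_⟩
  · intro t ht
    obtain ⟨h1, h2, h3⟩ := natFloor_mem hN (Ioo_subset_Ico_self ht)
    refine HasDerivWithinAt.congr_of_eventuallyEq
      ((q ⌊N * t⌋₊).hasDerivAt t).hasDerivWithinAt ?_ (hqf _ h1 t ⟨h2, h3.le⟩)
    filter_upwards [Ioo_mem_nhdsGT h3] with y hy
    exact hqf _ h1 y ⟨h2.trans hy.1.le, hy.2.le⟩
  · refine (pow_le_pow_iff_left₀ (norm_nonneg _) (by positivity) two_ne_zero).1 ?_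
    rw [mul_pow, norm_sq_L2I_of_ae hgL.coeFn_toLp, norm_sq_L2I_of_ae hφf]
    set a : ℕ → ℝ := fun l => (l : ℝ) / N with ha
    have ha0 : a 0 = 0 := by simp [ha]
    have haN : a N = 1 := by simp [ha, hN'.ne']
    have hamono : ∀ l, a l < a (l + 1) := fun l => by
      simp only [ha]; gcongr; simp
    have hfc : ContinuousOn (fun t => f t ^ 2) (Icc 0 1) := hf.1.continuousOn.pow 2
    have hsub : ∀ l < N, Icc (a l) (a (l + 1)) ⊆ Icc 0 1 := fun l hl => by
      refine Icc_subset_Icc (by simp only [ha]; positivity) ?_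
      simp only [ha]
      rw [div_le_one hN']
      exact_mod_cast hl
    have hi1 : ∀ l < N, IntervalIntegrable (fun t => f t ^ 2) volume (a l) (a (l + 1)) := by
      intro l hl
      exact (hfc.mono (hsub l hl)).intervalIntegrable_of_Icc (hamono l).le
    have hgi : IntervalIntegrable (fun t => g t ^ 2) volume 0 1 := by
      rw [intervalIntegrable_iff_integrableOn_Ioo_of_le zero_le_one]
      exact hgL.integrable_sq
    have hi2 : ∀ l < N, IntervalIntegrable (fun t => g t ^ 2) volume (a l) (a (l + 1)) := by
      intro l hl
      refine hgi.mono_set ?_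
      rw [uIcc_of_le (hamono l).le, uIcc_of_le zero_le_one]
      exact hsub l hl
    rw [← ha0, ← haN, ← intervalIntegral.sum_integral_adjacent_intervals hi1,
      ← intervalIntegral.sum_integral_adjacent_intervals hi2, Finset.mul_sum]
    refine Finset.sum_le_sum fun l hl => ?_
    have hl := Finset.mem_range.1 hl
    have hsucc : a (l + 1) = ((l : ℝ) + 1) / N := by simp [ha]
    have e1 : ∫ t in a l..a (l + 1), f t ^ 2 = ∫ t in a l..a (l + 1), (q l).eval t ^ 2 := by
      refine intervalIntegral.integral_congr fun t ht => ?_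
      rw [uIcc_of_le (hamono l).le, hsucc] at ht
      rw [hqf l hl t ht]
    have e2 : ∫ t in a l..a (l + 1), g t ^ 2 =
        ∫ t in a l..a (l + 1), (Polynomial.derivative (q l)).eval t ^ 2 := by
      rw [intervalIntegral.integral_of_le (hamono l).le, intervalIntegral.integral_of_le
        (hamono l).le, integral_Ioc_eq_integral_Ioo, integral_Ioc_eq_integral_Ioo]
      refine setIntegral_congr_fun measurableSet_Ioo fun t ht => ?_
      rw [hsucc] at ht
      simp only [hg]
      rw [natFloor_eq_of_mem hN ht.1.le ht.2]
    rw [e1, e2]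
    have h := hpoly (q l) (hq l hl) _ _ (hamono l)
    have e3 : C / (a (l + 1) - a l) = C * N := by
      rw [hsucc]; simp only [ha]; field_simp; ring
    rwa [e3] at h

end Splines

/-! ### Vector-valued splines. -/

section SplineTensor

variable {H : Type*} [NormedAddCommGroup H] [InnerProductSpace ℝ H]

variable (H) in
/-- The algebraic tensor product `S ⊗ H` inside `L²(I; H)`. -/
def tensSub (S : Submodule ℝ (L2I ℝ)) : Submodule ℝ (L2I H) :=
  Submodule.span ℝ {v | ∃ φ ∈ S, ∃ a : H, v = tens φ a}

lemma tens_mem_tensSub {S : Submodule ℝ (L2I ℝ)} {φ : L2I ℝ} (hφ : φ ∈ S) (a : H) :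
    tens φ a ∈ tensSub H S := Submodule.subset_span ⟨φ, hφ, a, rfl⟩

lemma tensSub_mono {S T : Submodule ℝ (L2I ℝ)} (h : S ≤ T) : tensSub H S ≤ tensSub H T :=
  Submodule.span_mono fun _ ⟨φ, hφ, a, ha⟩ => ⟨φ, h hφ, a, ha⟩

variable [CompleteSpace H]

lemma norm_sq_sum_tens' {ι : Type*} {ε : ι → H} (hε : Orthonormal ℝ ε) (s : Finset ι)
    (ψ : ι → L2I ℝ) : ‖∑ j ∈ s, tens (ψ j) (ε j)‖ ^ 2 = ∑ j ∈ s, ‖ψ j‖ ^ 2 := by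
  classical
  rw [← real_inner_self_eq_norm_sq, sum_inner]
  refine Finset.sum_congr rfl fun i hi => ?_
  rw [inner_sum, Finset.sum_eq_single i]
  · rw [inner_tens_tens, real_inner_self_eq_norm_sq, real_inner_self_eq_norm_sq, hε.1 i]; ring
  · intro j _ hj
    rw [inner_tens_tens, hε.2 (Ne.symm hj), mul_zero]
  · intro h; exact absurd hi h

/-- Elements of `S ⊗ H` have an expansion with orthonormal vectors. -/
lemma exists_orthonormal_expansion {S : Submodule ℝ (L2I ℝ)} {v : L2I H} (hv : v ∈ tensSub H S) :
    ∃ (m : ℕ) (ε : Fin m → H) (ψ : Fin m → L2I ℝ), Orthonormal ℝ ε ∧ (∀ j, ψ j ∈ S) ∧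
      v = ∑ j, tens (ψ j) (ε j) := by
  obtain ⟨n, c, g, hg⟩ := (Submodule.mem_span_set').1 hv
  choose φ hφ a ha using fun i => (g i).2
  -- Orthonormalize the finitely many spatial vectors; their coordinates are moved into the temporal
  -- factors, which stay in the subspace `S`.
  let W := Submodule.span ℝ (Set.range a)
  have : FiniteDimensional ℝ W := FiniteDimensional.span_of_finite ℝ (Set.finite_range a)
  let b := stdOrthonormalBasis ℝ W
  have haW : ∀ i, a i ∈ W := fun i => Submodule.subset_span ⟨i, rfl⟩
  refine ⟨_, fun j => (b j : H), fun j => ∑ i, (c i * inner ℝ (b j : H) (a i)) • φ i,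
    b.orthonormal.comp_linearIsometry W.subtypeₗᵢ, fun j => ?_, ?_⟩
  · exact Submodule.sum_mem _ fun i _ => Submodule.smul_mem _ _ (hφ i)
  · have hexp : ∀ i, a i = ∑ j, inner ℝ (b j : H) (a i) • (b j : H) := fun i => by
      have h := b.sum_repr' ⟨a i, haW i⟩
      have h2 := congrArg Subtype.val h
      simp only [Submodule.coe_sum, Submodule.coe_smul, Submodule.coe_inner] at h2
      exact h2.symm
    rw [← hg]
    simp_rw [sum_tens]
    rw [Finset.sum_comm]
    refine Finset.sum_congr rfl fun i _ => ?_
    rw [ha i]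
    conv_lhs => rw [hexp i]
    rw [tens_sum, Finset.smul_sum]
    refine Finset.sum_congr rfl fun j _ => ?_
    rw [tens_smul, smul_tens, smul_smul]

/-- The inverse inequality for vector-valued splines. -/
lemma exists_isPrim_of_mem_tensSub (d : ℕ) :
    ∃ C : ℝ, 0 < C ∧ ∀ (r N : ℕ), 1 ≤ N → ∀ v ∈ tensSub H (splineSub d r N),
      ∃ q : L2I H, IsPrim v q ∧ ‖q‖ ≤ C * N * ‖v‖ := by
  obtain ⟨C, hC, h⟩ := exists_isPrim_of_mem_splineSub d
  refine ⟨C, hC, fun r N hN v hv => ?_⟩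
  obtain ⟨m, ε, ψ, hε, hψ, rfl⟩ := exists_orthonormal_expansion hv
  choose χ hχ hχn using fun j => h r N hN (ψ j) (hψ j)
  refine ⟨∑ j, tens (χ j) (ε j), IsPrim.sum _ fun j _ => (hχ j).tens _, ?_⟩
  -- Over orthonormal spatial vectors the squares add up, so the scalar inverse inequality passes to
  -- vector values with the same constant.
  refine (pow_le_pow_iff_left₀ (norm_nonneg _) (by positivity) two_ne_zero).1 ?_
  rw [mul_pow, norm_sq_sum_tens' hε, norm_sq_sum_tens' hε, Finset.mul_sum]
  refine Finset.sum_le_sum fun j _ => ?_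
  rw [← mul_pow]
  exact pow_le_pow_left₀ (norm_nonneg _) (hχn j) 2

end SplineTensor

/-! ### Truncated powers as splines, and their reproduction properties. -/

section TruncSpline

lemma truncPow_succ_eq_max (k : ℕ) (τ : ℝ) :
    truncPow (k + 1) τ = (max τ 0) ^ (k + 1) / (k + 1).factorial := by
  rcases le_or_gt τ 0 with h | h
  · rw [truncPow_of_nonpos _ h, max_eq_right h]; simp
  · rw [truncPow_of_pos _ h, max_eq_left h.le]

lemma continuous_truncPow_succ (k : ℕ) : Continuous (truncPow (k + 1)) := by
  have : truncPow (k + 1) = fun τ => (max τ 0) ^ (k + 1) / ((k + 1).factorial : ℝ) :=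
    funext (truncPow_succ_eq_max k)
  rw [this]; fun_prop

/-- At the knot both one-sided derivatives vanish, since the power is at least two; elsewhere the
function is locally a monomial or zero. -/
lemma hasDerivAt_truncPow (k : ℕ) (τ : ℝ) :
    HasDerivAt (truncPow (k + 2)) (truncPow (k + 1) τ) τ := by
  have hpow : HasDerivAt (fun t : ℝ => t ^ (k + 2) / ((k + 2).factorial : ℝ))
      (τ ^ (k + 1) / ((k + 1).factorial : ℝ)) τ := by
    refine ((hasDerivAt_pow (k + 2) τ).div_const ((k + 2).factorial : ℝ)).congr_deriv ?_
    rw [Nat.factorial_succ (k + 1), show k + 2 - 1 = k + 1 from rfl]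
    push_cast
    have : ((k + 1).factorial : ℝ) ≠ 0 := by positivity
    field_simp
    ring
  rcases lt_trichotomy τ 0 with h | rfl | h
  · rw [truncPow_of_nonpos _ h.le]
    refine (hasDerivAt_const τ (0 : ℝ)).congr_of_eventuallyEq ?_
    filter_upwards [Iio_mem_nhds h] with y hy
    exact truncPow_of_nonpos _ (le_of_lt hy)
  · rw [truncPow_of_nonpos _ le_rfl]
    have h1 : HasDerivWithinAt (truncPow (k + 2)) 0 (Iic 0) 0 := by
      refine (hasDerivWithinAt_const (0 : ℝ) (Iic 0) (0 : ℝ)).congr (fun y hy => ?_) ?_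
      · exact truncPow_of_nonpos _ hy
      · exact truncPow_of_nonpos _ le_rfl
    have h2 : HasDerivWithinAt (truncPow (k + 2)) 0 (Ici 0) 0 := by
      have := hpow.hasDerivWithinAt (s := Ici 0)
      rw [zero_pow (Nat.succ_ne_zero k), zero_div] at this
      refine this.congr (fun y hy => ?_) ?_
      · exact truncPow_succ_of_nonneg _ hy
      · exact truncPow_succ_of_nonneg _ le_rfl
    have := h1.union h2
    rwa [Iic_union_Ici, hasDerivWithinAt_univ] at this
  · rw [truncPow_of_pos _ h]
    refine hpow.congr_of_eventuallyEq ?_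
    filter_upwards [Ioi_mem_nhds h] with y hy
    exact truncPow_of_pos _ hy

lemma contDiff_truncPow (r : ℕ) : ContDiff ℝ r (truncPow (r + 1)) := by
  induction r with
  | zero => exact contDiff_zero.2 (continuous_truncPow_succ 0)
  | succ r ih =>
    have hd : deriv (truncPow (r + 2)) = truncPow (r + 1) :=
      funext fun τ => (hasDerivAt_truncPow r τ).deriv
    push_cast
    rw [contDiff_succ_iff_deriv, hd]
    exact ⟨fun τ => (hasDerivAt_truncPow r τ).differentiableAt, by simp, ih⟩

lemma memLp_truncPow_sub (k : ℕ) {a : ℝ} (ha : 0 ≤ a) :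
    MemLp (fun t => truncPow k (t - a)) 2 timeMeasure :=
  memLp_of_bound_on ((measurable_truncPow k).comp
    (measurable_id.sub measurable_const)).aestronglyMeasurable 1
    fun t ht => abs_truncPow_le_one k (by linarith [ht.2])

/-- The truncated power `(t - l/N)₊^k / k!` as an element of `L²(I)`. -/
def truncL (k N l : ℕ) : L2I ℝ :=
  (memLp_truncPow_sub k (a := (l : ℝ) / N) (by positivity)).toLp

lemma coeFn_truncL (k N l : ℕ) :
    ⇑(truncL k N l) =ᵐ[timeMeasure] fun t => truncPow k (t - (l : ℝ) / N) :=
  MemLp.coeFn_toLp (memLp_truncPow_sub k (a := (l : ℝ) / N) (by positivity))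

lemma isPrim_truncL (k N l : ℕ) : IsPrim (truncL (k + 1) N l) (truncL k N l) := by
  unfold IsPrim
  filter_upwards [coeFn_truncL (k + 1) N l, ae_mem_Ioo] with t h1 ht
  rw [h1, ← integral_truncPow_mul ht (by positivity)]
  refine integral_congr_ae ?_
  filter_upwards [coeFn_truncL k N l] with s hs
  rw [hs, smul_eq_mul]

/-- The power d - 1 has d - 2 ≥ r continuous derivatives across its knot, and the knot is a mesh
point, so each element sees either zero or the full polynomial. Knots l ≥ N are harmless, because
the function then vanishes on [0,1]. -/
lemma truncL_mem_splineSub {d r N l : ℕ} (hN : 1 ≤ N) (hr : r + 2 ≤ d) :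
    truncL (d - 1) N l ∈ splineSub d r N := by
  obtain ⟨D, rfl⟩ : ∃ D, d = D + 2 := ⟨d - 2, by omega⟩
  have hN' : (0 : ℝ) < N := by exact_mod_cast hN
  refine ⟨fun t => truncPow (D + 1) (t - (l : ℝ) / N), ⟨?_, ?_, fun i hi => ?_⟩,
    coeFn_truncL _ N l⟩
  · have h1 : ContDiff ℝ D fun t : ℝ => truncPow (D + 1) (t - (l : ℝ) / N) :=
      (contDiff_truncPow D).comp (contDiff_id.sub contDiff_const)
    refine (h1.of_le ?_).contDiffOn
    exact_mod_cast (by omega : r ≤ D)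
  · exact truncPow_of_nonpos _ (by rw [zero_sub, neg_nonpos]; positivity)
  · rcases le_or_gt (i + 1) l with h | h
    · refine ⟨0, by rw [Polynomial.degree_zero]; exact WithBot.bot_lt_coe _, fun t ht => ?_⟩
      simp only [Polynomial.eval_zero]
      refine truncPow_of_nonpos _ (sub_nonpos.2 (ht.2.trans ?_))
      gcongr
      exact_mod_cast h
    · refine ⟨Polynomial.C ((D + 1).factorial : ℝ)⁻¹ *
        (Polynomial.X - Polynomial.C ((l : ℝ) / N)) ^ (D + 1), ?_, fun t ht => ?_⟩
      · have h1 : ((D + 1).factorial : ℝ)⁻¹ ≠ 0 := by positivity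
        rw [Polynomial.degree_C_mul h1, Polynomial.degree_pow, Polynomial.degree_X_sub_C]
        simp only [nsmul_eq_mul, mul_one]
        exact_mod_cast (by omega : D + 1 < D + 2)
      · simp only [Polynomial.eval_mul, Polynomial.eval_C, Polynomial.eval_pow,
          Polynomial.eval_sub, Polynomial.eval_X]
        rw [truncPow_succ_of_nonneg, div_eq_inv_mul]
        refine sub_nonneg.2 (le_trans ?_ ht.1)
        gcongr
        omega

lemma monoL_mem_splineSub {d r N k : ℕ} (hk : k < d) (hk1 : 1 ≤ k) :
    monoL k ∈ splineSub d r N := by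
  refine ⟨fun t => t ^ k / k.factorial, ⟨?_, ?_, fun i hi => ?_⟩, coeFn_monoL k⟩
  · exact (contDiff_id.pow k).div_const _ |>.contDiffOn
  · simp [zero_pow (by omega : k ≠ 0)]
  · refine ⟨Polynomial.C (k.factorial : ℝ)⁻¹ * Polynomial.X ^ k, ?_, fun t ht => ?_⟩
    · exact (Polynomial.degree_C_mul_X_pow_le _ _).trans_lt (by exact_mod_cast hk)
    · simp [div_eq_inv_mul]

/-- A finite-dimensional space of splines of maximal smoothness. -/
def approxSub (d N : ℕ) : Submodule ℝ (L2I ℝ) :=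
  Submodule.span ℝ ((monoL '' {k | 1 ≤ k ∧ k < d}) ∪ (truncL (d - 1) N '' Iic (N + d)))

instance finiteDimensional_approxSub (d N : ℕ) : FiniteDimensional ℝ (approxSub d N) := by
  refine FiniteDimensional.span_of_finite ℝ (Finite.union (Finite.image _ ?_)
    ((finite_Iic _).image _))
  exact (finite_Iio d).subset fun k hk => hk.2

lemma approxSub_le {d r N : ℕ} (hN : 1 ≤ N) (hr : r + 2 ≤ d) :
    approxSub d N ≤ splineSub d r N := by
  refine Submodule.span_le.2 (union_subset ?_ ?_)
  · rintro _ ⟨k, hk, rfl⟩; exact monoL_mem_splineSub hk.2 hk.1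
  · rintro _ ⟨l, _, rfl⟩; exact truncL_mem_splineSub hN hr

lemma monoL_mem_approxSub {d N k : ℕ} (hk : k < d) (hk1 : 1 ≤ k) : monoL k ∈ approxSub d N :=
  Submodule.subset_span (Or.inl ⟨k, ⟨hk1, hk⟩, rfl⟩)

lemma truncL_mem_approxSub {d N l : ℕ} (hl : l ≤ N + d) : truncL (d - 1) N l ∈ approxSub d N :=
  Submodule.subset_span (Or.inr ⟨l, hl, rfl⟩)

/-! #### Reproduction of truncated powers -/

open Polynomial in
/-- Weights which express `(τ - x)^M / M!` through the shifted powers `(τ - j)^D / D!`. -/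
lemma exists_reproducing_weights (D M : ℕ) (hM : M ≤ D) :
    ∃ a : ℕ → Polynomial ℝ, ∀ x τ : ℝ,
      ∑ j ∈ Finset.range (D + 1), (a j).eval x * ((τ - j) ^ D / D.factorial) =
        (τ - x) ^ M / M.factorial := by
  let ℓ : ℕ → ℝ[X] := fun j => Lagrange.basis (Finset.range (D + 1)) (fun i : ℕ => (i : ℝ)) j
  refine ⟨fun j => C ((-1 : ℝ) ^ (D - M)) * derivative^[D - M] (ℓ j), fun x τ => ?_⟩
  have hinj : Set.InjOn (fun i : ℕ => (i : ℝ)) (Finset.range (D + 1) : Set ℕ) :=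
    fun i _ j _ h => Nat.cast_injective (R := ℝ) h
  have hdeg : ((X - C τ) ^ D : ℝ[X]).degree < (Finset.range (D + 1)).card := by
    rw [degree_pow, degree_X_sub_C, Finset.card_range]
    simp only [nsmul_eq_mul, mul_one]
    exact_mod_cast Nat.lt_succ_self D
  -- Lagrange interpolation at 0, …, D reproduces x ↦ (x - τ)^D; differentiating D - M times in x
  -- lowers the exponent to M on the left and hits only the basis polynomials on the right. The rest
  -- of the proof tracks signs and factorials.
  have h1 := Lagrange.eq_interpolate hinj hdeg
  rw [Lagrange.interpolate_apply] at h1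
  have h2 := congrArg (fun p => eval x (derivative^[D - M] p)) h1
  simp only [iterate_derivative_X_sub_pow, iterate_derivative_sum, iterate_derivative_C_mul,
    eval_finsetSum, eval_mul, eval_C, eval_pow, eval_sub, eval_X, eval_smul] at h2
  rw [show D - (D - M) = M by omega] at h2
  have h3 : ((D.descFactorial (D - M) : ℕ) : ℝ) * M.factorial = D.factorial := by
    have := Nat.factorial_mul_descFactorial (Nat.sub_le D M)
    rw [show D - (D - M) = M by omega] at this
    rw [mul_comm]; exact_mod_cast this
  have hs : ((-1 : ℝ) ^ (D - M)) * (-1) ^ D * (-1) ^ M = 1 := by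
    rw [← pow_add, ← pow_add, show D - M + D + M = 2 * D by omega, pow_mul]; simp
  have hM0 : (M.factorial : ℝ) ≠ 0 := by positivity
  have hD0 : (D.factorial : ℝ) ≠ 0 := by positivity
  have e1 : ∀ j : ℕ, (τ - j) ^ D = (-1) ^ D * ((j : ℝ) - τ) ^ D := fun j => by
    rw [← mul_pow]; ring
  have e2 : (τ - x) ^ M = (-1) ^ M * (x - τ) ^ M := by rw [← mul_pow]; ring
  have hs2 : ((-1 : ℝ) ^ M) * (-1) ^ M = 1 := by rw [← mul_pow]; simp
  have e4 : ((-1 : ℝ) ^ (D - M)) * (-1) ^ D = (-1) ^ M := by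
    linear_combination (-1) ^ M * hs - (-1) ^ (D - M) * (-1) ^ D * hs2
  calc ∑ j ∈ Finset.range (D + 1), (C ((-1 : ℝ) ^ (D - M)) * derivative^[D - M] (ℓ j)).eval x *
        ((τ - j) ^ D / D.factorial)
      = ((-1) ^ (D - M) * (-1) ^ D / D.factorial) *
        ∑ j ∈ Finset.range (D + 1), ((j : ℝ) - τ) ^ D * eval x (derivative^[D - M] (ℓ j)) := by
        rw [Finset.mul_sum]
        refine Finset.sum_congr rfl fun j _ => ?_
        rw [e1, eval_mul, eval_C]; ring
    _ = (-1) ^ M / D.factorial * ((D.descFactorial (D - M) : ℝ) * (x - τ) ^ M) := by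
        rw [e4, ← h2]; simp
    _ = _ := by
        rw [e2, ← h3]
        have h5 : (D.descFactorial (D - M) : ℝ) ≠ 0 := fun h => hD0 (by rw [← h3, h, zero_mul])
        field_simp

/-- The derivative (in `τ`) of the reproduction identity. -/
lemma reproducing_weights_deriv {D M : ℕ} {a : ℕ → Polynomial ℝ}
    (ha : ∀ x τ : ℝ, ∑ j ∈ Finset.range (D + 2), (a j).eval x *
      ((τ - j) ^ (D + 1) / (D + 1).factorial) = (τ - x) ^ M / M.factorial) (x τ : ℝ) :
    ∑ j ∈ Finset.range (D + 2), (a j).eval x * ((τ - j) ^ D / D.factorial) =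
      M * (τ - x) ^ (M - 1) / M.factorial := by
  have h1 : HasDerivAt (fun τ => ∑ j ∈ Finset.range (D + 2), (a j).eval x *
      ((τ - j) ^ (D + 1) / (D + 1).factorial))
      (∑ j ∈ Finset.range (D + 2), (a j).eval x * ((τ - j) ^ D / D.factorial)) τ := by
    refine HasDerivAt.fun_sum fun j _ => ?_
    refine HasDerivAt.const_mul _ ?_
    refine ((((hasDerivAt_id τ).sub_const (j : ℝ)).pow (D + 1)).div_const _).congr_deriv ?_
    rw [Nat.factorial_succ]
    push_cast
    have : (D.factorial : ℝ) ≠ 0 := by positivity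
    simp only [id]
    field_simp
  have h2 : HasDerivAt (fun τ => (τ - x) ^ M / M.factorial)
      (M * (τ - x) ^ (M - 1) / M.factorial) τ := by
    refine ((((hasDerivAt_id τ).sub_const x).pow M).div_const _).congr_deriv ?_
    simp
  have h3 : (fun τ => ∑ j ∈ Finset.range (D + 2), (a j).eval x *
      ((τ - j) ^ (D + 1) / (D + 1).factorial)) = fun τ => (τ - x) ^ M / M.factorial :=
    funext (ha x)
  rw [h3] at h1
  exact h1.unique h2

end TruncSpline

/-! ### A Schur test for banded kernels. -/

section Schur

variable {H : Type*} [NormedAddCommGroup H] [InnerProductSpace ℝ H] [CompleteSpace H]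

/-- The kernel of a band of half-width `δ`. -/
def band (δ : ℝ) (t s : ℝ) : ℝ := if |t - s| ≤ δ then 1 else 0

lemma measurable_band (δ : ℝ) : Measurable (Function.uncurry (band δ)) := by
  refine Measurable.ite ?_ measurable_const measurable_const
  exact measurableSet_le (measurable_fst.sub measurable_snd).abs measurable_const

lemma band_nonneg (δ t s : ℝ) : 0 ≤ band δ t s := by unfold band; split_ifs <;> norm_num

lemma abs_band_le (δ t s : ℝ) : |band δ t s| ≤ 1 := by unfold band; split_ifs <;> norm_num

lemma integrable_band_smul (δ t : ℝ) {q : ℝ → ℝ} (hq : Integrable q timeMeasure) :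
    Integrable (fun s => band δ t s * q s) timeMeasure := by
  have hm : Measurable (band δ t) := (measurable_band δ).comp measurable_prodMk_left
  simpa using integrable_bdd_smul hm 1 (fun s _ => abs_band_le δ t s) hq

lemma integral_band_le {δ : ℝ} (hδ : 0 ≤ δ) (t : ℝ) : ∫ s, band δ t s ∂timeMeasure ≤ 2 * δ := by
  have h : band δ t = (Icc (t - δ) (t + δ)).indicator 1 := by
    ext s
    unfold band
    by_cases hs : |t - s| ≤ δ
    · rw [if_pos hs, indicator_of_mem]
      · rfl
      · rw [abs_le] at hs; exact ⟨by linarith, by linarith⟩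
    · rw [if_neg hs, indicator_of_notMem]
      intro h'; exact hs (abs_le.2 ⟨by linarith [h'.2], by linarith [h'.1]⟩)
  rw [h, integral_indicator_one measurableSet_Icc]
  have h1 : timeMeasure.real (Icc (t - δ) (t + δ)) ≤ volume.real (Icc (t - δ) (t + δ)) :=
    ENNReal.toReal_mono (by simp) (Measure.restrict_apply_le _ _)
  refine h1.trans ?_
  rw [Real.volume_real_Icc_of_le (by linarith)]
  linarith

lemma band_comm (δ t s : ℝ) : band δ t s = band δ s t := by
  unfold band; rw [abs_sub_comm]

/-- Schur test for banded kernels. -/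
lemma norm_le_of_banded {e q : L2I H} {M δ : ℝ} (hM : 0 ≤ M) (hδ : 0 < δ)
    (h : ∀ᵐ t ∂timeMeasure, ‖e t‖ ≤ M * ∫ s, band δ t s * ‖q s‖ ∂timeMeasure) :
    ‖e‖ ≤ M * (2 * δ) * ‖q‖ := by
  have hq2 : Integrable (fun s => ‖q s‖ ^ 2) timeMeasure := (Lp.memLp q).integrable_norm_pow two_ne_zero
  have hq1 : Integrable (fun s => ‖q s‖) timeMeasure := (integrable_L2I q).norm
  have hnorm : ∀ v : L2I H, ‖v‖ ^ 2 = ∫ t, ‖v t‖ ^ 2 ∂timeMeasure := fun v => by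
    rw [← real_inner_self_eq_norm_sq, L2.inner_def]
    simp_rw [real_inner_self_eq_norm_sq]
  -- Cauchy–Schwarz against the band, written as Young's inequality with the parameter adapted to y;
  -- a row of the band has mass at most 2δ.
  have hcs : ∀ t, (∫ s, band δ t s * ‖q s‖ ∂timeMeasure) ^ 2 ≤
      2 * δ * ∫ s, band δ t s * ‖q s‖ ^ 2 ∂timeMeasure := by
    intro t
    set y := ∫ s, band δ t s * ‖q s‖ ∂timeMeasure with hy
    have h1 : ∫ s, band δ t s * (2 * y * ‖q s‖) ∂timeMeasure ≤
        ∫ s, (2 * δ * (band δ t s * ‖q s‖ ^ 2) + band δ t s * (y ^ 2 / (2 * δ))) ∂timeMeasure := by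
      refine integral_mono (integrable_band_smul δ t (hq1.const_mul _)) ?_ fun s => ?_
      · exact ((integrable_band_smul δ t hq2).const_mul _).add
          (integrable_band_smul δ t (integrable_const _))
      · have hb := band_nonneg δ t s
        have h2 : 2 * y * ‖q s‖ ≤ 2 * δ * ‖q s‖ ^ 2 + y ^ 2 / (2 * δ) := by
          have h3 : 2 * δ * ‖q s‖ ^ 2 + y ^ 2 / (2 * δ) - 2 * y * ‖q s‖ =
              (2 * δ * ‖q s‖ - y) ^ 2 / (2 * δ) := by field_simp; ring
          have : 0 ≤ (2 * δ * ‖q s‖ - y) ^ 2 / (2 * δ) := by positivity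
          linarith
        calc _ ≤ band δ t s * (2 * δ * ‖q s‖ ^ 2 + y ^ 2 / (2 * δ)) := by gcongr
          _ = _ := by ring
    have e1 : ∫ s, band δ t s * (2 * y * ‖q s‖) ∂timeMeasure = 2 * y * y := by
      have : ∀ s, band δ t s * (2 * y * ‖q s‖) = 2 * y * (band δ t s * ‖q s‖) := fun s => by ring
      simp_rw [this]
      rw [integral_const_mul]
    rw [e1, integral_add ((integrable_band_smul δ t hq2).const_mul _)
      (integrable_band_smul δ t (integrable_const _)), integral_const_mul,
      integral_mul_const] at h1
    have h4 : (∫ s, band δ t s ∂timeMeasure) * (y ^ 2 / (2 * δ)) ≤ y ^ 2 := by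
      calc _ ≤ (2 * δ) * (y ^ 2 / (2 * δ)) := by
            gcongr; exact integral_band_le hδ.le t
        _ = _ := by field_simp
    nlinarith
  -- The same mass bound for the columns, after Fubini and by symmetry of the band.
  have hswap : ∫ t, ∫ s, band δ t s * ‖q s‖ ^ 2 ∂timeMeasure ∂timeMeasure ≤
      2 * δ * ‖q‖ ^ 2 := by
    have h1 := integral_kernel_swap (measurable_band δ) 1 (fun t _ s _ => abs_band_le δ t s) hq2
    simp only [smul_eq_mul] at h1
    rw [h1, hnorm q, ← integral_const_mul]
    refine integral_mono_of_nonneg (Eventually.of_forall fun s => ?_) (hq2.const_mul _)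
      (Eventually.of_forall fun s => ?_)
    · exact mul_nonneg (integral_nonneg fun t => band_nonneg _ _ _) (by positivity)
    · refine mul_le_mul_of_nonneg_right ?_ (by positivity)
      simp_rw [fun t => band_comm δ t s]
      exact integral_band_le hδ.le s
  have hint : Integrable (fun t => ∫ s, band δ t s * ‖q s‖ ^ 2 ∂timeMeasure) timeMeasure := by
    refine Integrable.of_bound (C := ∫ s, ‖q s‖ ^ 2 ∂timeMeasure) ?_
      (Eventually.of_forall fun t => ?_)
    · have : AEStronglyMeasurable (fun z : ℝ × ℝ => band δ z.1 z.2 * ‖q z.2‖ ^ 2)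
          (timeMeasure.prod timeMeasure) :=
        (measurable_band δ).aestronglyMeasurable.mul hq2.aestronglyMeasurable.comp_snd
      exact this.integral_prod_right'
    · refine norm_integral_le_of_norm_le hq2 (Eventually.of_forall fun s => ?_)
      rw [norm_mul, Real.norm_of_nonneg (by positivity : (0 : ℝ) ≤ ‖q s‖ ^ 2)]
      exact mul_le_of_le_one_left (by positivity) (abs_band_le δ t s)
  refine (pow_le_pow_iff_left₀ (norm_nonneg _) (by positivity) two_ne_zero).1 ?_
  calc ‖e‖ ^ 2 = ∫ t, ‖e t‖ ^ 2 ∂timeMeasure := hnorm e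
    _ ≤ ∫ t, M ^ 2 * (2 * δ) * ∫ s, band δ t s * ‖q s‖ ^ 2 ∂timeMeasure ∂timeMeasure := by
        refine integral_mono_ae ((Lp.memLp e).integrable_norm_pow two_ne_zero)
          (hint.const_mul _) ?_
        filter_upwards [h] with t ht
        calc ‖e t‖ ^ 2 ≤ (M * ∫ s, band δ t s * ‖q s‖ ∂timeMeasure) ^ 2 :=
              pow_le_pow_left₀ (norm_nonneg _) ht 2
          _ = M ^ 2 * (∫ s, band δ t s * ‖q s‖ ∂timeMeasure) ^ 2 := by ring
          _ ≤ M ^ 2 * (2 * δ * ∫ s, band δ t s * ‖q s‖ ^ 2 ∂timeMeasure) := by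
              gcongr; exact hcs t
          _ = _ := by ring
    _ = M ^ 2 * (2 * δ) * ∫ t, ∫ s, band δ t s * ‖q s‖ ^ 2 ∂timeMeasure ∂timeMeasure :=
        integral_const_mul _ _
    _ ≤ M ^ 2 * (2 * δ) * (2 * δ * ‖q‖ ^ 2) := by gcongr
    _ = _ := by ring

end Schur

/-! ### Quasi-interpolation of iterated primitives by splines. -/

section QuasiInterpolation

variable {H : Type*} [NormedAddCommGroup H] [InnerProductSpace ℝ H]

lemma coeFn_sum_tens {ι : Type*} (s : Finset ι) (φ : ι → L2I ℝ) (b : ι → H) :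
    ⇑(∑ i ∈ s, tens (φ i) (b i)) =ᵐ[timeMeasure] fun t => ∑ i ∈ s, φ i t • b i := by
  classical
  induction s using Finset.induction_on with
  | empty => exact Eventually.of_forall fun t => by simp
  | insert i s hi ih =>
    rw [Finset.sum_insert hi]
    filter_upwards [Lp.coeFn_add (tens (φ i) (b i)) (∑ i ∈ s, tens (φ i) (b i)), ih,
      coeFn_tens (φ i) (b i)] with t h1 h2 h3
    rw [h1, Pi.add_apply, h2, h3, Finset.sum_insert hi]

lemma monotone_truncPow (k : ℕ) : Monotone (truncPow k) := by
  intro u v huv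
  unfold truncPow
  split_ifs with h1 h2 h2
  · gcongr
  · exact absurd (h1.trans_le huv) h2
  · positivity
  · exact le_rfl

lemma abs_truncPow_le (k : ℕ) {y n : ℝ} (h : y ≤ n) : |truncPow k y| ≤ truncPow k n := by
  rw [abs_of_nonneg (truncPow_nonneg k y)]; exact monotone_truncPow k h

/-- A kernel shape vanishing on the negative axis which is reproduced by the weights `a` from
truncated powers of order `K`. -/
structure IsReproduced (D K : ℕ) (a : ℕ → Polynomial ℝ) (G : ℝ → ℝ) : Prop where
  measurable : Measurable G
  bounded : ∀ n : ℝ, ∃ B, ∀ y ≤ n, |G y| ≤ B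
  eq_zero : ∀ y ≤ 0, G y = 0
  reproduced : ∀ x τ : ℝ, x < τ →
    ∑ j ∈ Finset.range (D + 1), (a j).eval x * ((τ - j) ^ K / K.factorial) = G (τ - x)

/-- Localization of the kernel error. For τ < 0 all truncated powers and `G` vanish; for τ > D + 1
all truncations are inactive and the reproduction identity is exact. In between, everything is
bounded. -/
lemma IsReproduced.exists_bound {D K : ℕ} {a : ℕ → Polynomial ℝ} {G : ℝ → ℝ}
    (h : IsReproduced D K a G) :
    ∃ C : ℝ, 0 < C ∧ ∀ x ∈ Ico (0 : ℝ) 1, ∀ τ : ℝ,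
      |G (τ - x) - ∑ j ∈ Finset.range (D + 1), (a j).eval x * truncPow K (τ - j)| ≤
        if 0 ≤ τ ∧ τ ≤ D + 1 then C else 0 := by
  obtain ⟨B, hB⟩ := h.bounded (D + 1)
  have hb : ∀ j, ∃ A, ∀ x ∈ Icc (0 : ℝ) 1, ‖(a j).eval x‖ ≤ A := fun j =>
    isCompact_Icc.exists_bound_of_continuousOn (a j).continuous.continuousOn
  choose A hA using hb
  have hA0 : ∀ j, 0 ≤ A j := fun j => (norm_nonneg _).trans (hA j 0 (by simp))
  have hB0 : 0 ≤ B := (abs_nonneg _).trans (hB 0 (by positivity))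
  have hT : 0 ≤ truncPow K (D + 1 : ℝ) := truncPow_nonneg _ _
  refine ⟨B + ∑ j ∈ Finset.range (D + 1), A j * truncPow K (D + 1) + 1, ?_, fun x hx τ => ?_⟩
  · have : 0 ≤ ∑ j ∈ Finset.range (D + 1), A j * truncPow K (D + 1) :=
      Finset.sum_nonneg fun j _ => mul_nonneg (hA0 j) hT
    linarith
  split_ifs with hτ
  · refine (abs_sub _ _).trans ?_
    have h1 := hB (τ - x) (by linarith [hx.1, hτ.2])
    have h2 : |∑ j ∈ Finset.range (D + 1), (a j).eval x * truncPow K (τ - j)| ≤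
        ∑ j ∈ Finset.range (D + 1), A j * truncPow K (D + 1) := by
      refine (Finset.abs_sum_le_sum_abs _ _).trans (Finset.sum_le_sum fun j _ => ?_)
      rw [abs_mul]
      refine mul_le_mul (hA j x (Ico_subset_Icc_self hx)) (abs_truncPow_le K ?_) (abs_nonneg _)
        (hA0 j)
      have : (0 : ℝ) ≤ j := by positivity
      linarith [hτ.2]
    linarith
  · rw [not_and_or, not_le, not_le] at hτ
    refine le_of_eq (abs_eq_zero.2 ?_)
    rcases hτ with hτ | hτ
    · rw [h.eq_zero _ (by linarith [hx.1]), Finset.sum_eq_zero, sub_zero]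
      intro j _
      have : (0 : ℝ) ≤ j := by positivity
      rw [truncPow_of_nonpos _ (by linarith), mul_zero]
    · have hD : (0 : ℝ) ≤ D := by positivity
      rw [← h.reproduced x τ (by linarith [hx.2]), sub_eq_zero]
      refine Finset.sum_congr rfl fun j hj => ?_
      have : (j : ℝ) < D + 1 := by exact_mod_cast Finset.mem_range.1 hj
      rw [truncPow_of_pos _ (by linarith)]

lemma measurable_wt (a : Polynomial ℝ) (c : ℝ) (N l : ℕ) :
    Measurable fun s : ℝ => if ⌊N * s⌋₊ = l then c * a.eval (N * s - l) else 0 := by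
  refine Measurable.ite ?_ ?_ measurable_const
  · exact (Nat.measurable_floor.comp (measurable_const.mul measurable_id))
      (measurableSet_singleton l)
  · exact (measurable_const.mul (a.continuous.comp (by fun_prop)).measurable)

lemma exists_bound_wt (a : Polynomial ℝ) (c : ℝ) (N l : ℕ) :
    ∃ B, ∀ s ∈ Ioo (0 : ℝ) 1, ‖if ⌊N * s⌋₊ = l then c * a.eval (N * s - l) else 0‖ ≤ B := by
  obtain ⟨A, hA⟩ := (isCompact_Icc (a := (0 : ℝ)) (b := 1)).exists_bound_of_continuousOn
    (f := fun s => c * a.eval (N * s - l))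
    (continuous_const.mul (a.continuous.comp (by fun_prop))).continuousOn
  refine ⟨A, fun s hs => ?_⟩
  have h1 := hA s (Ioo_subset_Icc_self hs)
  split_ifs
  · exact h1
  · rw [norm_zero]; exact (norm_nonneg _).trans h1

lemma memLp_wt (a : Polynomial ℝ) (c : ℝ) (N l : ℕ) :
    MemLp (fun s : ℝ => if ⌊N * s⌋₊ = l then c * a.eval (N * s - l) else 0) 2 timeMeasure := by
  obtain ⟨B, hB⟩ := exists_bound_wt a c N l
  exact memLp_of_bound_on (measurable_wt a c N l).aestronglyMeasurable B hB

/-- The quasi-interpolant of order `K`, with weights `a`. -/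
def quasiInt (D K : ℕ) (a : ℕ → Polynomial ℝ) (c : ℝ) (N : ℕ) (q : L2I H) : L2I H :=
  ∑ i ∈ Finset.range N ×ˢ Finset.range (D + 1),
    tens (truncL K N (i.1 + i.2)) (coef (memLp_wt (a i.2) c N i.1).toLp q)

/-- The knots are l + j with l < N and j ≤ D, which stay within the range of knots admitted in
`approxSub (D + 1) N`. -/
lemma quasiInt_mem (D : ℕ) (a : ℕ → Polynomial ℝ) (c : ℝ) (N : ℕ) (q : L2I H) :
    quasiInt D D a c N q ∈ tensSub H (approxSub (D + 1) N) := by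
  refine Submodule.sum_mem _ fun i hi => tens_mem_tensSub ?_ _
  rw [Finset.mem_product, Finset.mem_range, Finset.mem_range] at hi
  exact truncL_mem_approxSub (d := D + 1) (by omega)

variable [CompleteSpace H]

/-- Differentiation in time lowers only the order of the truncated powers and keeps the weights, so
one construction serves the L² and the H¹ estimate. -/
lemma isPrim_quasiInt (D K : ℕ) (a : ℕ → Polynomial ℝ) (c : ℝ) (N : ℕ) (q : L2I H) :
    IsPrim (quasiInt D (K + 1) a c N q) (quasiInt D K a c N q) :=
  IsPrim.sum _ fun i _ => (isPrim_truncL K N (i.1 + i.2)).tens _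

/-- The quasi-interpolant as an integral operator: for given s only the element l = ⌊Ns⌋ containing
it contributes. Integrability is recorded so that kernels can be subtracted. -/
lemma coeFn_quasiInt (D K : ℕ) (a : ℕ → Polynomial ℝ) (c : ℝ) {N : ℕ} (hN : 1 ≤ N) (q : L2I H) :
    ∀ᵐ t ∂timeMeasure,
      Integrable (fun s : ℝ => (c * ∑ j ∈ Finset.range (D + 1), (a j).eval (N * s - ⌊N * s⌋₊) *
        truncPow K (t - ((⌊N * s⌋₊ : ℝ) + j) / N)) • q s) timeMeasure ∧
      quasiInt D K a c N q t =
        ∫ s : ℝ, (c * ∑ j ∈ Finset.range (D + 1), (a j).eval (N * s - ⌊N * s⌋₊) *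
          truncPow K (t - ((⌊N * s⌋₊ : ℝ) + j) / N)) • q s ∂timeMeasure := by
  have h0 : ∀ᵐ t ∂timeMeasure, ∀ l, truncL K N l t = truncPow K (t - (l : ℝ) / N) :=
    ae_all_iff.2 fun l => coeFn_truncL K N l
  filter_upwards [coeFn_sum_tens (Finset.range N ×ˢ Finset.range (D + 1))
    (fun i => truncL K N (i.1 + i.2))
    (fun i => coef (memLp_wt (a i.2) c N i.1).toLp q), h0] with t h1 h2
  have hI : ∀ i : ℕ × ℕ, Integrable (fun s : ℝ => truncPow K (t - ((i.1 + i.2 : ℕ) : ℝ) / N) •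
      ((if ⌊N * s⌋₊ = i.1 then c * (a i.2).eval (N * s - i.1) else 0) • q s)) timeMeasure := by
    intro i
    obtain ⟨B, hB⟩ := exists_bound_wt (a i.2) c N i.1
    exact (integrable_bdd_smul (measurable_wt (a i.2) c N i.1) B hB (integrable_L2I q)).smul _
  have hcong : (fun s : ℝ => ∑ i ∈ Finset.range N ×ˢ Finset.range (D + 1),
      truncPow K (t - ((i.1 + i.2 : ℕ) : ℝ) / N) •
      ((if ⌊N * s⌋₊ = i.1 then c * (a i.2).eval (N * s - i.1) else 0) • q s)) =ᵐ[timeMeasure]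
      fun s : ℝ => (c * ∑ j ∈ Finset.range (D + 1), (a j).eval (N * s - ⌊N * s⌋₊) *
        truncPow K (t - ((⌊N * s⌋₊ : ℝ) + j) / N)) • q s := by
    filter_upwards [ae_mem_Ioo] with s hs
    have hl := (natFloor_mem hN (Ioo_subset_Ico_self hs)).1
    rw [Finset.sum_product, Finset.sum_eq_single ⌊N * s⌋₊]
    · rw [Finset.mul_sum, Finset.sum_smul]
      refine Finset.sum_congr rfl fun j _ => ?_
      rw [if_pos rfl, smul_smul]
      congr 1
      push_cast
      ring
    · intro l _ hl'
      refine Finset.sum_eq_zero fun j _ => ?_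
      rw [if_neg (Ne.symm hl'), zero_smul, smul_zero]
    · intro h; exact absurd (Finset.mem_range.2 hl) h
  refine ⟨(integrable_finsetSum _ fun i _ => hI i).congr hcong, ?_⟩
  rw [← integral_congr_ae hcong, integral_finsetSum _ fun i _ => hI i]
  unfold quasiInt
  rw [h1]
  refine Finset.sum_congr rfl fun i _ => ?_
  rw [h2, integral_smul, coef_eq_of_ae (memLp_wt (a i.2) c N i.1).coeFn_toLp]

/-- In the local variables x = Ns - ⌊Ns⌋ and τ = Nt - ⌊Ns⌋ the difference of the kernels is bounded
by a multiple of N^{D-M} / N^K and supported where |t - s| ≤ (D+1)/N. The Schur test contributes the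
further factor 1/N. -/
lemma IsReproduced.norm_sub_quasiInt_le {D M K : ℕ} {a : ℕ → Polynomial ℝ} {G : ℝ → ℝ}
    (h : IsReproduced D K a G) :
    ∃ C : ℝ, 0 < C ∧ ∀ N : ℕ, 1 ≤ N → ∀ q w : L2I H,
      (⇑w =ᵐ[timeMeasure] fun t =>
        ∫ s, ((N : ℝ) ^ (D - M) / N ^ K * G (N * (t - s))) • q s ∂timeMeasure) →
      ‖w - quasiInt D K a ((N : ℝ) ^ (D - M)) N q‖ ≤
        C * ((N : ℝ) ^ (D - M) / N ^ K) / N * ‖q‖ := by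
  obtain ⟨C, hC, hbound⟩ := h.exists_bound
  refine ⟨C * (2 * (D + 1)), by positivity, fun N hN q w hw => ?_⟩
  have hN' : (0 : ℝ) < N := by exact_mod_cast hN
  set c : ℝ := (N : ℝ) ^ (D - M) / N ^ K with hc
  have hc0 : 0 ≤ c := by positivity
  have hδ : (0 : ℝ) < (D + 1) / N := by positivity
  have key := norm_le_of_banded (e := w - quasiInt D K a ((N : ℝ) ^ (D - M)) N q) (q := q)
    (M := C * c) (δ := (D + 1) / N) (by positivity) hδ ?_
  · refine key.trans (le_of_eq ?_)
    field_simp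
  filter_upwards [hw, coeFn_quasiInt D K a ((N : ℝ) ^ (D - M)) hN q,
    Lp.coeFn_sub w (quasiInt D K a ((N : ℝ) ^ (D - M)) N q), ae_mem_Ioo] with t h1 h2 h3 ht
  have hGi : Integrable (fun s : ℝ => (c * G (N * (t - s))) • q s) timeMeasure := by
    obtain ⟨B, hB⟩ := h.bounded N
    refine integrable_bdd_smul ?_ (c * B) (fun s hs => ?_) (integrable_L2I q)
    · exact measurable_const.mul (h.measurable.comp
        (measurable_const.mul (measurable_const.sub measurable_id)))
    · rw [abs_mul, abs_of_nonneg hc0]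
      refine mul_le_mul_of_nonneg_left (hB _ ?_) hc0
      have := sub_lt_one_of_mem ht hs
      nlinarith
  rw [h3, Pi.sub_apply, h1, h2.2, ← integral_sub hGi h2.1, ← integral_const_mul]
  refine norm_integral_le_of_norm_le
    ((integrable_band_smul _ t (integrable_L2I q).norm).const_mul _) ?_
  filter_upwards [ae_mem_Ioo] with s hs
  rw [← sub_smul, norm_smul, ← mul_assoc]
  refine mul_le_mul_of_nonneg_right ?_ (norm_nonneg _)
  obtain ⟨hl1, hl2, hl3⟩ := natFloor_mem hN (Ioo_subset_Ico_self hs)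
  set l := ⌊N * s⌋₊ with hl
  rw [div_le_iff₀ hN'] at hl2
  rw [lt_div_iff₀ hN'] at hl3
  have hx : (N * s - l : ℝ) ∈ Ico (0 : ℝ) 1 := ⟨by linarith, by linarith⟩
  have hb := hbound _ hx (N * t - l)
  have e1 : (N : ℝ) * t - l - (N * s - l) = N * (t - s) := by ring
  have e2 : ∀ j : ℕ, truncPow K ((N : ℝ) * t - l - j) =
      N ^ K * truncPow K (t - ((l : ℝ) + j) / N) := fun j => by
    rw [← truncPow_mul hN']
    congr 1
    field_simp
    ring
  simp_rw [e2] at hb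
  rw [e1] at hb
  have e3 : c * G (N * (t - s)) - (N : ℝ) ^ (D - M) * ∑ j ∈ Finset.range (D + 1),
      (a j).eval (N * s - l) * truncPow K (t - ((l : ℝ) + j) / N) =
      c * (G (N * (t - s)) - ∑ j ∈ Finset.range (D + 1),
      (a j).eval (N * s - l) * (N ^ K * truncPow K (t - ((l : ℝ) + j) / N))) := by
    rw [mul_sub c, Finset.mul_sum, Finset.mul_sum]
    congr 1
    refine Finset.sum_congr rfl fun j _ => ?_
    rw [hc]
    field_simp
  rw [e3, norm_mul, Real.norm_of_nonneg hc0, Real.norm_eq_abs]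
  have hband : (if 0 ≤ (N : ℝ) * t - l ∧ (N : ℝ) * t - l ≤ D + 1 then C else 0) ≤
      C * band ((D + 1) / N) t s := by
    split_ifs with h4
    · have : |t - s| ≤ (D + 1) / N := by
        have h5 : |N * (t - s)| ≤ D + 1 := by
          rw [abs_le]; constructor <;> nlinarith [h4.1, h4.2, hx.1, hx.2]
        rw [abs_mul, abs_of_pos hN'] at h5
        rw [le_div_iff₀ hN', mul_comm]
        exact h5
      unfold band
      rw [if_pos this, mul_one]
    · exact mul_nonneg hC.le (band_nonneg _ _ _)
  calc _ ≤ c * (C * band ((D + 1) / N) t s) := mul_le_mul_of_nonneg_left (hb.trans hband) hc0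
    _ = _ := by ring

lemma isReproduced_truncPow {D M : ℕ} {a : ℕ → Polynomial ℝ}
    (ha : ∀ x τ : ℝ, ∑ j ∈ Finset.range (D + 1), (a j).eval x *
      ((τ - j) ^ D / D.factorial) = (τ - x) ^ M / M.factorial) :
    IsReproduced D D a (truncPow M) where
  measurable := measurable_truncPow M
  bounded n := ⟨truncPow M n, fun _ hy => abs_truncPow_le M hy⟩
  eq_zero _ hy := truncPow_of_nonpos M hy
  reproduced x τ h := by rw [ha, truncPow_of_pos _ (sub_pos.2 h)]

lemma isReproduced_truncPow_deriv {D M : ℕ} {a : ℕ → Polynomial ℝ}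
    (ha : ∀ x τ : ℝ, ∑ j ∈ Finset.range (D + 2), (a j).eval x *
      ((τ - j) ^ (D + 1) / (D + 1).factorial) = (τ - x) ^ (M + 1) / (M + 1).factorial) :
    IsReproduced (D + 1) D a (truncPow M) where
  measurable := measurable_truncPow M
  bounded n := ⟨truncPow M n, fun _ hy => abs_truncPow_le M hy⟩
  eq_zero _ hy := truncPow_of_nonpos M hy
  reproduced x τ h := by
    rw [reproducing_weights_deriv ha, truncPow_of_pos _ (sub_pos.2 h), Nat.factorial_succ]
    have : (M.factorial : ℝ) ≠ 0 := by positivity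
    push_cast
    field_simp

/-- For M = 0 the right-hand side of the reproduction identity is constant in τ, so its derivative
vanishes off the diagonal. The kernel to compare with is therefore zero, and the error estimate
turns into a bound for the differentiated quasi-interpolant itself. -/
lemma isReproduced_zero {D : ℕ} {a : ℕ → Polynomial ℝ}
    (ha : ∀ x τ : ℝ, ∑ j ∈ Finset.range (D + 2), (a j).eval x *
      ((τ - j) ^ (D + 1) / (D + 1).factorial) = (τ - x) ^ 0 / Nat.factorial 0) :
    IsReproduced (D + 1) D a (fun _ => 0) where
  measurable := measurable_const
  bounded n := ⟨0, fun _ _ => by simp⟩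
  eq_zero _ _ := rfl
  reproduced x τ h := by rw [reproducing_weights_deriv ha]; simp

/-- Simultaneous approximation in `L²` and `H¹` by splines. -/
theorem exists_spline_approx {d M : ℕ} (hd : 2 ≤ d) (hM : M + 1 ≤ d) :
    ∃ C : ℝ, 0 < C ∧ ∀ N : ℕ, 1 ≤ N → ∀ q : L2I H,
      ∃ s ∈ tensSub H (approxSub d N), ∃ s' : L2I H, IsPrim s s' ∧
        ‖(primL ^ (M + 1)) q - s‖ ≤ C / (N : ℝ) ^ (M + 1) * ‖q‖ ∧
        ‖(primL ^ M) q - s'‖ ≤ C / (N : ℝ) ^ M * ‖q‖ := by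
  obtain ⟨D, rfl⟩ : ∃ D, d = D + 2 := ⟨d - 2, by omega⟩
  obtain ⟨a, ha⟩ := exists_reproducing_weights (D + 1) M (by omega)
  obtain ⟨C₁, hC₁, h₁⟩ := (isReproduced_truncPow ha).norm_sub_quasiInt_le (H := H) (M := M)
  have hdiv : ∀ {N : ℕ}, 1 ≤ N → (N : ℝ) ^ (D + 1 - M) / (N : ℝ) ^ (D + 1) = 1 / (N : ℝ) ^ M := by
    intro N hN
    have hN' : (N : ℝ) ≠ 0 := by
      have : (0 : ℝ) < N := by exact_mod_cast hN
      exact this.ne'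
    rw [div_eq_div_iff (by positivity) (by positivity), ← pow_add, one_mul]
    congr 1; omega
  have hfirst : ∀ N : ℕ, 1 ≤ N → ∀ q : L2I H,
      ‖(primL ^ (M + 1)) q - quasiInt (D + 1) (D + 1) a ((N : ℝ) ^ (D + 1 - M)) N q‖ ≤
        C₁ / (N : ℝ) ^ (M + 1) * ‖q‖ := by
    intro N hN q
    have hN' : (0 : ℝ) < N := by exact_mod_cast hN
    refine (h₁ N hN q _ ?_).trans (le_of_eq ?_)
    · rw [primL_pow_succ]
      refine (coeFn_powInt M q).trans (Eventually.of_forall fun t => ?_)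
      refine integral_congr_ae (Eventually.of_forall fun s => ?_)
      simp only
      rw [hdiv hN, truncPow_mul hN']
      congr 1
      field_simp
    · rw [hdiv hN, pow_succ]
      field_simp
  have hsecond : ∃ C₂ : ℝ, 0 < C₂ ∧ ∀ N : ℕ, 1 ≤ N → ∀ q : L2I H,
      ‖(primL ^ M) q - quasiInt (D + 1) D a ((N : ℝ) ^ (D + 1 - M)) N q‖ ≤
        C₂ / (N : ℝ) ^ M * ‖q‖ := by
    -- With M = 0 no convergence of the derivative is claimed, only boundedness: the triangle
    -- inequality gives 1 + C₂.
    cases M with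
    | zero =>
      obtain ⟨C₂, hC₂, h₂⟩ := (isReproduced_zero ha).norm_sub_quasiInt_le (H := H) (M := 0)
      refine ⟨1 + C₂, by positivity, fun N hN q => ?_⟩
      have hN' : (0 : ℝ) < N := by exact_mod_cast hN
      have h3 := h₂ N hN q 0 (by
        filter_upwards [Lp.coeFn_zero H 2 timeMeasure] with t ht
        rw [ht]; simp)
      rw [zero_sub, norm_neg] at h3
      have e1 : C₂ * ((N : ℝ) ^ (D + 1 - 0) / N ^ D) / N = C₂ := by
        rw [Nat.sub_zero, pow_succ]; field_simp
      rw [e1] at h3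
      rw [pow_zero, pow_zero, div_one, add_mul, one_mul]
      exact (norm_sub_le _ _).trans (add_le_add le_rfl h3)
    | succ M =>
      obtain ⟨C₂, hC₂, h₂⟩ :=
        (isReproduced_truncPow_deriv ha).norm_sub_quasiInt_le (H := H) (M := M + 1)
      refine ⟨C₂, hC₂, fun N hN q => ?_⟩
      have hN' : (0 : ℝ) < N := by exact_mod_cast hN
      have e0 : (N : ℝ) ^ (D + 1 - (M + 1)) / (N : ℝ) ^ D = 1 / (N : ℝ) ^ M := by
        rw [div_eq_div_iff (by positivity) (by positivity), ← pow_add, one_mul]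
        congr 1; omega
      refine (h₂ N hN q _ ?_).trans (le_of_eq ?_)
      · rw [primL_pow_succ]
        refine (coeFn_powInt M q).trans (Eventually.of_forall fun t => ?_)
        refine integral_congr_ae (Eventually.of_forall fun s => ?_)
        simp only
        rw [e0, truncPow_mul hN']
        congr 1
        field_simp
      · rw [e0, pow_succ]
        field_simp
  obtain ⟨C₂, hC₂, h₂⟩ := hsecond
  refine ⟨C₁ + C₂, by positivity, fun N hN q => ⟨_, quasiInt_mem (D + 1) a
    ((N : ℝ) ^ (D + 1 - M)) N q, _, isPrim_quasiInt (D + 1) D a _ N q, ?_, ?_⟩⟩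
  · refine (hfirst N hN q).trans ?_
    gcongr
    linarith
  · refine (h₂ N hN q).trans ?_
    gcongr
    linarith

end QuasiInterpolation

/-! ### The L²-projection onto vector-valued splines. -/

section Projection

variable {H : Type*} [NormedAddCommGroup H] [InnerProductSpace ℝ H]

/-- An orthonormal basis of a finite-dimensional space of functions in time. -/
def onb (S : Submodule ℝ (L2I ℝ)) [FiniteDimensional ℝ S] (j : Fin (Module.finrank ℝ S)) : L2I ℝ :=
  (stdOrthonormalBasis ℝ S j : S)

variable (S : Submodule ℝ (L2I ℝ)) [FiniteDimensional ℝ S]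

lemma orthonormal_onb : Orthonormal ℝ (onb S) :=
  (stdOrthonormalBasis ℝ S).orthonormal.comp_linearIsometry S.subtypeₗᵢ

lemma onb_mem (j : Fin (Module.finrank ℝ S)) : onb S j ∈ S := (stdOrthonormalBasis ℝ S j).2

lemma sum_inner_onb {ψ : L2I ℝ} (hψ : ψ ∈ S) :
    ∑ j, inner ℝ (onb S j) ψ • onb S j = ψ := by
  have h := (stdOrthonormalBasis ℝ S).sum_repr' ⟨ψ, hψ⟩
  have h2 := congrArg Subtype.val h
  simp only [Submodule.coe_sum, Submodule.coe_smul, Submodule.coe_inner] at h2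
  exact h2

/-- The `L²(I; H)`-orthogonal projection onto `S ⊗ H`. -/
def projS (v : L2I H) : L2I H := finOp (onb S) (onb S) v

lemma projS_mem (v : L2I H) : projS S v ∈ tensSub H S := by
  unfold projS finOp
  exact Submodule.sum_mem _ fun j _ => tens_mem_tensSub (onb_mem S j) _

variable [CompleteSpace H]

lemma coef_sub_projS {ψ : L2I ℝ} (hψ : ψ ∈ S) (v : L2I H) : coef ψ (v - projS S v) = 0 := by
  classical
  have h : ∀ i, coef (onb S i) (v - projS S v) = 0 := fun i => by
    rw [coef_sub, projS, finOp, coef_sum_tens (orthonormal_onb S), if_pos (Finset.mem_univ i),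
      sub_self]
  rw [← sum_inner_onb S hψ, sum_coef]
  refine Finset.sum_eq_zero fun i _ => ?_
  rw [smul_coef, h, smul_zero]

lemma inner_sub_projS {s : L2I H} (hs : s ∈ tensSub H S) (v : L2I H) :
    inner ℝ (v - projS S v) s = 0 := by
  induction hs using Submodule.span_induction with
  | mem x hx =>
    obtain ⟨φ, hφ, a, rfl⟩ := hx
    rw [inner_tens_right, coef_sub_projS S hφ, inner_zero_left]
  | zero => exact inner_zero_right _
  | add x y _ _ hx hy => rw [inner_add_right, hx, hy, add_zero]
  | smul c x _ hx => rw [real_inner_smul_right, hx, mul_zero]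

lemma norm_sub_projS_le {s : L2I H} (hs : s ∈ tensSub H S) (v : L2I H) :
    ‖v - projS S v‖ ≤ ‖v - s‖ := by
  have h0 : inner ℝ (v - projS S v) (projS S v - s) = 0 :=
    inner_sub_projS S (Submodule.sub_mem _ (projS_mem S v) hs) v
  have h1 : v - s = (v - projS S v) + (projS S v - s) := by abel
  have h2 : ‖v - s‖ ^ 2 = ‖v - projS S v‖ ^ 2 + ‖projS S v - s‖ ^ 2 := by
    rw [h1, norm_add_sq_real, h0]; ring
  refine (pow_le_pow_iff_left₀ (norm_nonneg _) (norm_nonneg _) two_ne_zero).1 ?_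
  rw [h2]
  nlinarith [sq_nonneg ‖projS S v - s‖]

end Projection

/-! ### A spline step and a spline bump at the initial time. -/

section Corrector

lemma integral_band_zero_le {δ : ℝ} (hδ : 0 ≤ δ) : ∫ t, band δ t 0 ∂timeMeasure ≤ 2 * δ := by
  simp_rw [fun t => band_comm δ t 0]
  exact integral_band_le hδ 0

lemma integrable_band (δ : ℝ) : Integrable (fun t => band δ t 0) timeMeasure := by
  simp_rw [fun t => band_comm δ t 0]
  simpa using integrable_band_smul δ 0 (integrable_const (1 : ℝ))

lemma norm_sq_le_of_abs_le_band {φ : L2I ℝ} {C δ : ℝ} (hδ : 0 ≤ δ)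
    (h : ∀ᵐ t ∂timeMeasure, |φ t| ≤ C * band δ t 0) : ‖φ‖ ^ 2 ≤ C ^ 2 * (2 * δ) := by
  have h1 : ‖φ‖ ^ 2 = ∫ t, ‖φ t‖ ^ 2 ∂timeMeasure := by
    rw [← real_inner_self_eq_norm_sq, L2.inner_def]
    simp_rw [real_inner_self_eq_norm_sq]
  calc ‖φ‖ ^ 2 ≤ ∫ t, C ^ 2 * band δ t 0 ∂timeMeasure := by
        rw [h1]
        refine integral_mono_ae ((Lp.memLp φ).integrable_norm_pow two_ne_zero)
          ((integrable_band δ).const_mul _) ?_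
        filter_upwards [h] with t ht
        calc ‖φ t‖ ^ 2 ≤ (C * band δ t 0) ^ 2 := pow_le_pow_left₀ (norm_nonneg _) ht 2
          _ = _ := by
            rw [mul_pow]
            congr 1
            unfold band
            split_ifs <;> norm_num
    _ ≤ _ := by
        rw [integral_const_mul]
        exact mul_le_mul_of_nonneg_left (integral_band_zero_le hδ) (by positivity)

/-- A spline which is a smooth step: it vanishes at `0` and is equal to `1` away from `0`; and a
normalized spline bump near `0`. -/
lemma exists_step_and_bump {d : ℕ} (hd : 2 ≤ d) :
    ∃ C : ℝ, 0 < C ∧ ∀ N : ℕ, d + 2 ≤ N → ∃ σ ∈ approxSub d N, ∃ β ∈ approxSub d N,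
      (∀ᵐ t ∂timeMeasure, |(oneL - σ) t| ≤ C * band (C / N) t 0) ∧
      (∀ᵐ t ∂timeMeasure, |β t| ≤ C * N * band (C / N) t 0) ∧
      inner ℝ oneL β = 1 := by
  obtain ⟨D, rfl⟩ : ∃ D, d = D + 2 := ⟨d - 2, by omega⟩
  -- With M = 0 the reproduced kernel is the Heaviside function; at x = 0 this yields a spline step
  -- `F` which is 0 for τ ≤ 0 and 1 for τ > D + 2.
  obtain ⟨a, ha⟩ := exists_reproducing_weights (D + 1) 0 (Nat.zero_le _)
  obtain ⟨C, hC, hbound⟩ := (isReproduced_truncPow ha).exists_bound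
  refine ⟨2 * C + 1 + (D + 3), by positivity, fun N hN => ?_⟩
  have hN' : (0 : ℝ) < N := by
    have : 0 < N := by omega
    exact_mod_cast this
  have hNd : (D : ℝ) + 4 ≤ N := by
    have : D + 2 + 2 ≤ N := hN
    exact_mod_cast (by omega : D + 4 ≤ N)
  set F : ℝ → ℝ := fun τ => ∑ j ∈ Finset.range (D + 2), (a j).eval 0 * truncPow (D + 1) (τ - j)
    with hF
  have hFc : Continuous F := by
    refine continuous_finsetSum _ fun j _ => continuous_const.mul ?_
    exact (continuous_truncPow_succ D).comp (continuous_id.sub continuous_const)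
  have hFb : ∀ τ, |truncPow 0 τ - F τ| ≤ if 0 ≤ τ ∧ τ ≤ D + 2 then C else 0 := fun τ => by
    have h := hbound 0 (by simp) τ
    rw [sub_zero] at h
    convert h using 3
    push_cast
    ring_nf
  have hF1 : ∀ τ, (D : ℝ) + 2 < τ → F τ = 1 := fun τ h => by
    have h1 := hFb τ
    rw [if_neg (fun h' => h'.2.not_gt h), truncPow_of_pos _ (by
      have : (0 : ℝ) ≤ D := by positivity
      linarith)] at h1
    have h2 := abs_nonpos_iff.1 h1
    simp only [pow_zero, Nat.factorial_zero, Nat.cast_one, div_one] at h2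
    linarith
  have hF0 : ∀ τ ≤ 0, F τ = 0 := fun τ h => by
    refine Finset.sum_eq_zero fun j _ => ?_
    have : (0 : ℝ) ≤ j := by positivity
    rw [truncPow_of_nonpos _ (by linarith), mul_zero]
  set st : ℕ → L2I ℝ := fun l => ∑ j ∈ Finset.range (D + 2),
    ((a j).eval 0 * (N : ℝ) ^ (D + 1)) • truncL (D + 1) N (l + j) with hst
  have hst_mem : ∀ l ≤ 1, st l ∈ approxSub (D + 2) N := fun l hl => by
    refine Submodule.sum_mem _ fun j hj => Submodule.smul_mem _ _ ?_
    have := Finset.mem_range.1 hj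
    exact truncL_mem_approxSub (d := D + 2) (by omega)
  have hst_eq : ∀ l, ⇑(st l) =ᵐ[timeMeasure] fun t => F (N * t - l) := fun l => by
    have h1 := coeFn_sum_tens (Finset.range (D + 2)) (fun j => truncL (D + 1) N (l + j))
      (fun j => (a j).eval 0 * (N : ℝ) ^ (D + 1))
    have h2 : ∑ j ∈ Finset.range (D + 2), tens (truncL (D + 1) N (l + j))
        ((a j).eval 0 * (N : ℝ) ^ (D + 1)) = st l := by
      refine Finset.sum_congr rfl fun j _ => ?_
      apply Lp.ext
      filter_upwards [coeFn_tens (truncL (D + 1) N (l + j)) ((a j).eval 0 * (N : ℝ) ^ (D + 1)),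
        Lp.coeFn_smul ((a j).eval 0 * (N : ℝ) ^ (D + 1)) (truncL (D + 1) N (l + j))]
        with t e1 e2
      rw [e1, e2, Pi.smul_apply, smul_eq_mul, smul_eq_mul, mul_comm]
    rw [h2] at h1
    have h0 : ∀ᵐ t ∂timeMeasure, ∀ j, truncL (D + 1) N j t = truncPow (D + 1) (t - (j : ℝ) / N) :=
      ae_all_iff.2 fun l => coeFn_truncL (D + 1) N l
    filter_upwards [h1, h0] with t e1 e2
    rw [e1]
    refine Finset.sum_congr rfl fun j _ => ?_
    rw [e2, smul_eq_mul]
    have e3 : (N : ℝ) * t - l - j = N * (t - ((l + j : ℕ) : ℝ) / N) := by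
      push_cast; field_simp; ring
    rw [e3, truncPow_mul hN']
    ring
  have hband : ∀ t ∈ Ioo (0 : ℝ) 1, (N : ℝ) * t ≤ D + 3 →
      band ((2 * C + 1 + (D + 3)) / N) t 0 = 1 := by
    intro t ht h
    unfold band
    rw [if_pos]
    rw [sub_zero, abs_of_pos ht.1, le_div_iff₀ hN']
    linarith
  have hD0 : (0 : ℝ) ≤ D := by positivity
  -- The bump is N times the difference of two steps shifted by one element: it has height O(N) and
  -- lives on O(1) elements at 0.
  refine ⟨st 0, hst_mem 0 zero_le_one, (N : ℝ) • (st 0 - st 1),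
    Submodule.smul_mem _ _ (Submodule.sub_mem _ (hst_mem 0 zero_le_one) (hst_mem 1 le_rfl)),
    ?_, ?_, ?_⟩
  · filter_upwards [hst_eq 0, Lp.coeFn_sub oneL (st 0), coeFn_oneL, ae_mem_Ioo] with t e1 e2 e3 ht
    rw [e2, Pi.sub_apply, e3, e1, Nat.cast_zero, sub_zero]
    have hp : 0 < (N : ℝ) * t := mul_pos hN' ht.1
    have h1 := hFb (N * t)
    rw [truncPow_of_pos _ hp] at h1
    simp only [pow_zero, Nat.factorial_zero, Nat.cast_one, div_one] at h1
    refine h1.trans ?_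
    split_ifs with h2
    · rw [hband t ht (by linarith [h2.2])]
      linarith
    · exact mul_nonneg (by positivity) (band_nonneg _ _ _)
  · filter_upwards [hst_eq 0, hst_eq 1, Lp.coeFn_sub (st 0) (st 1),
      Lp.coeFn_smul (N : ℝ) (st 0 - st 1), ae_mem_Ioo] with t e1 e2 e3 e4 ht
    rw [e4, Pi.smul_apply, e3, Pi.sub_apply, e1, e2, Nat.cast_zero, sub_zero, Nat.cast_one,
      smul_eq_mul, abs_mul, abs_of_pos hN']
    rcases le_or_gt ((N : ℝ) * t) (D + 3) with h | h
    · rw [hband t ht h]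
      have hle : ∀ τ, (if 0 ≤ τ ∧ τ ≤ (D : ℝ) + 2 then C else 0) ≤ C := fun τ => by
        split_ifs
        · exact le_rfl
        · exact hC.le
      have h1 := (hFb (N * t)).trans (hle _)
      have h2 := (hFb (N * t - 1)).trans (hle _)
      have hz : ∀ τ, 0 ≤ truncPow 0 τ ∧ truncPow 0 τ ≤ 1 := fun τ => by
        unfold truncPow; split_ifs <;> simp
      have h3 : |F (N * t) - F (N * t - 1)| ≤ 2 * C + 1 := by
        rw [abs_le] at h1 h2 ⊢
        have := hz (N * t)
        have := hz (N * t - 1)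
        constructor <;> linarith
      rw [mul_one, mul_comm]
      refine mul_le_mul_of_nonneg_right (h3.trans ?_) hN'.le
      linarith
    · rw [hF1 _ (by linarith), hF1 _ (by linarith)]
      simp only [sub_self, abs_zero, mul_zero]
      exact mul_nonneg (by positivity) (band_nonneg _ _ _)
  · have hsub : ⇑(st 0 - st 1) =ᵐ[timeMeasure] fun t => F (N * t) - F (N * t - 1) := by
      filter_upwards [hst_eq 0, hst_eq 1, Lp.coeFn_sub (st 0) (st 1)] with t e1 e2 e3
      rw [e3, Pi.sub_apply, e1, e2, Nat.cast_zero, sub_zero, Nat.cast_one]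
    have hi : ∀ x y, IntervalIntegrable F volume x y := fun x y => hFc.intervalIntegrable x y
    have hc1 : Continuous fun t => F (N * t) := hFc.comp (by fun_prop)
    have hc2 : Continuous fun t => F (N * t - 1) := hFc.comp (by fun_prop)
    rw [real_inner_smul_right, inner_L2I_of_ae coeFn_oneL hsub]
    simp only [one_mul]
    rw [intervalIntegral.integral_sub
      (hc1.intervalIntegrable _ _) (hc2.intervalIntegrable _ _),
      intervalIntegral.integral_comp_mul_left F hN'.ne',
      intervalIntegral.integral_comp_mul_sub F hN'.ne', mul_zero, mul_one, zero_sub,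
      ← smul_sub, intervalIntegral.integral_interval_sub_interval_comm (hi _ _) (hi _ _) (hi _ _)]
    have h1 : ∫ τ in (0 : ℝ)..(-1), F τ = 0 := by
      rw [intervalIntegral.integral_congr (g := fun _ => (0 : ℝ)), intervalIntegral.integral_zero]
      intro τ hτ
      rw [uIcc_of_ge (by norm_num)] at hτ
      exact hF0 τ hτ.2
    -- The mass telescopes to the integral of `F` over the last unit interval. There `F` is
    -- identically 1, because d + 2 ≤ N leaves room for the transition layer.
    have h2 : ∫ τ in (N : ℝ)..(N - 1), F τ = -1 := by
      rw [intervalIntegral.integral_congr (g := fun _ => (1 : ℝ))]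
      · simp
      · intro τ hτ
        rw [uIcc_of_ge (by linarith)] at hτ
        exact hF1 τ (by linarith [hτ.1])
    rw [h1, h2, smul_eq_mul]
    field_simp
    ring

end Corrector

lemma two_mul_ofReal_add {a b : ℝ} (ha : 0 ≤ a) (hb : 0 ≤ b) :
    2 * (ENNReal.ofReal a + ENNReal.ofReal b) = ENNReal.ofReal (2 * (a + b)) := by
  rw [ENNReal.ofReal_mul zero_le_two, ENNReal.ofReal_add ha hb, ENNReal.ofReal_ofNat]

/-! ### The operator in time: quasi-optimality, H^{1/2}-stability and the negative-norm estimate. -/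

section TimeOperator

variable {H : Type*} [NormedAddCommGroup H] [InnerProductSpace ℝ H] [CompleteSpace H]

lemma sub_tens_eq (v p : L2I H) (β : L2I ℝ) (c : H) :
    v - (tens β c + p) = (v - p) - tens β c := by abel

/-- The L²-projection corrected by a bump β that carries the mean of the projection error z = v -
`projS S v`. The correction is cheap: since z is orthogonal to the spline step, its mean only sees
the boundary layer and is O(N^{-1/2})‖z‖, while ‖β‖ = O(N^{1/2}). Against primitives, which are
O(√t) near 0, β is again O(N^{-1/2}), so the gain 1/N of the projection survives. -/
lemma exists_timeOp_aux {d : ℕ} (hd : 2 ≤ d) :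
    ∃ C : ℝ, 0 < C ∧ ∀ N : ℕ, d + 2 ≤ N → ∃ (ι : Type) (_ : Fintype ι) (φ χ : ι → L2I ℝ),
      (∀ i, φ i ∈ approxSub d N) ∧ ∀ v : L2I H,
        (∀ a : H, inner ℝ (v - finOp φ χ v) (tens oneL a) = 0) ∧
        ∀ s ∈ tensSub H (approxSub d N),
          ‖v - finOp φ χ v‖ ≤ C * ‖v - s‖ ∧
          ∀ q : L2I H, |inner ℝ (v - finOp φ χ v) (primL q)| ≤ C / N * ‖v - s‖ * ‖q‖ := by
  obtain ⟨B, hB, hstep⟩ := exists_step_and_bump hd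
  obtain ⟨A, hA, happ⟩ := exists_spline_approx (H := H) (M := 0) hd (by omega)
  set C₁ := √(B ^ 2 * (2 * B)) with hC₁
  have hC₁0 : 0 < C₁ := Real.sqrt_pos.2 (by positivity)
  set C₂ := √B * (2 * B ^ 2) with hC₂
  refine ⟨1 + C₁ * C₁ + A + C₁ * C₂, by positivity, fun N hN => ?_⟩
  obtain ⟨σ, hσ, β, hβ, hσb, hβb, hβ1⟩ := hstep N hN
  have hN1 : 1 ≤ N := by omega
  have hN' : (0 : ℝ) < N := by exact_mod_cast hN1
  have hsN : 0 < √(N : ℝ) := Real.sqrt_pos.2 hN'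
  let S := approxSub d N
  -- The index `none` carries the corrector. Its functional is integration against the part of the
  -- constant 1 orthogonal to `S`, which returns the mean of the projection error.
  refine ⟨Option (Fin (Module.finrank ℝ S)), inferInstance,
    fun o => o.elim β (onb S),
    fun o => o.elim (oneL - ∑ j, inner ℝ (onb S j) oneL • onb S j) (onb S), ?_, fun v => ?_⟩
  · rintro (_ | j)
    · exact hβ
    · exact onb_mem S j
  set z := v - projS S v with hz
  set P := finOp (fun o : Option (Fin (Module.finrank ℝ S)) => o.elim β (onb S))
    (fun o => o.elim (oneL - ∑ j, inner ℝ (onb S j) oneL • onb S j) (onb S)) v with hP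
  have hPv : v - P = z - tens β (coef oneL z) := by
    have h1 : coef (oneL - ∑ j, inner ℝ (onb S j) oneL • onb S j) v = coef oneL z := by
      rw [hz, sub_coef, coef_sub, sum_coef, projS, finOp, coef_sum]
      congr 1
      refine Finset.sum_congr rfl fun j _ => ?_
      rw [smul_coef, coef_tens, real_inner_comm]
    have h2 : P = tens β (coef oneL z) + projS S v := by
      rw [hP]
      unfold finOp
      rw [Fintype.sum_option]
      simp only [Option.elim_none, Option.elim_some]
      rw [h1]
      rfl
    rw [h2, sub_tens_eq]
  -- Orthogonality allows 1 to be replaced by 1 - σ, supported in a layer of length O(1/N).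
  have hone : ‖coef oneL z‖ ≤ C₁ / √N * ‖z‖ := by
    have h1 : coef oneL z = coef (oneL - σ) z := by
      rw [sub_coef, hz, coef_sub_projS S hσ, sub_zero]
    rw [h1]
    refine (norm_coef_le _ _).trans (mul_le_mul_of_nonneg_right ?_ (norm_nonneg _))
    have h2 := norm_sq_le_of_abs_le_band (by positivity) hσb
    rw [hC₁, ← Real.sqrt_div (by positivity)]
    refine Real.le_sqrt_of_sq_le (h2.trans (le_of_eq ?_))
    ring
  have hβn : ‖β‖ ≤ C₁ * √N := by
    have h2 := norm_sq_le_of_abs_le_band (by positivity) hβb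
    rw [hC₁, ← Real.sqrt_mul (by positivity)]
    refine Real.le_sqrt_of_sq_le (h2.trans (le_of_eq ?_))
    field_simp
  -- β has size O(N) on a layer of length O(1/N), where the primitive is at most √(B/N) ‖q‖.
  have hβm : ∀ q : L2I H, ‖coef β (primL q)‖ ≤ C₂ / √N * ‖q‖ := by
    intro q
    have h1 : ‖coef β (primL q)‖ ≤
        ∫ t, B * N * (√(B / N) * ‖q‖) * band (B / N) t 0 ∂timeMeasure := by
      refine norm_integral_le_of_norm_le ((integrable_band _).const_mul _) ?_
      filter_upwards [hβb, (isPrim_primL q).norm_le_sqrt, ae_mem_Ioo] with t e1 e2 ht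
      rw [norm_smul, Real.norm_eq_abs]
      have e3 : B * N * band (B / N) t 0 * ‖primL q t‖ ≤
          B * N * band (B / N) t 0 * (√(B / N) * ‖q‖) := by
        by_cases hb : |t - 0| ≤ B / N
        · refine mul_le_mul_of_nonneg_left (e2.trans ?_)
            (mul_nonneg (by positivity) (band_nonneg _ _ _))
          refine mul_le_mul_of_nonneg_right (Real.sqrt_le_sqrt ?_) (norm_nonneg _)
          rwa [sub_zero, abs_of_pos ht.1] at hb
        · have : band (B / N) t 0 = 0 := if_neg hb
          rw [this]; simp
      calc _ ≤ B * N * band (B / N) t 0 * ‖primL q t‖ := by gcongr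
        _ ≤ _ := e3
        _ = _ := by ring
    refine h1.trans ?_
    rw [integral_const_mul]
    calc _ ≤ B * N * (√(B / N) * ‖q‖) * (2 * (B / N)) :=
          mul_le_mul_of_nonneg_left (integral_band_zero_le (by positivity)) (by positivity)
      _ = _ := by
          rw [hC₂, Real.sqrt_div hB.le]
          field_simp
  refine ⟨fun a => ?_, fun s hs => ?_⟩
  · rw [hPv, inner_tens_right, coef_sub, coef_tens, hβ1, one_smul, sub_self, inner_zero_left]
  have hzs : ‖z‖ ≤ ‖v - s‖ := norm_sub_projS_le S hs v
  refine ⟨?_, fun q => ?_⟩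
  · rw [hPv]
    have h1 : ‖tens β (coef oneL z)‖ ≤ C₁ * C₁ * ‖z‖ := by
      rw [norm_tens]
      calc _ ≤ (C₁ * √N) * (C₁ / √N * ‖z‖) := by gcongr
        _ = _ := by field_simp
    calc _ ≤ ‖z‖ + C₁ * C₁ * ‖z‖ := (norm_sub_le _ _).trans (by linarith)
      _ = (1 + C₁ * C₁) * ‖z‖ := by ring
      _ ≤ (1 + C₁ * C₁ + A + C₁ * C₂) * ‖v - s‖ := by
          have : 0 ≤ C₁ * C₂ := by positivity
          exact mul_le_mul (by linarith) hzs (norm_nonneg _) (by positivity)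
  · obtain ⟨m, hm, -, -, hm2, -⟩ := happ N hN1 q
    rw [zero_add, pow_one, pow_one] at hm2
    have h1 : |inner ℝ z (primL q)| ≤ ‖z‖ * (A / N * ‖q‖) := by
      have : inner ℝ z (primL q) = inner ℝ z (primL q - m) := by
        rw [inner_sub_right, hz, inner_sub_projS S hm, sub_zero]
      rw [this]
      exact (abs_real_inner_le_norm _ _).trans (by gcongr)
    have h2 : |inner ℝ (tens β (coef oneL z)) (primL q)| ≤
        (C₁ / √N * ‖z‖) * (C₂ / √N * ‖q‖) := by
      rw [inner_tens_left]
      refine (abs_real_inner_le_norm _ _).trans ?_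
      have := hβm q
      gcongr
    rw [hPv, inner_sub_left]
    refine (abs_sub _ _).trans ?_
    calc _ ≤ ‖z‖ * (A / N * ‖q‖) + (C₁ / √N * ‖z‖) * (C₂ / √N * ‖q‖) := add_le_add h1 h2
      _ = (A + C₁ * C₂) / N * ‖z‖ * ‖q‖ := by
          have : √(N : ℝ) * √N = N := Real.mul_self_sqrt hN'.le
          have h3 : (C₁ / √N * ‖z‖) * (C₂ / √N * ‖q‖) = C₁ * C₂ / (√N * √N) * ‖z‖ * ‖q‖ := by
            field_simp
          rw [h3, this]
          ring
      _ ≤ (1 + C₁ * C₁ + A + C₁ * C₂) / N * ‖v - s‖ * ‖q‖ := by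
          gcongr
          have : 0 ≤ C₁ * C₁ := by positivity
          linarith

/-- Energy estimate for a quasi-optimal operator onto a spline space. -/
lemma exists_energy_sub_le (d : ℕ) (hd : 2 ≤ d) (C₀ : ℝ) (hC₀ : 0 < C₀) :
    ∃ C : ℝ, 0 < C ∧ ∀ N : ℕ, 1 ≤ N → ∀ (v w s r : L2I H),
      s ∈ tensSub H (approxSub d N) → w ∈ tensSub H (approxSub d N) →
      ‖v - w‖ ≤ C₀ * ‖v - s‖ → IsPrim (v - s) r →
      sinEnergy (v - w) ≤ ENNReal.ofReal (C * (‖v - s‖ * ‖r‖ + N * ‖v - s‖ ^ 2)) := by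
  obtain ⟨C₁, hC₁, hinv⟩ := exists_isPrim_of_mem_tensSub (H := H) d
  refine ⟨2 + 2 * C₁ * (C₀ + 1) ^ 2, by positivity, fun N hN v w s r hs hw hvw hr => ?_⟩
  have hmono := tensSub_mono (H := H) (approxSub_le (d := d) (r := 0) hN hd)
  obtain ⟨q, hq, hqn⟩ := hinv 0 N hN (s - w) (Submodule.sub_mem _ (hmono hs) (hmono hw))
  -- The first difference is estimated by interpolation between L² and H¹; the second is a spline,
  -- so its derivative is bounded by the inverse inequality.
  have h1 : v - w = (v - s) + (s - w) := by abel
  have h2 := hr.sinEnergy_le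
  have h3 := hq.sinEnergy_le
  have h4 : ‖s - w‖ ≤ (C₀ + 1) * ‖v - s‖ := by
    have : s - w = (v - w) - (v - s) := by abel
    rw [this]
    exact (norm_sub_le _ _).trans (by linarith)
  have h5 : ‖s - w‖ * ‖q‖ ≤ C₁ * (C₀ + 1) ^ 2 * (N * ‖v - s‖ ^ 2) := by
    calc _ ≤ ‖s - w‖ * (C₁ * N * ‖s - w‖) := by gcongr
      _ = C₁ * N * ‖s - w‖ ^ 2 := by ring
      _ ≤ C₁ * N * ((C₀ + 1) * ‖v - s‖) ^ 2 := by gcongr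
      _ = _ := by ring
  rw [h1]
  refine (sinEnergy_add_le _ _).trans ?_
  calc _ ≤ 2 * (ENNReal.ofReal (‖v - s‖ * ‖r‖) + ENNReal.ofReal (‖s - w‖ * ‖q‖)) := by gcongr
    _ = ENNReal.ofReal (2 * (‖v - s‖ * ‖r‖ + ‖s - w‖ * ‖q‖)) := by
        exact two_mul_ofReal_add (by positivity) (by positivity)
    _ ≤ _ := by
        refine ENNReal.ofReal_le_ofReal ?_
        have e1 : 0 ≤ ‖v - s‖ * ‖r‖ := by positivity
        have e2 : 0 ≤ C₁ * (C₀ + 1) ^ 2 * (‖v - s‖ * ‖r‖) := by positivity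
        have e3 : 0 ≤ N * ‖v - s‖ ^ 2 := by positivity
        nlinarith

lemma le_freq (N : ℕ) : (N : ℝ) ≤ freq N := by
  unfold freq
  have := Real.pi_gt_three
  have h : (0 : ℝ) ≤ N := by positivity
  nlinarith

lemma freq_le {N : ℕ} (hN : 1 ≤ N) : freq N ≤ 6 * N := by
  unfold freq
  have := Real.pi_le_four
  have h : (1 : ℝ) ≤ N := by exact_mod_cast hN
  nlinarith

/-- The low frequency part of the sine expansion. -/
def lowS (N : ℕ) (v : L2I H) : L2I H := ∑ k ∈ Finset.range N, tens (sinL k) (sinCoeff v k)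

lemma isPrim_lowS (N : ℕ) (v : L2I H) :
    IsPrim (lowS N v) (∑ k ∈ Finset.range N, tens (cosL k) (freq k • sinCoeff v k)) := by
  refine IsPrim.sum _ fun k _ => ?_
  have h := (isPrim_sinL k).tens (sinCoeff v k)
  rwa [smul_tens, ← tens_smul] at h

lemma sinEnergy_lowS_le (N : ℕ) (v : L2I H) : sinEnergy (lowS N v) ≤ sinEnergy v := by
  refine ENNReal.tsum_le_tsum fun k => ?_
  rw [sinCoeff_eq, lowS, coef_sum_tens orthonormal_sinL]
  split_ifs
  · exact le_rfl
  · simp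

lemma finOp_add_sub {ι : Type*} [Fintype ι] (φ χ : ι → L2I ℝ) (v w : L2I H) :
    finOp φ χ v = finOp φ χ w + finOp φ χ (v - w) := by
  rw [finOp_sub]; abel

/-- Stability of a quasi-optimal operator in `H^{1/2}_{0,}(I; H)`. -/
lemma exists_sinEnergy_finOp_le (d : ℕ) (hd : 2 ≤ d) (C₀ : ℝ) (hC₀ : 0 < C₀) :
    ∃ C : ℝ, 0 < C ∧ ∀ N : ℕ, 1 ≤ N → ∀ (ι : Type) [Fintype ι] (φ χ : ι → L2I ℝ),
      (∀ i, φ i ∈ approxSub d N) →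
      (∀ v : L2I H, ∀ s ∈ tensSub H (approxSub d N), ‖v - finOp φ χ v‖ ≤ C₀ * ‖v - s‖) →
      ∀ v : L2I H, sinEnergy (finOp φ χ v) ≤ ENNReal.ofReal C * sinEnergy v := by
  obtain ⟨C₁, hC₁, henergy⟩ := exists_energy_sub_le (H := H) d hd C₀ hC₀
  obtain ⟨A, hA, happ⟩ := exists_spline_approx (H := H) (M := 0) hd (by omega)
  obtain ⟨C₂, hC₂, hinv⟩ := exists_isPrim_of_mem_tensSub (H := H) d
  refine ⟨4 * (1 + C₁ * (6 * (A * A + A ^ 2))) + 2 * (C₂ * (C₀ + 1) ^ 2), by positivity,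
    fun N hN ι _ φ χ hφ hopt v => ?_⟩
  have hN' : (0 : ℝ) < N := by exact_mod_cast hN
  have hmem : ∀ v : L2I H, finOp φ χ v ∈ tensSub H (approxSub d N) := fun v =>
    Submodule.sum_mem _ fun i _ => tens_mem_tensSub (hφ i) _
  by_cases hv : sinEnergy v < ⊤
  swap
  · rw [not_lt, top_le_iff] at hv
    rw [hv, ENNReal.mul_top (by simp; positivity)]
    exact le_top
  have hs := (sinEnergy_lt_top_iff v).1 hv
  set E := energy v with hE
  have hE0 : 0 ≤ E := energy_nonneg v
  -- Cutting at the index N balances both parts: the derivative of the low part is O(√(N E)), and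
  -- the high part is O(√(E/N)) in L².
  set vl := lowS N v with hvl
  set ql := ∑ k ∈ Finset.range N, tens (cosL k) (freq k • sinCoeff v k) with hql
  have hprim : IsPrim vl ql := isPrim_lowS N v
  have hqn : ‖ql‖ ^ 2 ≤ 6 * N * E := by
    refine (norm_low_deriv_sq_le orthonormal_cosL hs N).trans ?_
    exact mul_le_mul_of_nonneg_right (freq_le hN) hE0
  have hhigh : N * ‖v - vl‖ ^ 2 ≤ E := by
    have h1 := norm_sub_low_sq_le orthonormal_sinL (hasSum_sinCoeff v) hs N
    refine le_trans ?_ h1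
    exact mul_le_mul_of_nonneg_right (le_freq N) (by positivity)
  have hlow : sinEnergy (finOp φ χ vl) ≤
      ENNReal.ofReal (2 * (1 + C₁ * (6 * (A * A + A ^ 2))) * E) := by
    obtain ⟨s, hs1, s', hs2, hs3, hs4⟩ := happ N hN ql
    have hpl : (primL ^ (0 + 1)) ql = vl := by
      rw [zero_add, pow_one]; exact (isPrim_primL ql).unique hprim
    rw [hpl, zero_add, pow_one] at hs3
    rw [pow_zero, pow_zero, div_one, Module.End.one_apply] at hs4
    have h1 := henergy N hN vl (finOp φ χ vl) s (ql - s') hs1 (hmem vl) (hopt vl s hs1)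
      (hprim.sub hs2)
    have h2 : ‖vl - s‖ * ‖ql - s'‖ + N * ‖vl - s‖ ^ 2 ≤ 6 * (A * A + A ^ 2) * E := by
      calc _ ≤ (A / N * ‖ql‖) * (A * ‖ql‖) + N * (A / N * ‖ql‖) ^ 2 := by gcongr
        _ = (A * A + A ^ 2) / N * ‖ql‖ ^ 2 := by field_simp
        _ ≤ (A * A + A ^ 2) / N * (6 * N * E) := by gcongr
        _ = _ := by field_simp
    have h3 : finOp φ χ vl = vl - (vl - finOp φ χ vl) := by abel
    rw [h3]
    refine (sinEnergy_sub_le _ _).trans ?_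
    calc _ ≤ 2 * (ENNReal.ofReal E + ENNReal.ofReal (C₁ * (6 * (A * A + A ^ 2) * E))) := by
          gcongr
          · exact (sinEnergy_lowS_le N v).trans (sinEnergy_eq hv).le
          · exact h1.trans (ENNReal.ofReal_le_ofReal (by gcongr))
      _ = ENNReal.ofReal (2 * (E + C₁ * (6 * (A * A + A ^ 2) * E))) := by
          exact two_mul_ofReal_add hE0 (by positivity)
      _ = _ := by congr 1; ring
  -- On the high frequencies, L²-stability (quasi-optimality against the spline 0) together with the
  -- inverse inequality suffices.
  have hhi : sinEnergy (finOp φ χ (v - vl)) ≤ ENNReal.ofReal (C₂ * (C₀ + 1) ^ 2 * E) := by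
    have hmono := tensSub_mono (H := H) (approxSub_le (d := d) (r := 0) hN hd)
    obtain ⟨q, hq, hqn'⟩ := hinv 0 N hN _ (hmono (hmem (v - vl)))
    refine hq.sinEnergy_le.trans (ENNReal.ofReal_le_ofReal ?_)
    have h1 : ‖finOp φ χ (v - vl)‖ ≤ (C₀ + 1) * ‖v - vl‖ := by
      have h2 := hopt (v - vl) 0 (Submodule.zero_mem _)
      rw [sub_zero] at h2
      have h3 : finOp φ χ (v - vl) = (v - vl) - ((v - vl) - finOp φ χ (v - vl)) := by abel
      rw [h3]
      exact (norm_sub_le _ _).trans (by linarith)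
    calc _ ≤ ‖finOp φ χ (v - vl)‖ * (C₂ * N * ‖finOp φ χ (v - vl)‖) := by gcongr
      _ = C₂ * N * ‖finOp φ χ (v - vl)‖ ^ 2 := by ring
      _ ≤ C₂ * N * ((C₀ + 1) * ‖v - vl‖) ^ 2 := by gcongr
      _ = C₂ * (C₀ + 1) ^ 2 * (N * ‖v - vl‖ ^ 2) := by ring
      _ ≤ _ := by gcongr
  rw [finOp_add_sub φ χ v vl, sinEnergy_eq hv, ← ENNReal.ofReal_mul (by positivity)]
  refine (sinEnergy_add_le _ _).trans ?_
  calc _ ≤ 2 * (ENNReal.ofReal (2 * (1 + C₁ * (6 * (A * A + A ^ 2))) * E) +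
        ENNReal.ofReal (C₂ * (C₀ + 1) ^ 2 * E)) := by gcongr
    _ = ENNReal.ofReal (2 * (2 * (1 + C₁ * (6 * (A * A + A ^ 2))) * E +
        C₂ * (C₀ + 1) ^ 2 * E)) := by
        exact two_mul_ofReal_add (by positivity) (by positivity)
    _ = _ := by congr 1; ring

/-- A negative norm estimate for functions orthogonal to the constants. -/
lemma inner_hilbertT_sq_le {z e : L2I H} {N : ℕ} (hN : 1 ≤ N) {δ : ℝ}
    (he : sinEnergy e < ⊤) (h1 : ∀ a : H, inner ℝ z (tens oneL a) = 0) (h2 : ‖z‖ ≤ δ)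
    (h3 : ∀ q : L2I H, |inner ℝ z (primL q)| ≤ δ / N * ‖q‖) :
    inner ℝ z (hilbertT e) ^ 2 ≤ 14 * (δ ^ 2 / N * energy e) := by
  have hN' : (0 : ℝ) < N := by exact_mod_cast hN
  have hs := (sinEnergy_lt_top_iff e).1 he
  set E := energy e with hE
  set wl := ∑ k ∈ Finset.range N, tens (cosL k) (sinCoeff e k) with hwl
  set ql := ∑ k ∈ Finset.range N, tens (sinL k) (freq k • sinCoeff e k) with hql
  have hqn : ‖ql‖ ^ 2 ≤ 6 * N * E := by
    refine (norm_low_deriv_sq_le orthonormal_sinL hs N).trans ?_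
    exact mul_le_mul_of_nonneg_right (freq_le hN) (energy_nonneg e)
  have hhigh : N * ‖hilbertT e - wl‖ ^ 2 ≤ E := by
    have h1 := norm_sub_low_sq_le orthonormal_cosL (hasSum_hilbertT e) hs N
    refine le_trans ?_ h1
    exact mul_le_mul_of_nonneg_right (le_freq N) (by positivity)
  -- Integrating the low-frequency cosines back from 0 produces their value at 0, a constant in time
  -- annihilated by z. Otherwise this value would have to be bounded by the energy, which is
  -- possible only up to a factor growing with N.
  have hwl2 : wl = tens oneL (√2 • ∑ k ∈ Finset.range N, sinCoeff e k) - primL ql := by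
    have hp : IsPrim (∑ k ∈ Finset.range N, tens (cosL k - √2 • oneL) (sinCoeff e k))
        (∑ k ∈ Finset.range N, tens (-(freq k • sinL k)) (sinCoeff e k)) :=
      IsPrim.sum _ fun k _ => (isPrim_cosL k).tens _
    have e1 : ∑ k ∈ Finset.range N, tens (-(freq k • sinL k)) (sinCoeff e k) = -ql := by
      rw [hql, ← Finset.sum_neg_distrib]
      refine Finset.sum_congr rfl fun k _ => ?_
      rw [tens_smul, ← smul_tens, ← neg_one_smul ℝ, smul_tens, neg_one_smul]
    have e2 : ∑ k ∈ Finset.range N, tens (cosL k - √2 • oneL) (sinCoeff e k) =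
        wl - tens oneL (√2 • ∑ k ∈ Finset.range N, sinCoeff e k) := by
      rw [hwl, Finset.smul_sum, tens_sum, ← Finset.sum_sub_distrib]
      refine Finset.sum_congr rfl fun k _ => ?_
      rw [sub_tens, smul_tens, tens_smul]
    rw [e1, e2] at hp
    have := (isPrim_primL (-ql)).unique hp
    rw [map_neg] at this
    rw [eq_sub_iff_add_eq, ← sub_eq_zero]
    have h4 : primL ql = tens oneL (√2 • ∑ k ∈ Finset.range N, sinCoeff e k) - wl := by
      rw [← neg_sub, ← this, neg_neg]
    rw [h4]; abel
  have hdec : inner ℝ z (hilbertT e) = inner ℝ z (hilbertT e - wl) - inner ℝ z (primL ql) := by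
    have : inner ℝ z wl = - inner ℝ z (primL ql) := by
      rw [hwl2, inner_sub_right, h1, zero_sub]
    rw [inner_sub_right, this]; ring
  have ha : inner ℝ z (hilbertT e - wl) ^ 2 ≤ δ ^ 2 / N * E := by
    have e1 : |inner ℝ z (hilbertT e - wl)| ≤ δ * ‖hilbertT e - wl‖ :=
      (abs_real_inner_le_norm _ _).trans (by gcongr)
    calc _ ≤ (δ * ‖hilbertT e - wl‖) ^ 2 := sq_le_sq' (abs_le.1 e1).1 (abs_le.1 e1).2
      _ = δ ^ 2 / N * (N * ‖hilbertT e - wl‖ ^ 2) := by field_simp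
      _ ≤ _ := by gcongr
  have hb : inner ℝ z (primL ql) ^ 2 ≤ 6 * (δ ^ 2 / N * E) := by
    calc _ ≤ (δ / N * ‖ql‖) ^ 2 := sq_le_sq' (abs_le.1 (h3 ql)).1 (abs_le.1 (h3 ql)).2
      _ = (δ / N) ^ 2 * ‖ql‖ ^ 2 := by ring
      _ ≤ (δ / N) ^ 2 * (6 * N * E) := by gcongr
      _ = _ := by field_simp
  rw [hdec]
  -- The constant is 14 = 2(1 + 6): high part plus low part, with the 6 coming from `freq_le`.
  nlinarith [sq_nonneg (inner ℝ z (hilbertT e - wl) + inner ℝ z (primL ql))]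

/-- Functions in `H^m(I; H)` which vanish at `0`. -/
def IsZeroSobolev (m : ℕ) (v : L2I H) : Prop :=
  ∃ (a : ℕ → H) (q : L2I H),
    v = ∑ k ∈ Finset.Ico 1 m, tens (monoL k) (a k) + (primL ^ m) q

/-- The spline operator in time with its stability and approximation properties. -/
theorem exists_timeOp {d r : ℕ} (hd : 2 ≤ d) (hr : r + 2 ≤ d) {u g : L2I H}
    (hu : IsZeroSobolev d u) (hu' : sinEnergy u < ⊤) (hg : IsZeroSobolev (d - 1) g) :
    ∃ C : ℝ, 0 < C ∧ ∀ N : ℕ, 1 ≤ N → ∃ (ι : Type) (_ : Fintype ι) (φ χ : ι → L2I ℝ),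
      (∀ i, φ i ∈ splineSub d r N) ∧
      (∀ v : L2I H, sinEnergy (finOp φ χ v) ≤ ENNReal.ofReal C * sinEnergy v) ∧
      sinEnergy (u - finOp φ χ u) ≤ ENNReal.ofReal (C / (N : ℝ) ^ (2 * d - 1)) ∧
      ∀ e : L2I H, sinEnergy e < ⊤ →
        inner ℝ (g - finOp φ χ g) (hilbertT e) ^ 2 ≤ C / (N : ℝ) ^ (2 * d - 1) * energy e := by
  obtain ⟨a, q, hu⟩ := hu
  obtain ⟨b, q', hg⟩ := hg
  obtain ⟨C₀, hC₀, hop⟩ := exists_timeOp_aux (H := H) hd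
  obtain ⟨C₁, hC₁, henergy⟩ := exists_energy_sub_le (H := H) d hd C₀ hC₀
  obtain ⟨C₂, hC₂, hstab⟩ := exists_sinEnergy_finOp_le (H := H) d hd C₀ hC₀
  obtain ⟨A, hA, happ⟩ := exists_spline_approx (H := H) (M := d - 1) hd (by omega)
  obtain ⟨A', hA', happ'⟩ := exists_spline_approx (H := H) (M := d - 2) hd (by omega)
  rw [show d - 1 + 1 = d by omega] at happ
  rw [show d - 2 + 1 = d - 1 by omega] at happ'
  set Cu := C₁ * (A * A + A ^ 2) * ‖q‖ ^ 2 with hCu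
  set Cg := 14 * (C₀ * A' * ‖q'‖) ^ 2 with hCg
  -- Covers the finitely many meshes with N < d + 2, on which the zero operator is used and the rate
  -- is hidden in (d + 2)^{2d-1}.
  set Cs := (energy u + ‖g‖ ^ 2) * ((d : ℝ) + 2) ^ (2 * d - 1) with hCs
  have hEu := energy_nonneg u
  have hCs0 : 0 ≤ Cs := by positivity
  have hCu0 : 0 ≤ Cu := by positivity
  have hCg0 : 0 ≤ Cg := by positivity
  refine ⟨1 + C₂ + Cu + Cg + Cs, by positivity, fun N hN => ?_⟩
  have hN' : (0 : ℝ) < N := by exact_mod_cast hN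
  rcases le_or_gt (d + 2) N with hdN | hdN
  · obtain ⟨ι, hι, φ, χ, hφ, hv⟩ := hop N hdN
    have hmem : ∀ v : L2I H, finOp φ χ v ∈ tensSub H (approxSub d N) := fun v =>
      Submodule.sum_mem _ fun i _ => tens_mem_tensSub (hφ i) _
    refine ⟨ι, hι, φ, χ, fun i => approxSub_le hN hr (hφ i), fun v => ?_, ?_, fun e he => ?_⟩
    · refine (hstab N hN ι φ χ hφ (fun v s hs => ((hv v).2 s hs).1) v).trans ?_
      gcongr
      linarith
    · obtain ⟨s, hs1, s', hs2, hs3, hs4⟩ := happ N hN q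
      -- The Taylor polynomial has no constant term, so it is itself a spline; only the remainder
      -- has to be approximated.
      have hpoly : ∑ k ∈ Finset.Ico 1 d, tens (monoL k) (a k) ∈ tensSub H (approxSub d N) :=
        Submodule.sum_mem _ fun k hk => tens_mem_tensSub
          (monoL_mem_approxSub (Finset.mem_Ico.1 hk).2 (Finset.mem_Ico.1 hk).1) _
      set S := ∑ k ∈ Finset.Ico 1 d, tens (monoL k) (a k) + s with hS
      have hSm : S ∈ tensSub H (approxSub d N) := Submodule.add_mem _ hpoly hs1
      have huS : u - S = (primL ^ d) q - s := by rw [hu, hS]; abel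
      have hprim : IsPrim (u - S) ((primL ^ (d - 1)) q - s') := by
        rw [huS]
        refine IsPrim.sub ?_ hs2
        have : (primL ^ d) q = primL ((primL ^ (d - 1)) q) := by
          rw [← Module.End.mul_apply, ← pow_succ', show d - 1 + 1 = d by omega]
        rw [this]
        exact isPrim_primL _
      refine (henergy N hN u _ S _ hSm (hmem u) ((hv u).2 S hSm).1 hprim).trans ?_
      refine ENNReal.ofReal_le_ofReal ?_
      rw [huS]
      have hpow : (N : ℝ) ^ (2 * d - 1) = N ^ d * N ^ (d - 1) := by
        rw [← pow_add]; congr 1; omega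
      have hpow2 : (N : ℝ) ^ d = N ^ (d - 1) * N := by
        rw [← pow_succ]; congr 1; omega
      calc _ ≤ C₁ * ((A / (N : ℝ) ^ d * ‖q‖) * (A / (N : ℝ) ^ (d - 1) * ‖q‖) +
            N * (A / (N : ℝ) ^ d * ‖q‖) ^ 2) := by gcongr
        _ = Cu / (N : ℝ) ^ (2 * d - 1) := by
            rw [hCu, hpow, hpow2]
            field_simp
        _ ≤ _ := by gcongr; linarith
    · obtain ⟨s, hs1, s', hs2, hs3, -⟩ := happ' N hN q'
      have hpoly : ∑ k ∈ Finset.Ico 1 (d - 1), tens (monoL k) (b k) ∈ tensSub H (approxSub d N) :=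
        Submodule.sum_mem _ fun k hk => tens_mem_tensSub
          (monoL_mem_approxSub (by have := (Finset.mem_Ico.1 hk).2; omega)
            (Finset.mem_Ico.1 hk).1) _
      set S := ∑ k ∈ Finset.Ico 1 (d - 1), tens (monoL k) (b k) + s with hS
      have hSm : S ∈ tensSub H (approxSub d N) := Submodule.add_mem _ hpoly hs1
      have hgS : ‖g - S‖ ≤ A' / (N : ℝ) ^ (d - 1) * ‖q'‖ := by
        have : g - S = (primL ^ (d - 1)) q' - s := by rw [hg, hS]; abel
        rw [this]; exact hs3
      -- The residual is O(N^{-(d-1)}) in L² and gains a further 1/N against primitives; the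
      -- negative-norm estimate combines the two into N^{-(2d-1)} for the square.
      obtain ⟨h1, h2⟩ := (hv g).2 S hSm
      have h3 := inner_hilbertT_sq_le hN (z := g - finOp φ χ g) (e := e)
        (δ := C₀ * (A' / (N : ℝ) ^ (d - 1) * ‖q'‖)) he (hv g).1
        (h1.trans (by gcongr)) (fun x => (h2 x).trans (by
          calc C₀ / N * ‖g - S‖ * ‖x‖ ≤ C₀ / N * (A' / (N : ℝ) ^ (d - 1) * ‖q'‖) * ‖x‖ := by gcongr
            _ = _ := by ring))
      refine h3.trans ?_
      have hpow : (N : ℝ) ^ (2 * d - 1) = (N ^ (d - 1)) ^ 2 * N := by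
        rw [← pow_mul, ← pow_succ]; congr 1; omega
      have he0 := energy_nonneg e
      calc _ = Cg / (N : ℝ) ^ (2 * d - 1) * energy e := by
            rw [hCg, hpow]; field_simp
        _ ≤ _ := by gcongr; linarith
  · have hzero : ∀ v : L2I H, finOp (fun i : Fin 0 => (0 : L2I ℝ)) (fun i => 0) v = 0 := fun v => by
      unfold finOp; simp
    have hCsN : (energy u + ‖g‖ ^ 2) ≤ Cs / (N : ℝ) ^ (2 * d - 1) := by
      rw [le_div_iff₀ (by positivity), hCs]
      gcongr
      exact_mod_cast hdN.le
    have hle : Cs / (N : ℝ) ^ (2 * d - 1) ≤ (1 + C₂ + Cu + Cg + Cs) / (N : ℝ) ^ (2 * d - 1) := by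
      gcongr; linarith
    refine ⟨Fin 0, inferInstance, fun _ => 0, fun _ => 0, fun i => i.elim0, fun v => ?_, ?_,
      fun e he => ?_⟩
    · rw [hzero]
      have : sinEnergy (0 : L2I H) = 0 := by
        unfold sinEnergy
        simp [sinCoeff_eq, coef_zero]
      rw [this]; exact bot_le
    · rw [hzero, sub_zero, sinEnergy_eq hu']
      refine ENNReal.ofReal_le_ofReal (le_trans ?_ hle)
      refine le_trans ?_ hCsN
      have := sq_nonneg ‖g‖
      linarith
    · rw [hzero, sub_zero]
      have hs := (sinEnergy_lt_top_iff e).1 he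
      have h1 := norm_sub_low_sq_le orthonormal_cosL (hasSum_hilbertT e) hs 0
      rw [Finset.range_zero, Finset.sum_empty, sub_zero] at h1
      have h2 : ‖hilbertT e‖ ^ 2 ≤ energy e := by
        have h3 : 1 ≤ freq 0 := by
          unfold freq
          have := Real.pi_gt_three
          simp; linarith
        refine le_trans ?_ h1
        exact le_mul_of_one_le_left (by positivity) h3
      have h4 := abs_real_inner_le_norm g (hilbertT e)
      have he0 := energy_nonneg e
      calc _ ≤ (‖g‖ * ‖hilbertT e‖) ^ 2 := sq_le_sq' (abs_le.1 h4).1 (abs_le.1 h4).2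
        _ = ‖g‖ ^ 2 * ‖hilbertT e‖ ^ 2 := by ring
        _ ≤ (energy u + ‖g‖ ^ 2) * energy e := by gcongr; linarith
        _ ≤ _ := by gcongr; exact hCsN.trans hle

end TimeOperator

/-! ### The elliptic form as a bounded operator, and density of H¹_Γ(Ω) in L²(Ω). -/

section Elliptic

variable {n : ℕ} {Ω Γ : Set (Eu n)} {A : Eu n → Matrix (Fin n) (Fin n) ℝ}

lemma norm_toLp_mulVec_le {B : Matrix (Fin n) (Fin n) ℝ} {M : ℝ} (hB : ∀ i j, |B i j| ≤ M)
    (v : Eu n) : ‖(WithLp.toLp 2 (Matrix.mulVec B v.ofLp) : Eu n)‖ ≤ n * (n * M) * ‖v‖ := by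
  have hcoord : ∀ i, ‖(Matrix.mulVec B v.ofLp) i‖ ≤ n * M * ‖v‖ := fun i => by
    have hM : 0 ≤ M := (abs_nonneg _).trans (hB i i)
    calc ‖(Matrix.mulVec B v.ofLp) i‖ ≤ ∑ j, ‖B i j * v.ofLp j‖ :=
          norm_sum_le Finset.univ fun j => B i j * v.ofLp j
      _ ≤ ∑ _j : Fin n, M * ‖v‖ := by
          refine Finset.sum_le_sum fun j _ => ?_
          rw [norm_mul]
          exact mul_le_mul (hB i j) (PiLp.norm_apply_le v j) (norm_nonneg _) hM
      _ = n * M * ‖v‖ := by simp; ring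
  have h : (WithLp.toLp 2 (Matrix.mulVec B v.ofLp) : Eu n) =
      ∑ i, (Matrix.mulVec B v.ofLp) i • EuclideanSpace.single i (1 : ℝ) := by
    ext i
    simp [Finset.sum_apply, Pi.single_apply]
  rw [h]
  refine (norm_sum_le _ _).trans ?_
  calc _ ≤ ∑ _i : Fin n, n * M * ‖v‖ := by
        refine Finset.sum_le_sum fun i _ => ?_
        rw [norm_smul, PiLp.norm_single, norm_one, mul_one]
        exact hcoord i
    _ = _ := by simp; ring

lemma IsDiffusionCoefficient.aestronglyMeasurable_mulVec (hA : IsDiffusionCoefficient Ω A)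
    (G : L2Vec Ω) :
    AEStronglyMeasurable (fun x => (WithLp.toLp 2 (Matrix.mulVec (A x) (G x).ofLp) : Eu n))
      (volume.restrict Ω) := by
  have h : AEMeasurable (fun x => Matrix.mulVec (A x) (G x).ofLp) (volume.restrict Ω) := by
    refine aemeasurable_pi_lambda _ fun i => ?_
    have hsum : (fun x => Matrix.mulVec (A x) (G x).ofLp i) =
        fun x => ∑ j, A x i j * (G x).ofLp j := rfl
    rw [hsum]
    refine Finset.aemeasurable_fun_sum _ fun j _ => ?_
    refine (hA.measurable i j).aemeasurable.mul ?_
    exact ((EuclideanSpace.proj (𝕜 := ℝ) j).continuous.measurable).comp_aemeasurable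
      (Lp.aestronglyMeasurable G).aemeasurable
  exact ((WithLp.measurable_toLp 2 _).comp_aemeasurable h).aestronglyMeasurable

/-- Multiplication by the diffusion coefficient is a bounded operator on `L²(Ω)ⁿ`. -/
lemma IsDiffusionCoefficient.exists_mulVecL (hA : IsDiffusionCoefficient Ω A) :
    ∃ T : L2Vec Ω →L[ℝ] L2Vec Ω, ∀ G : L2Vec Ω,
      ∀ᵐ x ∂(volume.restrict Ω), T G x = WithLp.toLp 2 (Matrix.mulVec (A x) (G x).ofLp) := by
  obtain ⟨M, hM⟩ := hA.bounded
  have hbound : ∀ G : L2Vec Ω, ∀ᵐ x ∂(volume.restrict Ω),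
      ‖(WithLp.toLp 2 (Matrix.mulVec (A x) (G x).ofLp) : Eu n)‖ ≤ n * (n * M) * ‖G x‖ := fun G =>
    hM.mono fun x hx => norm_toLp_mulVec_le hx (G x)
  have hmem : ∀ G : L2Vec Ω, MemLp
      (fun x => (WithLp.toLp 2 (Matrix.mulVec (A x) (G x).ofLp) : Eu n)) 2 (volume.restrict Ω) :=
    fun G => MemLp.of_le_mul (Lp.memLp G) (hA.aestronglyMeasurable_mulVec G) (hbound G)
  let T₀ : L2Vec Ω →ₗ[ℝ] L2Vec Ω :=
    { toFun := fun G => (hmem G).toLp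
      map_add' := fun G F => by
        apply Lp.ext
        filter_upwards [(hmem (G + F)).coeFn_toLp, (hmem G).coeFn_toLp, (hmem F).coeFn_toLp,
          Lp.coeFn_add G F, Lp.coeFn_add ((hmem G).toLp) ((hmem F).toLp)] with x h1 h2 h3 h4 h5
        rw [h1, h5, Pi.add_apply, h2, h3, h4, Pi.add_apply, WithLp.ofLp_add, Matrix.mulVec_add,
          WithLp.toLp_add]
      map_smul' := fun c G => by
        apply Lp.ext
        filter_upwards [(hmem (c • G)).coeFn_toLp, (hmem G).coeFn_toLp, Lp.coeFn_smul c G,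
          Lp.coeFn_smul c ((hmem G).toLp)] with x h1 h2 h3 h4
        rw [h1, RingHom.id_apply, h4, Pi.smul_apply, h2, h3, Pi.smul_apply, WithLp.ofLp_smul,
          Matrix.mulVec_smul, WithLp.toLp_smul] }
  refine ⟨T₀.mkContinuous (n * (n * M)) fun G => ?_, fun G => (hmem G).coeFn_toLp⟩
  refine Lp.norm_le_mul_norm_of_ae_le_mul ?_
  filter_upwards [(hmem G).coeFn_toLp, hbound G] with x h1 h2
  exact (congrArg norm h1).trans_le h2

/-- The bilinear form `⟨A ∇z, ∇w⟩` is represented by a bounded operator on `H¹_Γ(Ω)`. -/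
lemma IsDiffusionCoefficient.exists_ellipticL (hA : IsDiffusionCoefficient Ω A) :
    ∃ L : H1D Ω Γ →L[ℝ] H1D Ω Γ, ∀ z w : H1D Ω Γ, aForm A z w = inner ℝ (L z) w := by
  obtain ⟨T, hT⟩ := hA.exists_mulVecL
  refine ⟨(ContinuousLinearMap.adjoint (grad Ω Γ)).comp (T.comp (grad Ω Γ)), fun z w => ?_⟩
  rw [ContinuousLinearMap.comp_apply, ContinuousLinearMap.adjoint_inner_left, L2.inner_def, aForm]
  refine integral_congr_ae ?_
  filter_upwards [hT (grad Ω Γ z)] with x hx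
  rw [ContinuousLinearMap.comp_apply, hx, real_inner_comm, EuclideanSpace.inner_eq_star_dotProduct]
  simp

lemma IsDiffusionCoefficient.aForm_symm (hA : IsDiffusionCoefficient Ω A) (z w : H1D Ω Γ) :
    aForm A z w = aForm A w z := by
  refine integral_congr_ae ?_
  filter_upwards [hA.symm] with x hx
  rw [dotProduct_comm, Matrix.dotProduct_mulVec, ← Matrix.mulVec_transpose, hx.eq]

lemma IsDiffusionCoefficient.aForm_self_nonneg (hA : IsDiffusionCoefficient Ω A) (z : H1D Ω Γ) :
    0 ≤ aForm A z z := by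
  obtain ⟨α, hα, h⟩ := hA.coercive
  refine integral_nonneg_of_ae ?_
  filter_upwards [h] with x hx
  rw [Pi.zero_apply, dotProduct_comm]
  refine le_trans (mul_nonneg hα.le ?_) (hx _)
  exact Finset.sum_nonneg fun i _ => mul_self_nonneg _

lemma aFormQ_eq_inner {L : H1D Ω Γ →L[ℝ] H1D Ω Γ}
    (hL : ∀ z w : H1D Ω Γ, aForm A z w = inner ℝ (L z) w) (u w : L2I (H1D Ω Γ)) :
    aFormQ A u w = inner ℝ (L.compLp u) w := by
  rw [L2.inner_def, aFormQ]
  refine integral_congr_ae ?_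
  filter_upwards [L.coeFn_compLp u] with t ht
  rw [ht, hL]

lemma IsEllipticImage.inner_eq {u : L2I (H1D Ω Γ)} {g : L2I (L2 Ω)} (h : IsEllipticImage A u g)
    {L : H1D Ω Γ →L[ℝ] H1D Ω Γ} (hL : ∀ z w : H1D Ω Γ, aForm A z w = inner ℝ (L z) w)
    (w : L2I (H1D Ω Γ)) : inner ℝ (L.compLp u) w = inner ℝ g (toL2Q w) := by
  rw [← aFormQ_eq_inner hL, h w, L2.inner_def]

lemma IsFace.subset_frontier {F : Set (Eu n)} (hF : IsFace Ω F) : F ⊆ frontier Ω := by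
  obtain ⟨H, -, x, -, rfl⟩ := hF
  refine closure_minimal ?_ isClosed_frontier
  refine (connectedComponentIn_subset _ _).trans ?_
  rintro y ⟨hy, ε, hε, hsub⟩
  exact hsub ⟨Metric.mem_ball_self hε, hy⟩

lemma IsDirichletPart.subset_frontier (hΓ : IsDirichletPart Ω Γ) : Γ ⊆ frontier Ω := by
  obtain ⟨𝓕, -, -, hF, rfl⟩ := hΓ
  exact sUnion_subset fun F h => (hF F h).subset_frontier

/-- Smooth functions with compact support in `Ω` belong to `H¹_Γ(Ω)`. -/
lemma exists_toL2_eq_of_contDiff (hΩ : IsOpen Ω) (hΓ : IsDirichletPart Ω Γ) {φ : Eu n → ℝ}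
    (h1 : ContDiff ℝ ∞ φ) (h2 : HasCompactSupport φ) (h3 : tsupport φ ⊆ Ω) :
    ∃ z : H1D Ω Γ, ⇑(toL2 Ω Γ z) =ᵐ[volume.restrict Ω] φ := by
  have hm1 : MemLp φ 2 (volume.restrict Ω) := h1.continuous.memLp_of_hasCompactSupport h2
  have hgc : Continuous (gradient φ) :=
    (InnerProductSpace.toDual ℝ (Eu n)).symm.continuous.comp (h1.continuous_fderiv (by simp))
  have hgs : HasCompactSupport (gradient φ) :=
    (h2.fderiv ℝ).comp_left (g := (InnerProductSpace.toDual ℝ (Eu n)).symm) (map_zero _)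
  have hm2 : MemLp (gradient φ) 2 (volume.restrict Ω) := hgc.memLp_of_hasCompactSupport hgs
  have hdisj : Disjoint (tsupport φ) Γ := by
    rw [Set.disjoint_left]
    intro x hx hxΓ
    have := hΓ.subset_frontier hxΓ
    rw [hΩ.frontier_eq] at this
    exact this.2 (h3 hx)
  refine ⟨⟨WithLp.toLp 2 (hm1.toLp, hm2.toLp), subset_closure (Submodule.subset_span
    ⟨φ, h1, h2, hdisj, hm1.coeFn_toLp, hm2.coeFn_toLp⟩)⟩, hm1.coeFn_toLp⟩

/-- The range of the embedding `H¹_Γ(Ω) → L²(Ω)` is dense. -/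
lemma eq_zero_of_inner_toL2 (hΩ : IsOpen Ω) (hΓ : IsDirichletPart Ω Γ) {a : L2 Ω}
    (ha : ∀ w : H1D Ω Γ, inner ℝ a (toL2 Ω Γ w) = 0) : a = 0 := by
  have hloc : LocallyIntegrableOn (⇑a) Ω (volume.restrict Ω) :=
    ((Lp.memLp a).locallyIntegrable (by norm_num)).locallyIntegrableOn Ω
  have h := hΩ.ae_eq_zero_of_integral_contDiff_smul_eq_zero hloc (fun φ h1 h2 h3 => by
    obtain ⟨z, hz⟩ := exists_toL2_eq_of_contDiff hΩ hΓ h1 h2 h3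
    rw [← ha z, L2.inner_def]
    refine integral_congr_ae ?_
    filter_upwards [hz] with x hx
    rw [hx, smul_eq_mul, RCLike.inner_apply, conj_trivial])
  apply Lp.ext
  filter_upwards [h, ae_restrict_mem hΩ.measurableSet, Lp.coeFn_zero ℝ 2 (volume.restrict Ω)]
    with x h1 h2 h3
  rw [h1 h2, h3, Pi.zero_apply]

end Elliptic

/-! ### Functions of finite H^{1/2}_{0,}-norm vanish at the initial time. -/

section InitialValues

variable {H : Type*} [NormedAddCommGroup H] [InnerProductSpace ℝ H] [CompleteSpace H]

lemma inner_sinL_oneL (k : ℕ) : inner ℝ (sinL k) oneL = √2 / freq k := by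
  rw [inner_L2I_of_ae (coeFn_sinL k) coeFn_oneL]
  simp_rw [mul_one]
  rw [intervalIntegral.integral_eq_sub_of_hasDerivAt (fun t _ => hasDerivAt_neg_cosFun_div k t)
    ((continuous_sinFun k).intervalIntegrable _ _), cosFun_one]
  have h0 : cosFun k 0 = √2 := by unfold cosFun; simp
  rw [h0]; simp

/-- Nonzero constants do not belong to `H^{1/2}_{0,}(I; H)`. -/
lemma eq_zero_of_sinEnergy_tens_oneL {a : H} (h : sinEnergy (tens oneL a) < ⊤) : a = 0 := by
  rw [sinEnergy_lt_top_iff] at h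
  by_contra ha
  have hpos : 0 < ‖a‖ := norm_pos_iff.2 ha
  -- The sine coefficients of a constant decay exactly like 1/√λ_k, so the energy is a multiple of ∑
  -- 1/√λ_k and is compared with the harmonic series.
  have heq : ∀ k, freq k * ‖sinCoeff (tens oneL a) k‖ ^ 2 = 2 * ‖a‖ ^ 2 * (freq k)⁻¹ := fun k => by
    have := freq_pos k
    rw [sinCoeff_eq, coef_tens, inner_sinL_oneL, norm_smul, mul_pow, Real.norm_eq_abs, sq_abs,
      div_pow, Real.sq_sqrt zero_le_two]
    field_simp
  simp_rw [heq] at h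
  have h1 : Summable fun k => (freq k)⁻¹ :=
    (summable_mul_left_iff (by positivity : 2 * ‖a‖ ^ 2 ≠ 0)).1 h
  have h2 : Summable fun k : ℕ => 1 / ((k + 1 : ℕ) : ℝ) := by
    refine Summable.of_nonneg_of_le (fun k => by positivity) (fun k => ?_) (h1.mul_left 4)
    have := Real.pi_lt_four
    have hk : freq k ≤ 4 * (k + 1) := by
      unfold freq
      have : (k : ℝ) * Real.pi ≤ k * 4 := by gcongr
      linarith
    have := freq_pos k
    push_cast
    rw [← div_eq_mul_inv, div_le_div_iff₀ (by positivity) this]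
    linarith
  exact Real.not_summable_one_div_natCast ((summable_nat_add_iff 1).1 h2)

lemma exists_isPrim_sum_monoL {m : ℕ} (hm : 1 ≤ m) (a : ℕ → H) (q : L2I H) :
    ∃ x, IsPrim (∑ k ∈ Finset.Ico 1 m, tens (monoL k) (a k) + (primL ^ m) q) x := by
  refine ⟨∑ k ∈ Finset.Ico 1 m, tens (monoL (k - 1)) (a k) + (primL ^ (m - 1)) q, ?_⟩
  refine (IsPrim.sum _ fun k hk => ?_).add ?_
  · obtain ⟨j, rfl⟩ := Nat.exists_eq_add_of_le' (Finset.mem_Ico.1 hk).1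
    exact (isPrim_monoL_succ j).tens _
  · obtain ⟨j, rfl⟩ := Nat.exists_eq_add_of_le' hm
    rw [Nat.add_sub_cancel, pow_succ', Module.End.mul_apply]
    exact isPrim_primL _

lemma IsZeroSobolev.exists_isPrim {m : ℕ} (hm : 1 ≤ m) {v : L2I H} (h : IsZeroSobolev m v) :
    ∃ x, IsPrim v x := by
  obtain ⟨a, q, rfl⟩ := h
  exact exists_isPrim_sum_monoL hm a q

lemma MemSobolevTime.exists_eq_add {m : ℕ} (hm : 1 ≤ m) {v : L2I H} (h : MemSobolevTime m v) :
    ∃ (a : H) (p : L2I H), IsZeroSobolev m p ∧ v = tens oneL a + p := by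
  obtain ⟨a, q, hv⟩ := h.exists_eq
  refine ⟨a 0, _, ⟨a, q, rfl⟩, ?_⟩
  rw [hv, ← monoL_zero, ← add_assoc, Finset.range_eq_Ico, Finset.sum_eq_sum_Ico_succ_bot hm]

/-- Apart from the constant Taylor term, `v` is a primitive and has finite energy; hence the
constant has finite energy as well and must be zero. -/
lemma MemSobolevTime.isZeroSobolev_of_sinEnergy {m : ℕ} (hm : 1 ≤ m) {v : L2I H}
    (h : MemSobolevTime m v) (hv : sinEnergy v < ⊤) : IsZeroSobolev m v := by
  obtain ⟨a, p, hp, rfl⟩ := h.exists_eq_add hm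
  obtain ⟨x, hx⟩ := hp.exists_isPrim hm
  have h1 : sinEnergy p < ⊤ := hx.sinEnergy_le.trans_lt ENNReal.ofReal_lt_top
  have h2 : sinEnergy (tens oneL a) < ⊤ := by
    have h3 := sinEnergy_sub_le (tens oneL a + p) p
    rw [add_sub_cancel_right] at h3
    exact h3.trans_lt (ENNReal.mul_lt_top (by norm_num) (ENNReal.add_lt_top.2 ⟨hv, h1⟩))
  have ha := eq_zero_of_sinEnergy_tens_oneL h2
  have h0 : tens oneL (0 : H) = 0 := by rw [← tensL_apply, map_zero]
  rwa [ha, h0, zero_add]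

/-- Averaging over `(0,ε)`. -/
lemma exists_mean (H : Type*) [NormedAddCommGroup H] [InnerProductSpace ℝ H] [CompleteSpace H]
    {ε : ℝ} (h0 : 0 < ε) (h1 : ε ≤ 1) :
    ∃ χ : L2I ℝ, inner ℝ χ oneL = (1 : ℝ) ∧
      ∀ v q : L2I H, IsPrim v q → ‖coef χ v‖ ≤ √ε * ‖q‖ := by
  have hm : MemLp ((Ioo (0 : ℝ) ε).indicator fun _ => ε⁻¹) 2 timeMeasure :=
    memLp_indicator_const 2 measurableSet_Ioo _ (Or.inr (measure_ne_top _ _))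
  have hint : ∫ t, (Ioo (0 : ℝ) ε).indicator (fun _ => ε⁻¹) t ∂timeMeasure = 1 := by
    rw [integral_indicator measurableSet_Ioo, Measure.restrict_restrict measurableSet_Ioo,
      inter_eq_left.2 (Ioo_subset_Ioo_right h1), setIntegral_const]
    simp [Measure.real, h0.le, h0.ne']
  refine ⟨hm.toLp, ?_, fun v q hvq => ?_⟩
  · rw [L2.inner_def, ← hint]
    refine integral_congr_ae ?_
    filter_upwards [hm.coeFn_toLp, coeFn_oneL] with t h2 h3
    rw [h2, h3]; simp
  · rw [coef_eq_of_ae hm.coeFn_toLp]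
    have h2 : √ε * ‖q‖ = ∫ t, (Ioo (0 : ℝ) ε).indicator (fun _ => ε⁻¹) t * (√ε * ‖q‖)
        ∂timeMeasure := by
      rw [integral_mul_const, hint, one_mul]
    rw [h2]
    refine norm_integral_le_of_norm_le ((hm.integrable (by norm_num)).mul_const _) ?_
    filter_upwards [hvq.norm_le_sqrt] with t ht
    by_cases hmem : t ∈ Ioo (0 : ℝ) ε
    · rw [indicator_of_mem hmem, norm_smul, Real.norm_of_nonneg (by positivity)]
      have : √t ≤ √ε := Real.sqrt_le_sqrt hmem.2.le
      gcongr
      exact ht.trans (by gcongr)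
    · rw [indicator_of_notMem hmem]; simp

lemma sq_inner_le_of_nonneg {V : Type*} [NormedAddCommGroup V] [InnerProductSpace ℝ V]
    (L : V →L[ℝ] V) (hs : ∀ x y, inner ℝ (L x) y = inner ℝ (L y) x)
    (hp : ∀ x, 0 ≤ inner ℝ (L x) x) (x y : V) :
    inner ℝ (L x) y ^ 2 ≤ inner ℝ (L x) x * inner ℝ (L y) y := by
  have h : ∀ s : ℝ, 0 ≤ inner ℝ (L y) y * (s * s) + 2 * inner ℝ (L x) y * s +
      inner ℝ (L x) x := fun s => by
    have h1 := hp (x + s • y)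
    rw [map_add, map_smul, inner_add_left, inner_add_right, inner_add_right, real_inner_smul_left,
      real_inner_smul_left, real_inner_smul_right, real_inner_smul_right, hs y x] at h1
    linarith
  have h2 := discrim_le_zero h
  unfold discrim at h2
  linarith

end InitialValues

/-! ### The elliptic image inherits the zero initial value. -/

section InitialElliptic

variable {n : ℕ} {Ω Γ : Set (Eu n)} {A : Eu n → Matrix (Fin n) (Fin n) ℝ}

/-- If `u` vanishes at the initial time, so does `ℒ_x u`. -/
lemma IsEllipticImage.isZeroSobolev (hΩ : IsOpen Ω) (hΓ : IsDirichletPart Ω Γ)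
    {u : L2I (H1D Ω Γ)} {g : L2I (L2 Ω)} (h : IsEllipticImage A u g)
    {L : H1D Ω Γ →L[ℝ] H1D Ω Γ} (hL : ∀ z w : H1D Ω Γ, aForm A z w = inner ℝ (L z) w)
    (hs : ∀ x y, inner ℝ (L x) y = inner ℝ (L y) x) (hp : ∀ x, 0 ≤ inner ℝ (L x) x)
    {x : L2I (L2 Ω)} (hu : IsPrim (toL2Q u) x) {m : ℕ} (hm : 1 ≤ m) (hg : MemSobolevTime m g) :
    IsZeroSobolev m g := by
  obtain ⟨a, p, hp0, rfl⟩ := hg.exists_eq_add hm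
  obtain ⟨y, hy⟩ := hp0.exists_isPrim hm
  have ha : a = 0 := by
    refine eq_zero_of_inner_toL2 hΩ hΓ fun w => ?_
    -- Let U be the mean of `u` over (0,ε). Then ⟨LU, U⟩ is the L²(Ω) product of the means of `g`
    -- and `u`, and the latter is O(√ε). Cauchy–Schwarz for the semidefinite form then makes ⟨LU, w⟩
    -- small for fixed w, with no separate bound on ∇U; but ⟨LU, w⟩ also tends to ⟨a, w⟩.
    have key : ∀ ε : ℝ, 0 < ε → ε ≤ 1 → |inner ℝ a (toL2 Ω Γ w)| ≤
        √ε * ‖y‖ * ‖toL2 Ω Γ w‖ +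
          √((‖a‖ + √ε * ‖y‖) * (√ε * ‖x‖) * inner ℝ (L w) w) := by
      intro ε h0 h1
      obtain ⟨χ, hχ1, hχ2⟩ := exists_mean (L2 Ω) h0 h1
      have hcg : coef χ (tens oneL a + p) = a + coef χ p := by
        rw [coef_add, coef_tens, hχ1, one_smul]
      have hLU : ∀ w : H1D Ω Γ, inner ℝ (L (coef χ u)) w =
          inner ℝ (a + coef χ p) (toL2 Ω Γ w) := fun w => by
        rw [← coef_compLp, ← inner_tens_right, h.inner_eq hL, toL2Q, compLp_tens, inner_tens_right,
          hcg]
      have hU : toL2 Ω Γ (coef χ u) = coef χ (toL2Q u) := (coef_compLp _ _ _).symm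
      have hcp := hχ2 p y hy
      have hcu := hχ2 _ x hu
      have hUU : inner ℝ (L (coef χ u)) (coef χ u) ≤ (‖a‖ + √ε * ‖y‖) * (√ε * ‖x‖) := by
        rw [hLU, hU]
        refine (real_inner_le_norm _ _).trans ?_
        have := norm_add_le a (coef χ p)
        gcongr
        linarith
      have h2 : |inner ℝ (L (coef χ u)) w| ≤
          √((‖a‖ + √ε * ‖y‖) * (√ε * ‖x‖) * inner ℝ (L w) w) := by
        refine Real.abs_le_sqrt ((sq_inner_le_of_nonneg L hs hp _ _).trans ?_)
        exact mul_le_mul_of_nonneg_right hUU (hp w)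
      have h3 : inner ℝ a (toL2 Ω Γ w) =
          inner ℝ (L (coef χ u)) w - inner ℝ (coef χ p) (toL2 Ω Γ w) := by
        rw [hLU, inner_add_left]; ring
      have h4 : |inner ℝ (coef χ p) (toL2 Ω Γ w)| ≤ √ε * ‖y‖ * ‖toL2 Ω Γ w‖ :=
        (abs_real_inner_le_norm _ _).trans (by gcongr)
      rw [h3]
      exact (abs_sub _ _).trans (by linarith)
    have hlim : Tendsto (fun ε : ℝ => √ε * ‖y‖ * ‖toL2 Ω Γ w‖ +
          √((‖a‖ + √ε * ‖y‖) * (√ε * ‖x‖) * inner ℝ (L w) w)) (𝓝[>] 0) (𝓝 0) := by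
      have hc : Continuous (fun ε : ℝ => √ε * ‖y‖ * ‖toL2 Ω Γ w‖ +
          √((‖a‖ + √ε * ‖y‖) * (√ε * ‖x‖) * inner ℝ (L w) w)) := by fun_prop
      have := hc.tendsto 0
      simp only [Real.sqrt_zero, zero_mul, mul_zero, add_zero] at this
      exact this.mono_left nhdsWithin_le_nhds
    have hle := ge_of_tendsto hlim (b := |inner ℝ a (toL2 Ω Γ w)|) (by
      filter_upwards [Ioc_mem_nhdsGT (zero_lt_one' ℝ)] with ε hε
      exact key ε hε.1 hε.2)
    exact abs_eq_zero.1 (le_antisymm hle (abs_nonneg _))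
  have h0 : tens oneL (0 : L2 Ω) = 0 := by rw [← tensL_apply, map_zero]
  rwa [ha, h0, zero_add]

end InitialElliptic

/-! ### The pairing ⟨∂_t v, ℋ_T e⟩ as an inner product. -/

section Pairing

variable {H : Type*} [NormedAddCommGroup H] [InnerProductSpace ℝ H] [CompleteSpace H]

lemma inner_sub_left_L2I (v w z : L2I H) : inner ℝ (v - w) z = inner ℝ v z - inner ℝ w z :=
  inner_sub_left v w z

lemma normZeroRight_hilbertT (v : L2I H) : normZeroRight (hilbertT v) = normZeroLeft v := by
  unfold normZeroRight normZeroLeft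
  simp_rw [cosCoeff_hilbertT]

lemma timePairing_hilbertT (v e : L2I H) :
    timePairing v (hilbertT e) = ∑' k, freq k * inner ℝ (sinCoeff v k) (sinCoeff e k) := by
  unfold timePairing
  simp_rw [cosCoeff_hilbertT]

lemma timePairing_hilbertT_self (e : L2I H) : timePairing e (hilbertT e) = energy e := by
  rw [timePairing_hilbertT, energy]
  simp_rw [real_inner_self_eq_norm_sq]

lemma summable_timePairing {v e : L2I H} (hv : sinEnergy v < ⊤) (he : sinEnergy e < ⊤) :
    Summable fun k => freq k * inner ℝ (sinCoeff v k) (sinCoeff e k) := by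
  refine Summable.of_norm_bounded
    (((sinEnergy_lt_top_iff v).1 hv).add ((sinEnergy_lt_top_iff e).1 he)) fun k => ?_
  rw [norm_mul, Real.norm_of_nonneg (freq_pos k).le, ← mul_add]
  refine mul_le_mul_of_nonneg_left ?_ (freq_pos k).le
  refine (norm_inner_le_norm _ _).trans ?_
  nlinarith [sq_nonneg (‖sinCoeff v k‖ - ‖sinCoeff e k‖), sq_nonneg ‖sinCoeff v k‖,
    sq_nonneg ‖sinCoeff e k‖]

lemma timePairing_hilbertT_add {v w e : L2I H} (hv : sinEnergy v < ⊤) (hw : sinEnergy w < ⊤)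
    (he : sinEnergy e < ⊤) : timePairing (v + w) (hilbertT e) =
      timePairing v (hilbertT e) + timePairing w (hilbertT e) := by
  simp_rw [timePairing_hilbertT]
  rw [← (summable_timePairing hv he).tsum_add (summable_timePairing hw he)]
  refine tsum_congr fun k => ?_
  rw [sinCoeff_add, inner_add_left, mul_add]

lemma timePairing_hilbertT_sq_le {v e : L2I H} (hv : sinEnergy v < ⊤) (he : sinEnergy e < ⊤) :
    timePairing v (hilbertT e) ^ 2 ≤ energy v * energy e := by
  have hp := (summable_timePairing hv he).hasSum
  rw [← timePairing_hilbertT] at hp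
  have hvs : HasSum (fun k => freq k * ‖sinCoeff v k‖ ^ 2) (energy v) :=
    ((sinEnergy_lt_top_iff v).1 hv).hasSum
  have hes : HasSum (fun k => freq k * ‖sinCoeff e k‖ ^ 2) (energy e) :=
    ((sinEnergy_lt_top_iff e).1 he).hasSum
  have h : ∀ s : ℝ, 0 ≤ energy e * (s * s) + 2 * timePairing v (hilbertT e) * s + energy v := by
    intro s
    have h1 := ((hes.mul_right (s * s)).add ((hp.mul_left 2).mul_right s)).add hvs
    refine h1.nonneg fun k => ?_
    have h2 : freq k * ‖sinCoeff e k‖ ^ 2 * (s * s) +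
        2 * (freq k * inner ℝ (sinCoeff v k) (sinCoeff e k)) * s + freq k * ‖sinCoeff v k‖ ^ 2 =
        freq k * ‖sinCoeff v k + s • sinCoeff e k‖ ^ 2 := by
      rw [norm_add_sq_real, norm_smul, real_inner_smul_right, mul_pow, Real.norm_eq_abs, sq_abs]
      ring
    rw [h2]
    exact mul_nonneg (freq_pos k).le (by positivity)
  have h2 := discrim_le_zero h
  unfold discrim at h2
  linarith

end Pairing

/-! ### Galerkin orthogonality and the discrete error. -/

section Galerkin

variable {n : ℕ} {Ω Γ : Set (Eu n)} {A : Eu n → Matrix (Fin n) (Fin n) ℝ}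

lemma toL2Q_add (v w : L2I (H1D Ω Γ)) : toL2Q (v + w) = toL2Q v + toL2Q w := compLp_add _ v w

lemma toL2Q_sub (v w : L2I (H1D Ω Γ)) : toL2Q (v - w) = toL2Q v - toL2Q w := compLp_sub _ v w

lemma memLp_of_mem_temporalSpace {d r N : ℕ} {φ : ℝ → ℝ} (hφ : φ ∈ temporalSpace d r N) :
    MemLp φ 2 timeMeasure := by
  have hc : ContinuousOn φ (Icc 0 1) := hφ.1.continuousOn
  obtain ⟨M, hM⟩ := isCompact_Icc.exists_bound_of_continuousOn hc
  exact memLp_of_bound_on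
    ((hc.mono Ioo_subset_Icc_self).aestronglyMeasurable measurableSet_Ioo) M
    fun t ht => hM t (Ioo_subset_Icc_self ht)

lemma tens_mem_trialSpace {d r N p : ℕ} {K : Geometry.SimplicialComplex ℝ (Eu n)} {φ : L2I ℝ}
    (hφ : φ ∈ splineSub d r N) {s : H1D Ω Γ} (hs : s ∈ spatialSpace Ω Γ K p) :
    tens φ s ∈ trialSpace Ω Γ d r N K p := by
  obtain ⟨f, hf, hφf⟩ := mem_splineSub.1 hφ
  refine Submodule.subset_span ⟨f, hf, s, hs, ?_⟩
  filter_upwards [coeFn_tens φ s, hφf] with t h1 h2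
  rw [h1, h2]

lemma trialSpace_induction {d r N p : ℕ} {K : Geometry.SimplicialComplex ℝ (Eu n)}
    {q : Submodule ℝ (L2I (H1D Ω Γ))}
    (h : ∀ φ ∈ splineSub d r N, ∀ s ∈ spatialSpace Ω Γ K p, tens φ s ∈ q) :
    trialSpace Ω Γ d r N K p ≤ q := by
  refine Submodule.span_le.2 ?_
  rintro v ⟨φ, hφ, s, hs, hv⟩
  have hm := memLp_of_mem_temporalSpace hφ
  have : v = tens hm.toLp s := by
    apply Lp.ext
    filter_upwards [hv, coeFn_tens hm.toLp s, hm.coeFn_toLp] with t h1 h2 h3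
    rw [h1, h2, h3]
  rw [this]
  exact h _ (mem_splineSub.2 ⟨φ, hφ, hm.coeFn_toLp⟩) s hs

lemma exists_isPrim_of_mem_trialSpace {d r N p : ℕ} {K : Geometry.SimplicialComplex ℝ (Eu n)}
    (hN : 1 ≤ N) {v : L2I (H1D Ω Γ)} (hv : v ∈ trialSpace Ω Γ d r N K p) :
    ∃ x, IsPrim v x := by
  let q : Submodule ℝ (L2I (H1D Ω Γ)) :=
    { carrier := {v | ∃ x, IsPrim v x}
      zero_mem' := ⟨0, isPrim_zero⟩
      add_mem' := by rintro v w ⟨x, hx⟩ ⟨y, hy⟩; exact ⟨x + y, hx.add hy⟩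
      smul_mem' := by rintro c v ⟨x, hx⟩; exact ⟨c • x, hx.smul c⟩ }
  refine trialSpace_induction (q := q) (fun φ hφ s _ => ?_) hv
  obtain ⟨C, -, h⟩ := exists_isPrim_of_mem_splineSub d
  obtain ⟨ψ, hψ, -⟩ := h r N hN φ hφ
  exact ⟨_, hψ.tens s⟩

lemma IsPrim.compLp {H V : Type*} [NormedAddCommGroup H] [InnerProductSpace ℝ H] [CompleteSpace H]
    [NormedAddCommGroup V] [InnerProductSpace ℝ V] [CompleteSpace V] (L : H →L[ℝ] V)
    {v q : L2I H} (h : IsPrim v q) : IsPrim (L.compLp v) (L.compLp q) := by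
  unfold IsPrim at *
  filter_upwards [h, L.coeFn_compLp v, ae_mem_Ioo] with t h1 h2 ht
  rw [h2, h1, ← L.integral_comp_comm (integrable_truncPow_smul 0 ht (integrable_L2I q))]
  refine integral_congr_ae ?_
  filter_upwards [L.coeFn_compLp q] with s hs
  rw [hs, map_smul]

lemma sinEnergy_lt_top_of_mem_trialSpace {d r N p : ℕ}
    {K : Geometry.SimplicialComplex ℝ (Eu n)} (hN : 1 ≤ N) {v : L2I (H1D Ω Γ)}
    (hv : v ∈ trialSpace Ω Γ d r N K p) : sinEnergy (toL2Q v) < ⊤ := by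
  obtain ⟨x, hx⟩ := exists_isPrim_of_mem_trialSpace hN hv
  exact (hx.compLp (toL2 Ω Γ)).sinEnergy_le.trans_lt ENNReal.ofReal_lt_top

lemma sinCoeff_mem_span_of_mem_trialSpace {d r N p : ℕ}
    {K : Geometry.SimplicialComplex ℝ (Eu n)} {v : L2I (H1D Ω Γ)}
    (hv : v ∈ trialSpace Ω Γ d r N K p) (k : ℕ) :
    sinCoeff v k ∈ Submodule.span ℝ (spatialSpace Ω Γ K p) := by
  rw [sinCoeff_eq]
  refine trialSpace_induction
    (q := (Submodule.span ℝ (spatialSpace Ω Γ K p)).comap (coefL (sinL k))) (fun φ _ s hs => ?_) hv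
  rw [Submodule.mem_comap, coefL_apply, coef_tens]
  exact Submodule.smul_mem _ _ (Submodule.subset_span hs)

/-- ℋ_T takes `e` out of the spline space in time, but each mode W_k still carries a coefficient in
the span of S^x. Ritz orthogonality therefore applies mode by mode. -/
lemma IsRitzProjection.inner_hilbertT_eq_zero {d r N p : ℕ}
    {K : Geometry.SimplicialComplex ℝ (Eu n)} {P L : H1D Ω Γ →L[ℝ] H1D Ω Γ}
    (hP : IsRitzProjection A K p P) (hL : ∀ z w : H1D Ω Γ, aForm A z w = inner ℝ (L z) w)
    {e : L2I (H1D Ω Γ)} (he : e ∈ trialSpace Ω Γ d r N K p) (v : L2I (H1D Ω Γ)) :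
    inner ℝ (L.compLp (v - P.compLp v)) (hilbertT e) = 0 := by
  have hz : ∀ z : H1D Ω Γ, ∀ s ∈ Submodule.span ℝ (spatialSpace Ω Γ K p),
      inner ℝ (L (z - P z)) s = 0 := by
    intro z s hs
    induction hs using Submodule.span_induction with
    | mem s hs => rw [map_sub, inner_sub_left, ← hL, ← hL, (hP z).2 s hs, sub_self]
    | zero => rw [inner_zero_right]
    | add x y _ _ hx hy => rw [inner_add_right, hx, hy, add_zero]
    | smul c x _ hx => rw [real_inner_smul_right, hx, mul_zero]
  have h1 := (hasSum_hilbertT e).mapL (innerSL ℝ (L.compLp (v - P.compLp v)))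
  have h2 : ∀ k, innerSL ℝ (L.compLp (v - P.compLp v)) (tens (cosL k) (sinCoeff e k)) = 0 := by
    intro k
    rw [innerSL_apply_apply, inner_tens_right, coef_compLp, coef_sub, coef_compLp]
    exact hz _ _ (sinCoeff_mem_span_of_mem_trialSpace he k)
  simp_rw [h2] at h1
  exact h1.unique hasSum_zero

lemma finOp_compLp_mem_trialSpace {d r N p : ℕ} {K : Geometry.SimplicialComplex ℝ (Eu n)}
    {P : H1D Ω Γ →L[ℝ] H1D Ω Γ} (hP : IsRitzProjection A K p P) {ι : Type*} [Fintype ι]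
    {φ χ : ι → L2I ℝ} (hφ : ∀ i, φ i ∈ splineSub d r N) (u : L2I (H1D Ω Γ)) :
    finOp φ χ (P.compLp u) ∈ trialSpace Ω Γ d r N K p := by
  refine Submodule.sum_mem _ fun i _ => tens_mem_trialSpace (hφ i) ?_
  rw [coef_compLp]
  exact (hP _).1

/-- The energy of the discrete error is controlled by the consistency errors. -/
lemma energy_discrete_error_le {d r N p : ℕ} {K : Geometry.SimplicialComplex ℝ (Eu n)}
    (hN : 1 ≤ N) (hA : IsDiffusionCoefficient Ω A) {L P : H1D Ω Γ →L[ℝ] H1D Ω Γ}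
    (hL : ∀ z w : H1D Ω Γ, aForm A z w = inner ℝ (L z) w)
    (hP : IsRitzProjection A K p P) {f : TestSpace Ω Γ →ₗ[ℝ] ℝ} {u uh : L2I (H1D Ω Γ)}
    (hu : IsWeakSolution A f u) (huh : IsGalerkinSolution A f d r N K p uh)
    {g : L2I (L2 Ω)} (hg : IsEllipticImage A u g) {ι : Type*} [Fintype ι] {φ χ : ι → L2I ℝ}
    (hφ : ∀ i, φ i ∈ splineSub d r N) :
    energy (toL2Q (uh - finOp φ χ (P.compLp u))) ≤
      timePairing (toL2Q u - finOp φ χ (toL2Q (P.compLp u)))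
        (hilbertT (toL2Q (uh - finOp φ χ (P.compLp u)))) +
      inner ℝ (g - finOp φ χ g) (hilbertT (toL2Q (uh - finOp φ χ (P.compLp u)))) := by
  set w := finOp φ χ (P.compLp u) with hw
  set e := uh - w with he
  have hwt : w ∈ trialSpace Ω Γ d r N K p := finOp_compLp_mem_trialSpace hP hφ u
  have het : e ∈ trialSpace Ω Γ d r N K p := Submodule.sub_mem _ huh.1 hwt
  have hes := sinEnergy_lt_top_of_mem_trialSpace hN het
  have hws := sinEnergy_lt_top_of_mem_trialSpace hN hwt
  have hus : sinEnergy (toL2Q u) < ⊤ := (normZeroLeft_lt_top_iff _).1 hu.1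
  have hHe : toL2Q (hilbertT e) = hilbertT (toL2Q e) := compLp_hilbertT _ e
  have htest : hilbertT e ∈ TestSpace Ω Γ := by
    change normZeroRight (toL2Q (hilbertT e)) < ⊤
    rw [hHe, normZeroRight_hilbertT]
    exact (normZeroLeft_lt_top_iff _).2 hes
  -- Galerkin orthogonality. The test function is admissible because the norm of ℋ_T e equals that
  -- of e, and discrete functions have finite energy.
  have hgal : bForm A u (hilbertT e) = bForm A uh (hilbertT e) :=
    (hu.2 ⟨hilbertT e, htest⟩).trans (huh.2 e het ⟨hilbertT e, htest⟩ rfl).symm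
  unfold bForm at hgal
  rw [aFormQ_eq_inner hL, aFormQ_eq_inner hL, hHe] at hgal
  have hww : toL2Q w = finOp φ χ (toL2Q (P.compLp u)) := compLp_finOp φ χ (toL2 Ω Γ) _
  have hds : sinEnergy (toL2Q u - toL2Q w) < ⊤ :=
    (sinEnergy_sub_le _ _).trans_lt
      (ENNReal.mul_lt_top (by norm_num) (ENNReal.add_lt_top.2 ⟨hus, hws⟩))
  have h1 : timePairing (toL2Q u) (hilbertT (toL2Q e)) =
      timePairing (toL2Q u - toL2Q w) (hilbertT (toL2Q e)) +
        timePairing (toL2Q w) (hilbertT (toL2Q e)) := by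
    rw [← timePairing_hilbertT_add hds hws hes, sub_add_cancel]
  have h2 : timePairing (toL2Q uh) (hilbertT (toL2Q e)) =
      energy (toL2Q e) + timePairing (toL2Q w) (hilbertT (toL2Q e)) := by
    rw [← timePairing_hilbertT_self, ← timePairing_hilbertT_add hes hws hes, ← toL2Q_add, he,
      sub_add_cancel]
  have hpos : 0 ≤ inner ℝ (L.compLp e) (hilbertT e) := by
    refine inner_compLp_hilbertT_nonneg L (fun x y => ?_) (fun x => ?_) e
    · rw [← hL, hA.aForm_symm, hL, real_inner_comm]
    · rw [← hL]; exact hA.aForm_self_nonneg x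
  -- Since the operator in time commutes with `P`, w is also the Ritz projection of `finOp φ χ u`,
  -- so P may be dropped in the elliptic term.
  have hPw : w = P.compLp (finOp φ χ u) := (compLp_finOp φ χ P u).symm
  have h3 : inner ℝ (L.compLp u) (hilbertT e) = inner ℝ g (hilbertT (toL2Q e)) := by
    rw [hg.inner_eq hL, hHe]
  -- Move the operator in time to the test function by taking its adjoint, use the elliptic equation
  -- there, and move it back; this replaces L∘Π u by Π g without assuming more regularity of `u`.
  have h4 : inner ℝ (L.compLp (finOp φ χ u)) (hilbertT e) =
      inner ℝ (finOp φ χ g) (hilbertT (toL2Q e)) := by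
    rw [compLp_finOp, inner_finOp_left, hg.inner_eq hL, inner_finOp_left]
    congr 1
    rw [← hHe]
    exact compLp_finOp χ φ (toL2 Ω Γ) _
  have h5 := hP.inner_hilbertT_eq_zero hL het (finOp φ χ u)
  rw [← hPw, compLp_sub] at h5
  rw [inner_sub_left_L2I] at h5
  have h6 : inner ℝ (L.compLp uh) (hilbertT e) =
      inner ℝ (L.compLp e) (hilbertT e) + inner ℝ (L.compLp w) (hilbertT e) := by
    have h := inner_sub_left_L2I (L.compLp uh) (L.compLp w) (hilbertT e)
    rw [← compLp_sub, ← he] at h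
    linarith
  rw [inner_sub_left_L2I, ← hww]
  linarith

lemma meshSize_nonneg (K : Geometry.SimplicialComplex ℝ (Eu n)) : 0 ≤ meshSize K := by
  refine Real.sSup_nonneg ?_
  rintro x ⟨s, -, rfl⟩
  exact Metric.diam_nonneg

end Galerkin

/-- Square the first bound and cancel one factor `E`; here `E` is the energy of the discrete error,
which occurs on both sides. -/
lemma le_two_mul_add_of_le_add {E a b x y : ℝ} (hE : 0 ≤ E) (ha : 0 ≤ a) (hb : 0 ≤ b)
    (h : E ≤ x + y) (hx : x ^ 2 ≤ a * E) (hy : y ^ 2 ≤ b * E) : E ≤ 2 * (a + b) := by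
  rcases hE.eq_or_lt with rfl | hE
  · positivity
  · have h1 : E * E ≤ 2 * (a + b) * E := by
      have := pow_le_pow_left₀ hE.le h 2
      nlinarith [sq_nonneg (x - y)]
    exact le_of_mul_le_mul_right h1 hE

/-! ### The error estimate in terms of the consistency errors. -/

section Convergence

variable {n : ℕ} {Ω Γ : Set (Eu n)} {A : Eu n → Matrix (Fin n) (Fin n) ℝ}

/-- Split into the temporal error of `u` and the operator applied to `u - v`, so that only its
stability is needed for the spatial error. -/
lemma sinEnergy_sub_finOp_le {H : Type*} [NormedAddCommGroup H] [InnerProductSpace ℝ H]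
    [CompleteSpace H] {ι : Type*} [Fintype ι] {φ χ : ι → L2I ℝ} {C δ s : ℝ} (hC : 0 ≤ C)
    (hδ : 0 ≤ δ) (hs : 0 ≤ s)
    (hstab : ∀ v : L2I H, sinEnergy (finOp φ χ v) ≤ ENNReal.ofReal C * sinEnergy v)
    {u v : L2I H} (hu : sinEnergy (u - finOp φ χ u) ≤ ENNReal.ofReal δ)
    (hv : sinEnergy (u - v) ≤ ENNReal.ofReal s) :
    sinEnergy (u - finOp φ χ v) ≤ ENNReal.ofReal (2 * (δ + C * s)) := by
  have h : u - finOp φ χ v = (u - finOp φ χ u) + finOp φ χ (u - v) := by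
    rw [finOp_sub]; abel
  rw [h]
  refine (sinEnergy_add_le _ _).trans ?_
  rw [← two_mul_ofReal_add hδ (by positivity), ENNReal.ofReal_mul hC]
  gcongr
  exact (hstab _).trans (by gcongr)

/-- The error of the Galerkin method in terms of the temporal consistency error `δ` and of the
error `s` of the Ritz projection. -/
lemma sinEnergy_error_le {d r N p : ℕ} {K : Geometry.SimplicialComplex ℝ (Eu n)}
    (hN : 1 ≤ N) (hA : IsDiffusionCoefficient Ω A) {L P : H1D Ω Γ →L[ℝ] H1D Ω Γ}
    (hL : ∀ z w : H1D Ω Γ, aForm A z w = inner ℝ (L z) w)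
    (hP : IsRitzProjection A K p P) {f : TestSpace Ω Γ →ₗ[ℝ] ℝ} {u uh : L2I (H1D Ω Γ)}
    (hu : IsWeakSolution A f u) (huh : IsGalerkinSolution A f d r N K p uh)
    {g : L2I (L2 Ω)} (hg : IsEllipticImage A u g) {ι : Type*} [Fintype ι] {φ χ : ι → L2I ℝ}
    (hφ : ∀ i, φ i ∈ splineSub d r N) {C δ s : ℝ} (hC : 0 ≤ C) (hδ : 0 ≤ δ) (hs : 0 ≤ s)
    (hstab : ∀ v : L2I (L2 Ω), sinEnergy (finOp φ χ v) ≤ ENNReal.ofReal C * sinEnergy v)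
    (happrox : sinEnergy (toL2Q u - finOp φ χ (toL2Q u)) ≤ ENNReal.ofReal δ)
    (hcons : ∀ e : L2I (L2 Ω), sinEnergy e < ⊤ →
      inner ℝ (g - finOp φ χ g) (hilbertT e) ^ 2 ≤ δ * energy e)
    (hRitz : sinEnergy (toL2Q (u - P.compLp u)) ≤ ENNReal.ofReal s) :
    sinEnergy (toL2Q (u - uh)) ≤ ENNReal.ofReal (16 * (δ + C * s)) := by
  set w := finOp φ χ (P.compLp u) with hw
  set D := δ + C * s with hD
  have hD0 : 0 ≤ C * s := by positivity
  have hww : toL2Q w = finOp φ χ (toL2Q (P.compLp u)) := compLp_finOp φ χ (toL2 Ω Γ) _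
  have h1 : sinEnergy (toL2Q u - toL2Q w) ≤ ENNReal.ofReal (2 * D) := by
    rw [hww]
    refine sinEnergy_sub_finOp_le hC hδ hs hstab happrox ?_
    rw [← toL2Q_sub]; exact hRitz
  have h1t : sinEnergy (toL2Q u - toL2Q w) < ⊤ := h1.trans_lt ENNReal.ofReal_lt_top
  have het : uh - w ∈ trialSpace Ω Γ d r N K p :=
    Submodule.sub_mem _ huh.1 (finOp_compLp_mem_trialSpace hP hφ u)
  have hes := sinEnergy_lt_top_of_mem_trialSpace hN het
  have h1e : energy (toL2Q u - toL2Q w) ≤ 2 * D := by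
    rw [sinEnergy_eq h1t] at h1
    exact (ENNReal.ofReal_le_ofReal_iff (by positivity)).1 h1
  have h2 : energy (toL2Q (uh - w)) ≤ 2 * (2 * D + δ) := by
    have h := energy_discrete_error_le hN hA hL hP hu huh hg (χ := χ) hφ
    rw [← hw, ← hww] at h
    have hE := energy_nonneg (toL2Q (uh - w))
    refine le_two_mul_add_of_le_add hE (by positivity) hδ h
      ((timePairing_hilbertT_sq_le h1t hes).trans ?_) (hcons _ hes)
    exact mul_le_mul_of_nonneg_right h1e hE
  have h3 : toL2Q (u - uh) = (toL2Q u - toL2Q w) - toL2Q (uh - w) := by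
    rw [toL2Q_sub, toL2Q_sub]; abel
  rw [h3]
  refine (sinEnergy_sub_le _ _).trans ?_
  have h4 : sinEnergy (toL2Q (uh - w)) ≤ ENNReal.ofReal (6 * D) := by
    rw [sinEnergy_eq hes]
    exact ENNReal.ofReal_le_ofReal (by linarith)
  calc _ ≤ 2 * (ENNReal.ofReal (2 * D) + ENNReal.ofReal (6 * D)) := by gcongr
    _ = ENNReal.ofReal (2 * (2 * D + 6 * D)) :=
        two_mul_ofReal_add (by positivity) (by positivity)
    _ = _ := by congr 1; ring

lemma one_div_rpow_sq {N d : ℕ} (hd : 1 ≤ d) :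
    ((1 / (N : ℝ)) ^ ((d : ℝ) - 1 / 2)) ^ 2 = 1 / (N : ℝ) ^ (2 * d - 1) := by
  rw [← Real.rpow_natCast, ← Real.rpow_mul (by positivity), ← one_div_pow, ← Real.rpow_natCast]
  congr 1
  rw [Nat.cast_sub (by omega)]
  push_cast
  ring

end Convergence

end SpaceTime

end

theorem corollary3p2 {n : ℕ} (hn1 : 1 ≤ n) (hn3 : n ≤ 3)
    (Ω Γ : Set (SpaceTime.Eu n))
    (hΩ : SpaceTime.IsPolytopalLipschitzDomain Ω) (hΓ : SpaceTime.IsDirichletPart Ω Γ)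
    (A : SpaceTime.Eu n → Matrix (Fin n) (Fin n) ℝ) (hA : SpaceTime.IsDiffusionCoefficient Ω A)
    (d r p : ℕ) (hd : 2 ≤ d) (hr : r + 2 ≤ d) (hp : 1 ≤ p)
    (f : SpaceTime.TestSpace Ω Γ →ₗ[ℝ] ℝ) (hf : SpaceTime.IsBoundedFunctional f)
    (u : SpaceTime.L2I (SpaceTime.H1D Ω Γ)) (hu : SpaceTime.IsWeakSolution A f u)
    (hu_space : SpaceTime.normZeroLeftSobolev p (SpaceTime.toL2Q u) < ⊤)
    (hu_time : SpaceTime.MemSobolevTime d (SpaceTime.toL2Q u))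
    (hLu : ∃ g : SpaceTime.L2I (SpaceTime.L2 Ω),
      SpaceTime.IsEllipticImage A u g ∧ SpaceTime.MemSobolevTime (d - 1) g)
    (c : ℝ) (hc : 0 < c) :
    ∃ C : ℝ, 0 < C ∧
      ∀ (N : ℕ) (K : Geometry.SimplicialComplex ℝ (SpaceTime.Eu n))
        (P : SpaceTime.H1D Ω Γ →L[ℝ] SpaceTime.H1D Ω Γ)
        (uh : SpaceTime.L2I (SpaceTime.H1D Ω Γ)),
        1 ≤ N → SpaceTime.IsTriangulation K Ω →
        SpaceTime.IsRitzProjection A K p P →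
        SpaceTime.normZeroLeft (SpaceTime.toL2Q (u - P.compLp u)) ≤
          ENNReal.ofReal (c * SpaceTime.meshSize K ^ ((p : ℝ) + 1 / 2)) *
            SpaceTime.normZeroLeftSobolev p (SpaceTime.toL2Q u) →
        SpaceTime.IsGalerkinSolution A f d r N K p uh →
        SpaceTime.normZeroLeft (SpaceTime.toL2Q (u - uh)) ≤
          ENNReal.ofReal (C * ((1 / (N : ℝ)) ^ ((d : ℝ) - 1 / 2) +
            SpaceTime.meshSize K ^ ((p : ℝ) + 1 / 2))) := by
  obtain ⟨g, hg, hgt⟩ := hLu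
  obtain ⟨L, hL⟩ := hA.exists_ellipticL (Γ := Γ)
  have hus : SpaceTime.sinEnergy (SpaceTime.toL2Q u) < ⊤ :=
    (SpaceTime.normZeroLeft_lt_top_iff _).1 hu.1
  have hu0 := hu_time.isZeroSobolev_of_sinEnergy (by omega) hus
  obtain ⟨x, hx⟩ := hu0.exists_isPrim (by omega)
  -- The zero initial value of u passes to ℒ_x u; without it, splines vanishing at 0 would not
  -- approximate it with order d - 1.
  have hg0 : SpaceTime.IsZeroSobolev (d - 1) g :=
    hg.isZeroSobolev hΩ.isOpen hΓ hL (fun y z => by rw [← hL, ← hL, hA.aForm_symm])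
      (fun y => by rw [← hL]; exact hA.aForm_self_nonneg y) hx (by omega) hgt
  obtain ⟨C, hC, hop⟩ := SpaceTime.exists_timeOp hd hr hu0 hus hg0
  set S := (SpaceTime.normZeroLeftSobolev p (SpaceTime.toL2Q u)).toReal with hS
  -- The estimates bound the square of the norm by B(τ + M)², where B is the second summand; since B
  -- ≤ (1 + B)², the constant 1 + B works without a square root.
  refine ⟨1 + 16 * (C * (1 + c ^ 2 * S ^ 2)), by positivity,
    fun N K P uh hN _ hP hRitz huh => ?_⟩
  obtain ⟨ι, _, φ, χ, hφ, hstab, happrox, hcons⟩ := hop N hN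
  set M := SpaceTime.meshSize K ^ ((p : ℝ) + 1 / 2) with hM
  have hM0 : 0 ≤ M := Real.rpow_nonneg (SpaceTime.meshSize_nonneg K) _
  set τ := (1 / (N : ℝ)) ^ ((d : ℝ) - 1 / 2) with hτ
  have hτ0 : 0 ≤ τ := Real.rpow_nonneg (by positivity) _
  have hS0 : 0 ≤ S := ENNReal.toReal_nonneg
  have hδ : C / (N : ℝ) ^ (2 * d - 1) = C * τ ^ 2 := by
    rw [hτ, SpaceTime.one_div_rpow_sq (by omega)]; ring
  rw [hδ] at happrox hcons
  rw [← ENNReal.ofReal_toReal hu_space.ne, ← hS, ← ENNReal.ofReal_mul (by positivity),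
    SpaceTime.normZeroLeft_le_ofReal_iff _ (by positivity)] at hRitz
  rw [SpaceTime.normZeroLeft_le_ofReal_iff _ (by positivity)]
  refine (SpaceTime.sinEnergy_error_le hN hA hL hP hu huh hg hφ hC.le (by positivity)
    (by positivity) hstab happrox hcons hRitz).trans (ENNReal.ofReal_le_ofReal ?_)
  set B := 16 * (C * (1 + c ^ 2 * S ^ 2)) with hB
  have hB0 : 0 ≤ B := by positivity
  have h1 : 16 * (C * τ ^ 2 + C * (c * M * S) ^ 2) ≤ B * (τ + M) ^ 2 := by
    have e1 : τ ^ 2 ≤ (τ + M) ^ 2 := by gcongr; linarith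
    have e2 : M ^ 2 ≤ (τ + M) ^ 2 := by gcongr; linarith
    calc 16 * (C * τ ^ 2 + C * (c * M * S) ^ 2)
        = 16 * (C * (τ ^ 2 + c ^ 2 * S ^ 2 * M ^ 2)) := by ring
      _ ≤ 16 * (C * ((τ + M) ^ 2 + c ^ 2 * S ^ 2 * (τ + M) ^ 2)) := by gcongr
      _ = B * (τ + M) ^ 2 := by rw [hB]; ring
  refine h1.trans ?_
  rw [mul_pow]
  gcongr
  nlinarith
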